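/- **Theorem 1.3.** Let $n \ge 0$, let $\gamma$ be the standard Gaussian measure on $\mathbb{R}^n$, with density $q(x) = (2\pi)^{-n/2}e^{-|x|^2/2}$ where $|\cdot|$ is the Euclidean norm, and let $Z$ be a random vector with law $\gamma$. Let $X = (X_1,\dots,X_n)$ be a random vector in $\mathbb{R}^n$ whose law has a $C^\infty$-smooth density $p \ge 0$ with respect to Lebesgue measure and for which the relative Fisher information $$I(X|Z) = \int_{\mathbb{R}^n} \Big|\frac{\nabla p(x)}{p(x)} - \frac{\nabla q(x)}{q(x)}\Big|^2 p(x)\,dx$$ is finite (the integrand is read as $0$ where $p = 0$). Write $D(Y|Z)$ for the relative entropy of the law of $Y$ with respect to $\gamma$, that is $D(Y|Z) = \int r \log (r/q)\,dx$ if $Y$ has a density $r$ (and $+\infty$ if the law of $Y$ is not absolutely continuous). Put $\Delta(t) = t - \log(1+t)$ and $$\mathcal{T}(Y,Z) = \inf_\pi \iint \Delta(|x-z|)\,d\pi(x,z),$$ the infimum being over all probability measures $\pi$ on $\mathbb{R}^n\times\mathbb{R}^n$ whose marginals are the law of $Y$ and $\gamma$. Then $\mathbf{E}|X| < \infty$,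 so that the recentered vector $\bar X = (\bar X_1,\dots,\bar X_n)$, $$\bar X_1 = X_1 - \mathbf{E} X_1, \qquad \bar X_k = X_k - \mathbf{E}(X_k \mid X_1,\dots,X_{k-1}) \quad (2 \le k \le n),$$ is defined; the quantities $D(X|Z)$, $D(\bar X|Z)$ and $\mathcal{T}(\bar X,Z)$ are finite; and $$\frac12\, I(X|Z) - D(X|Z) \;\ge\; \frac{1}{256\,\pi^2}\,\frac{\mathcal{T}(\bar X,Z)^2}{D(\bar X|Z)},$$ with the convention $0/0 = 0$ on the right-hand side. -/

import Mathlib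

open MeasureTheory ProbabilityTheory InformationTheory
open scoped ENNReal Gradient

noncomputable section

/-- The function `Δ(t) = t - log (1 + t)`, for `t > -1`. -/
def Delta (t : ℝ) : ℝ := t - Real.log (1 + t)

/-- The density of the standard Gaussian measure `γ` on `ℝⁿ` with respect to Lebesgue measure. -/
def gaussDensity (n : ℕ) (x : EuclideanSpace ℝ (Fin n)) : ℝ :=
  (2 * Real.pi) ^ (-(n : ℝ) / 2) * Real.exp (-‖x‖ ^ 2 / 2)

/-- The standard Gaussian measure `γ` has density `gaussDensity`. -/
theorem stdGaussian_eq_withDensity (n : ℕ) :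
    stdGaussian (EuclideanSpace ℝ (Fin n)) =
      volume.withDensity (fun x => ENNReal.ofReal (gaussDensity n x)) := by
  have hnn : ∀ x, 0 ≤ gaussDensity n x := fun x => by unfold gaussDensity; positivity
  have hcont : Continuous (gaussDensity n) := by unfold gaussDensity; fun_prop
  have key : ∀ t : EuclideanSpace ℝ (Fin n),
      ∫ x, (gaussDensity n x : ℂ) * Complex.exp (inner ℝ x t * Complex.I)
        = Complex.exp (-‖t‖ ^ 2 / 2) := by
    intro t
    have h := GaussianFourier.integral_cexp_neg_mul_sq_norm_add_of_euclideanSpace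
      (b := (1 / 2 : ℂ)) (by norm_num) Complex.I t
    have e : ∀ x : EuclideanSpace ℝ (Fin n),
        (gaussDensity n x : ℂ) * Complex.exp (inner ℝ x t * Complex.I)
        = (((2 * Real.pi) ^ (-(n : ℝ) / 2) : ℝ) : ℂ) *
          Complex.exp (-(1 / 2) * ‖x‖ ^ 2 + Complex.I * inner ℝ t x) := by
      intro x
      rw [gaussDensity, Complex.exp_add, real_inner_comm]
      push_cast
      rw [mul_assoc]
      congr 3 <;> ring_nf
    simp_rw [e]
    rw [integral_const_mul, h, ← mul_assoc]
    have h1 : (((2 * Real.pi) ^ (-(n : ℝ) / 2) : ℝ) : ℂ) *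
        ((Real.pi : ℂ) / (1 / 2)) ^ ((Fintype.card (Fin n) : ℂ) / 2) = 1 := by
      have : ((Real.pi : ℂ) / (1 / 2)) ^ ((Fintype.card (Fin n) : ℂ) / 2)
          = (((2 * Real.pi) ^ ((n : ℝ) / 2) : ℝ) : ℂ) := by
        rw [Complex.ofReal_cpow (by positivity)]
        push_cast
        rw [Fintype.card_fin]
        congr 1
        ring
      rw [this, ← Complex.ofReal_mul, ← Real.rpow_add (by positivity)]
      simp [neg_div]
    rw [h1, one_mul]
    congr 1
    simp
    ring
  have hint : Integrable (gaussDensity n) volume := by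
    by_contra hc
    have h0 := key 0
    simp only [inner_zero_right, Complex.ofReal_zero, zero_mul, Complex.exp_zero, mul_one,
      norm_zero] at h0
    rw [integral_complex_ofReal, integral_undef hc] at h0
    simp at h0
  have : IsFiniteMeasure (volume.withDensity (fun x => ENNReal.ofReal (gaussDensity n x))) :=
    isFiniteMeasure_withDensity_ofReal hint.2
  refine Measure.ext_of_charFun ?_
  ext t
  rw [charFun_stdGaussian, charFun_apply, integral_withDensity_eq_integral_toReal_smul
    (by fun_prop) (by simp)]
  simp_rw [ENNReal.toReal_ofReal (hnn _), Complex.real_smul]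
  exact (key t).symm

/-- The relative Fisher information
`∫ |∇p / p - ∇q / q|² p dx ∈ [0, ∞]` of a density `p` with respect to a density `q`.
The integrand is `0` at the points where `p` vanishes. -/
def fisherInfo {n : ℕ} (p q : EuclideanSpace ℝ (Fin n) → ℝ) : ℝ≥0∞ :=
  ∫⁻ x, ENNReal.ofReal (‖(p x)⁻¹ • ∇ p x - (q x)⁻¹ • ∇ q x‖ ^ 2 * p x)

/-- The optimal transport cost between `μ` and `ν` for the cost function `Δ(|x - z|)`:
the infimum of the total cost over all couplings of `μ` and `ν`. -/
def transportCost {n : ℕ} (μ ν : Measure (EuclideanSpace ℝ (Fin n))) : ℝ≥0∞ :=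
  ⨅ (π : Measure (EuclideanSpace ℝ (Fin n) × EuclideanSpace ℝ (Fin n)))
    (_ : π.map Prod.fst = μ ∧ π.map Prod.snd = ν),
    ∫⁻ w, ENNReal.ofReal (Delta ‖w.1 - w.2‖) ∂π

/-- The σ-algebra generated by the coordinates `X_j`, `j < k`.
It is trivial when `k` is the first index. -/
@[reducible]
def pastSigma {Ω : Type*} {n : ℕ} (X : Ω → EuclideanSpace ℝ (Fin n)) (k : Fin n) :
    MeasurableSpace Ω :=
  ⨆ (j : Fin n) (_ : j < k), MeasurableSpace.comap (fun ω => X ω j) inferInstance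

/-- The recentered vector with coordinates `X_k - E (X_k | X_1, …, X_{k-1})`; for the first
coordinate the conditioning is trivial and the subtracted term is the mean. -/
def recenter {Ω : Type*} [MeasurableSpace Ω] (P : Measure Ω) {n : ℕ}
    (X : Ω → EuclideanSpace ℝ (Fin n)) : Ω → EuclideanSpace ℝ (Fin n) :=
  fun ω => WithLp.toLp 2 fun k => X ω k - (P[fun ω' => X ω' k | pastSigma X k]) ω

end

noncomputable section

open Set Filter Topology

/-- The standard Gaussian measure on the line. -/
abbrev gauss : Measure ℝ := gaussianReal 0 1

/-- The density of the standard Gaussian measure on the line. -/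
abbrev gpdf (x : ℝ) : ℝ := gaussianPDFReal 0 1 x

lemma gpdf_eq (x : ℝ) : gpdf x = (√(2 * Real.pi))⁻¹ * Real.exp (-x ^ 2 / 2) := by
  simp [gpdf, gaussianPDFReal]

lemma gpdf_pos (x : ℝ) : 0 < gpdf x := gaussianPDFReal_pos _ _ _ (by simp)

lemma hasDerivAt_gpdf (x : ℝ) : HasDerivAt gpdf (-x * gpdf x) x := by
  have h : HasDerivAt (fun x : ℝ => -x ^ 2 / 2) (-x) x := by
    refine ((hasDerivAt_pow 2 x).neg.div_const 2).congr_deriv ?_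
    push_cast; ring
  have h2 := (h.exp).const_mul (√(2 * Real.pi))⁻¹
  have e : gpdf = fun x => (√(2 * Real.pi))⁻¹ * Real.exp (-x ^ 2 / 2) := funext gpdf_eq
  rw [e]; exact h2.congr_deriv (by simp only; ring)

lemma continuous_gpdf : Continuous gpdf :=
  continuous_iff_continuousAt.2 fun x => (hasDerivAt_gpdf x).continuousAt

lemma gpdf_neg (x : ℝ) : gpdf (-x) = gpdf x := by simp [gpdf_eq]

lemma gauss_eq : gauss = volume.withDensity (fun x => ENNReal.ofReal (gpdf x)) := by
  rw [gauss, gaussianReal_of_var_ne_zero _ (by simp)]; rfl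

lemma integral_gauss (h : ℝ → ℝ) : ∫ x, h x ∂gauss = ∫ x, h x * gpdf x := by
  rw [gauss, integral_gaussianReal_eq_integral_smul (by simp)]
  simp [mul_comm]

lemma lintegral_gauss {h : ℝ → ℝ≥0∞} (hh : AEMeasurable h) :
    ∫⁻ x, h x ∂gauss = ∫⁻ x, h x * ENNReal.ofReal (gpdf x) := by
  rw [gauss_eq, lintegral_withDensity_eq_lintegral_mul₀' (by fun_prop)]
  · simp [mul_comm]
  · exact hh.mono_ac (withDensity_absolutelyContinuous _ _)

lemma integrable_gauss_iff (h : ℝ → ℝ) :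
    Integrable h gauss ↔ Integrable (fun x => h x * gpdf x) := by
  rw [gauss_eq, integrable_withDensity_iff (by fun_prop) (by simp)]
  simp [ENNReal.toReal_ofReal (gpdf_pos _).le]

instance : NullSingletonClass gauss := nullSingletonClass_gaussianReal (by simp)

lemma integrable_id_gauss : Integrable (fun x : ℝ => x) gauss :=
  (memLp_id_gaussianReal 1).integrable le_rfl

lemma integrable_sq_gauss : Integrable (fun x : ℝ => x ^ 2) gauss :=
  (memLp_id_gaussianReal 2).integrable_sq

lemma integral_id_gauss : ∫ x, x ∂gauss = 0 := integral_id_gaussianReal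

lemma integral_sq_gauss : ∫ x, x ^ 2 ∂gauss = 1 := by
  have h := variance_id_gaussianReal (μ := 0) (v := 1)
  rw [variance_eq_sub (memLp_id_gaussianReal 2)] at h
  simpa [integral_id_gaussianReal] using h

lemma integrable_abs_gauss : Integrable (fun x : ℝ => |x|) gauss := integrable_id_gauss.abs

lemma integral_abs_gauss_le : ∫ x, |x| ∂gauss ≤ 1 := by
  have : ∫ x, |x| ∂gauss ≤ ∫ x, (x ^ 2 + 1) / 2 ∂gauss := by
    refine integral_mono integrable_abs_gauss ((integrable_sq_gauss.add (integrable_const _)).div_const 2)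
      fun x => ?_
    have : 0 ≤ (|x| - 1) ^ 2 := sq_nonneg _
    have h2 := sq_abs x
    simp only; nlinarith
  rw [integral_div, integral_add integrable_sq_gauss (integrable_const _), integral_sq_gauss] at this
  simpa using this

lemma integrable_exp_abs_gauss : Integrable (fun x : ℝ => Real.exp |x|) gauss := by
  refine Integrable.mono' ((integrable_exp_mul_gaussianReal (μ := 0) (v := 1) 1).add
    (integrable_exp_mul_gaussianReal (μ := 0) (v := 1) (-1))) (by fun_prop) (ae_of_all _ fun x => ?_)
  rw [Real.norm_of_nonneg (Real.exp_pos _).le]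
  simp only [Pi.add_apply, one_mul, neg_mul]
  rcases abs_cases x with ⟨h, _⟩ | ⟨h, _⟩ <;> rw [h] <;> linarith [Real.exp_pos x, Real.exp_pos (-x)]

lemma continuous_cdf {μ : Measure ℝ} [IsProbabilityMeasure μ] [NullSingletonClass μ] :
    Continuous (cdf μ) := by
  refine continuous_iff_continuousAt.2 fun x => ?_
  rw [(monotone_cdf μ).continuousAt_iff_leftLim_eq_rightLim, (cdf μ).rightLim_eq]
  have h : (cdf μ).measure {x} = 0 := by rw [measure_cdf]; simp
  rw [StieltjesFunction.measure_singleton, ENNReal.ofReal_eq_zero] at h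
  exact le_antisymm ((monotone_cdf μ).leftLim_le le_rfl) (by linarith)

lemma measure_cdf_le {μ : Measure ℝ} [IsProbabilityMeasure μ] [NullSingletonClass μ] {y : ℝ}
    (h0 : 0 < y) (h1 : y < 1) : μ {t | cdf μ t ≤ y} = ENNReal.ofReal y := by
  have hb : ∃ b, y < cdf μ b := ((tendsto_cdf_atTop μ).eventually (lt_mem_nhds h1)).exists
  have ha : ∃ a, cdf μ a < y := ((tendsto_cdf_atBot μ).eventually (gt_mem_nhds h0)).exists
  obtain ⟨b, hb⟩ := hb
  obtain ⟨a, ha⟩ := ha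
  set S := {t | cdf μ t ≤ y}
  have hbdd : BddAbove S := ⟨b, fun t ht => by
    by_contra hc
    exact absurd (hb.trans_le ((monotone_cdf μ) (not_le.1 hc).le)) (not_lt.2 ht)⟩
  have hcl : IsClosed S := isClosed_le continuous_cdf continuous_const
  have hne : S.Nonempty := ⟨a, ha.le⟩
  have hmem : sSup S ∈ S := hcl.csSup_mem hne hbdd
  have hS : S = Iic (sSup S) := by
    ext t
    exact ⟨fun h => le_csSup hbdd h, fun h => ((monotone_cdf μ) h).trans hmem⟩
  have hval : cdf μ (sSup S) = y := by
    refine le_antisymm hmem ?_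
    obtain ⟨c, -, hc⟩ := intermediate_value_univ a b (continuous_cdf (μ := μ)) ⟨ha.le, hb.le⟩
      |> fun ⟨c, hc⟩ => (⟨c, trivial, hc⟩ : ∃ c, True ∧ cdf μ c = y)
    rw [← hc]
    exact (monotone_cdf μ) (le_csSup hbdd hc.le)
  rw [hS, ← ofReal_cdf, hval]

lemma hasDerivAt_cdf_withDensity {p : ℝ → ℝ} (hp : Continuous p) (hp0 : ∀ x, 0 ≤ p x)
    (hpi : Integrable p) [IsProbabilityMeasure (volume.withDensity fun x => ENNReal.ofReal (p x))]
    (x : ℝ) : HasDerivAt (cdf (volume.withDensity fun x => ENNReal.ofReal (p x))) (p x) x := by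
  have e : ∀ y, cdf (volume.withDensity fun x => ENNReal.ofReal (p x)) y
      = (∫ t in Iic x, p t) + ∫ t in x..y, p t := by
    intro y
    rw [cdf_eq_real, measureReal_def, withDensity_apply _ measurableSet_Iic,
      ← ofReal_integral_eq_lintegral_ofReal hpi.integrableOn (ae_of_all _ hp0),
      ENNReal.toReal_ofReal (setIntegral_nonneg measurableSet_Iic fun t _ => hp0 t),
      ← intervalIntegral.integral_Iic_sub_Iic hpi.integrableOn hpi.integrableOn]
    ring
  have h := (intervalIntegral.integral_hasDerivAt_right (hp.intervalIntegrable x x)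
    hp.stronglyMeasurable.stronglyMeasurableAtFilter hp.continuousAt).const_add (∫ t in Iic x, p t)
  exact h.congr_of_eventuallyEq (Eventually.of_forall e)

lemma hasDerivAt_cdf_gauss (x : ℝ) : HasDerivAt (cdf gauss) (gpdf x) x := by
  have h1 : IsProbabilityMeasure (volume.withDensity fun x => ENNReal.ofReal (gpdf x)) := by
    rw [← gauss_eq]; infer_instance
  rw [gauss_eq]
  exact hasDerivAt_cdf_withDensity continuous_gpdf (fun x => (gpdf_pos x).le)
    (integrable_gaussianPDFReal 0 1) x

lemma cdf_mem_Ioo {μ : Measure ℝ} (h : StrictMono (cdf μ)) (x : ℝ) : cdf μ x ∈ Ioo (0 : ℝ) 1 :=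
  ⟨(cdf_nonneg μ (x - 1)).trans_lt (h (by linarith)),
    (h (by linarith : x < x + 1)).trans_le (cdf_le_one μ _)⟩

lemma exists_cdf_eq {μ : Measure ℝ} [IsProbabilityMeasure μ] [NullSingletonClass μ] {y : ℝ}
    (hy : y ∈ Ioo (0 : ℝ) 1) : ∃ x, cdf μ x = y := by
  obtain ⟨b, hb⟩ := ((tendsto_cdf_atTop μ).eventually (lt_mem_nhds hy.2)).exists
  obtain ⟨a, ha⟩ := ((tendsto_cdf_atBot μ).eventually (gt_mem_nhds hy.1)).exists
  exact intermediate_value_univ a b (continuous_cdf (μ := μ)) ⟨ha.le, hb.le⟩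

lemma strictMono_cdf_gauss : StrictMono (cdf gauss) :=
  strictMono_of_hasDerivAt_pos hasDerivAt_cdf_gauss gpdf_pos

/-- The Gaussian quantile function. -/
def probit (y : ℝ) : ℝ := Function.invFun (cdf gauss) y

lemma probit_cdf (x : ℝ) : probit (cdf gauss x) = x :=
  Function.leftInverse_invFun strictMono_cdf_gauss.injective x

lemma cdf_probit {y : ℝ} (hy : y ∈ Ioo (0 : ℝ) 1) : cdf gauss (probit y) = y :=
  Function.invFun_eq (exists_cdf_eq hy)

lemma probit_le_iff {y z : ℝ} (hy : y ∈ Ioo (0 : ℝ) 1) : probit y ≤ z ↔ y ≤ cdf gauss z := by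
  rw [← strictMono_cdf_gauss.le_iff_le, cdf_probit hy]

lemma probit_of_notMem {y : ℝ} (hy : y ∉ Ioo (0 : ℝ) 1) : probit y = Classical.arbitrary ℝ :=
  Function.invFun_neg fun ⟨x, hx⟩ => hy (hx ▸ cdf_mem_Ioo strictMono_cdf_gauss x)

lemma measurable_probit : Measurable probit := by
  refine measurable_of_Iic fun z => ?_
  have : probit ⁻¹' Iic z = (Ioo 0 1 ∩ Iic (cdf gauss z)) ∪
      ((Ioo (0 : ℝ) 1)ᶜ ∩ {_y | Classical.arbitrary ℝ ≤ z}) := by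
    ext y
    by_cases hy : y ∈ Ioo (0 : ℝ) 1
    · have h0 := hy.1
      have h1 := hy.2
      simp [probit_le_iff hy, h0, h1]
    · simp only [mem_preimage, mem_Iic, probit_of_notMem hy, mem_union, mem_inter_iff, hy,
        false_and, mem_compl_iff, not_false_eq_true, true_and, mem_ofPred_eq, false_or]
  rw [this]
  exact (measurableSet_Ioo.inter measurableSet_Iic).union
    (measurableSet_Ioo.compl.inter (MeasurableSet.const _))

lemma ae_cdf_mem_Ioo (μ : Measure ℝ) [IsProbabilityMeasure μ] [NullSingletonClass μ] :
    ∀ᵐ t ∂μ, cdf μ t ∈ Ioo (0 : ℝ) 1 := by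
  have hle : ∀ y, 0 < y → y < 1 → μ {t | cdf μ t ≤ y} = ENNReal.ofReal y :=
    fun y => measure_cdf_le (μ := μ)
  have h0 : μ {t | cdf μ t ≤ 0} = 0 := by
    refine le_antisymm (le_of_forall_gt fun ε hε => ?_) bot_le
    obtain ⟨δ, hδ0, hδ⟩ := ENNReal.lt_iff_exists_real_btwn.1 (lt_min hε one_pos)
    have hd : 0 < δ := by
      have := hδ.1
      simpa using this
    have h1 : δ < 1 := by
      have := hδ.2.trans_le (min_le_right _ _)
      simpa using this
    calc μ {t | cdf μ t ≤ 0} ≤ μ {t | cdf μ t ≤ δ} := measure_mono fun t ht => le_trans ht hd.le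
      _ = ENNReal.ofReal δ := hle δ hd h1
      _ < ε := hδ.2.trans_le (min_le_left _ _)
  have h1 : μ {t | cdf μ t < 1}ᶜ = 0 := by
    rw [prob_compl_eq_zero_iff (measurableSet_lt (cdf μ).mono.measurable measurable_const)]
    refine le_antisymm prob_le_one (le_of_forall_lt fun c hc => ?_)
    obtain ⟨δ, hδ0, hδ⟩ := ENNReal.lt_iff_exists_real_btwn.1 hc
    have hd1 : δ < 1 := by simpa using hδ.2
    rcases le_or_gt δ 0 with h | h
    · rw [ENNReal.ofReal_of_nonpos h] at hδ
      exact absurd hδ.1 (by simp)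
    · calc c < ENNReal.ofReal δ := hδ.1
        _ = μ {t | cdf μ t ≤ δ} := (hle δ h hd1).symm
        _ ≤ _ := measure_mono fun t (ht : _ ≤ _) => lt_of_le_of_lt ht hd1
  have e0 : ∀ᵐ t ∂μ, ¬ cdf μ t ≤ 0 := by simpa [ae_iff] using h0
  have e1 : ∀ᵐ t ∂μ, cdf μ t < 1 := h1
  filter_upwards [e0, e1] with t a b using ⟨not_le.1 a, b⟩

lemma map_probit_cdf (μ : Measure ℝ) [IsProbabilityMeasure μ] [NullSingletonClass μ] :
    μ.map (fun t => probit (cdf μ t)) = gauss := by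
  have hm : Measurable fun t => probit (cdf μ t) := measurable_probit.comp (cdf μ).mono.measurable
  have : IsProbabilityMeasure (μ.map (fun t => probit (cdf μ t))) :=
    Measure.isProbabilityMeasure_map hm.aemeasurable
  refine Measure.ext_of_Iic _ _ fun z => ?_
  have hz := cdf_mem_Ioo strictMono_cdf_gauss z
  rw [Measure.map_apply hm measurableSet_Iic, ← ofReal_cdf,
    ← measure_cdf_le (μ := μ) hz.1 hz.2]
  refine measure_congr ?_
  filter_upwards [ae_cdf_mem_Ioo μ] with t ht
  exact propext (probit_le_iff ht)

/-- The Gaussian tail bound. -/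
lemma gauss_Ioi_le {t : ℝ} (ht : 0 ≤ t) : gauss.real (Ioi t) ≤ √(2 * Real.pi) * gpdf t := by
  have h1 : gauss.real (Ioi t) = ∫ x in Ioi t, gpdf x := by
    rw [measureReal_def, gauss, gaussianReal_apply_eq_integral _ (by simp),
      ENNReal.toReal_ofReal (setIntegral_nonneg measurableSet_Ioi fun x _ => (gpdf_pos x).le)]
  have hi := integrable_gaussianPDFReal 0 1
  have h2 : ∫ x in Ioi t, gpdf x ≤ ∫ x in Ioi t, √(2 * Real.pi) * gpdf t * gpdf (x - t) := by
    refine setIntegral_mono_on hi.integrableOn ((hi.comp_sub_right t).const_mul _).integrableOn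
      measurableSet_Ioi fun x hx => ?_
    rw [gpdf_eq, gpdf_eq, gpdf_eq]
    have hs : (0 : ℝ) < √(2 * Real.pi) := by positivity
    have : √(2 * Real.pi) * ((√(2 * Real.pi))⁻¹ * Real.exp (-t ^ 2 / 2)) *
        ((√(2 * Real.pi))⁻¹ * Real.exp (-(x - t) ^ 2 / 2)) =
        (√(2 * Real.pi))⁻¹ * Real.exp (-t ^ 2 / 2 + -(x - t) ^ 2 / 2) := by
      rw [Real.exp_add]; field_simp
    rw [this]
    gcongr
    have := mem_Ioi.1 hx
    nlinarith
  have h3 : ∫ x in Ioi t, √(2 * Real.pi) * gpdf t * gpdf (x - t)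
      ≤ ∫ x, √(2 * Real.pi) * gpdf t * gpdf (x - t) :=
    setIntegral_le_integral ((hi.comp_sub_right t).const_mul _)
      (ae_of_all _ fun x => by have := (gpdf_pos t).le; have := (gpdf_pos (x - t)).le; positivity)
  have h4 : ∫ x, √(2 * Real.pi) * gpdf t * gpdf (x - t) = √(2 * Real.pi) * gpdf t := by
    rw [integral_const_mul, integral_sub_right_eq_self (fun x => gpdf x),
      integral_gaussianPDFReal_eq_one _ (by simp), mul_one]
  linarith

/-- `∫_t^∞ x dγ(x) = q(t)`. -/
lemma setIntegral_Ioi_id_gauss (t : ℝ) : ∫ x in Ioi t, x * gpdf x = gpdf t := by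
  have hi : Integrable fun x : ℝ => x * gpdf x := (integrable_gauss_iff _).1 integrable_id_gauss
  have hlim : Tendsto (fun x => -gpdf x) atTop (𝓝 0) := by
    have : Tendsto (fun x : ℝ => -((√(2 * Real.pi))⁻¹ * Real.exp (-x ^ 2 / 2))) atTop
        (𝓝 (-((√(2 * Real.pi))⁻¹ * 0))) := by
      refine (Tendsto.const_mul _ (Real.tendsto_exp_atBot.comp ?_)).neg
      have h : Tendsto (fun x : ℝ => x ^ 2 / 2) atTop atTop :=
        (tendsto_pow_atTop (by norm_num)).atTop_div_const (by norm_num)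
      refine (tendsto_neg_atTop_atBot.comp h).congr fun x => ?_
      simp [neg_div]
    simpa [gpdf_eq] using this
  have h := integral_Ioi_of_hasDerivAt_of_tendsto' (a := t) (f := fun x => -gpdf x)
    (f' := fun x => x * gpdf x) (m := 0)
    (fun x _ => (hasDerivAt_gpdf x).neg.congr_deriv (by ring)) hi.integrableOn hlim
  simpa using h

lemma measurable_Delta : Measurable Delta := by unfold Delta; fun_prop

lemma Delta_zero : Delta 0 = 0 := by simp [Delta]

lemma hasDerivAt_Delta {t : ℝ} (ht : -1 < t) : HasDerivAt Delta (t / (1 + t)) t := by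
  have h1 : (1 : ℝ) + t ≠ 0 := by linarith
  have h := (hasDerivAt_id t).sub (((hasDerivAt_id t).const_add 1).log h1)
  refine h.congr_deriv ?_
  simp only [id]
  field_simp
  ring

lemma continuousOn_Delta : ContinuousOn Delta (Ioi (-1)) :=
  fun _ ht => (hasDerivAt_Delta ht).continuousAt.continuousWithinAt

lemma Delta_nonneg {t : ℝ} (ht : -1 < t) : 0 ≤ Delta t := by
  have := Real.log_le_sub_one_of_pos (by linarith : 0 < 1 + t)
  unfold Delta; linarith

lemma Delta_abs_nonneg (t : ℝ) : 0 ≤ Delta |t| := Delta_nonneg (by linarith [abs_nonneg t])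

lemma Delta_le_self {t : ℝ} (ht : 0 ≤ t) : Delta t ≤ t := by
  have := Real.log_nonneg (by linarith : 1 ≤ 1 + t)
  unfold Delta; linarith

lemma monotoneOn_Delta : MonotoneOn Delta (Ici 0) := by
  refine monotoneOn_of_deriv_nonneg (convex_Ici 0)
    (continuousOn_Delta.mono fun x (hx : 0 ≤ x) => (by linarith : (-1 : ℝ) < x)) ?_ ?_
  · intro x hx
    rw [interior_Ici] at hx
    exact (hasDerivAt_Delta (by linarith [mem_Ioi.1 hx])).differentiableAt.differentiableWithinAt
  · intro x hx
    rw [interior_Ici] at hx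
    have hx := mem_Ioi.1 hx
    rw [(hasDerivAt_Delta (by linarith)).deriv]
    positivity

lemma Delta_mono {s t : ℝ} (hs : 0 ≤ s) (hst : s ≤ t) : Delta s ≤ Delta t :=
  monotoneOn_Delta hs (hs.trans hst) hst

lemma convexOn_Delta : ConvexOn ℝ (Ici 0) Delta := by
  refine MonotoneOn.convexOn_of_deriv (convex_Ici 0)
    (continuousOn_Delta.mono fun x (hx : 0 ≤ x) => (by linarith : (-1 : ℝ) < x)) ?_ ?_
  · intro x hx
    rw [interior_Ici] at hx
    exact (hasDerivAt_Delta (by linarith [mem_Ioi.1 hx])).differentiableAt.differentiableWithinAt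
  · intro x hx y hy hxy
    rw [interior_Ici] at hx hy
    have hx := mem_Ioi.1 hx
    have hy := mem_Ioi.1 hy
    rw [(hasDerivAt_Delta (by linarith)).deriv, (hasDerivAt_Delta (by linarith)).deriv,
      div_le_div_iff₀ (by linarith) (by linarith)]
    nlinarith

lemma Delta_mul_le_of_le_one {l a : ℝ} (hl0 : 0 ≤ l) (hl : l ≤ 1) (ha : 0 ≤ a) :
    Delta (l * a) ≤ l * Delta a := by
  have := convexOn_Delta.2 (show (0 : ℝ) ∈ Ici 0 by simp) (show a ∈ Ici 0 from ha)
    (show 0 ≤ 1 - l by linarith) hl0 (by ring)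
  simpa [Delta_zero] using this

lemma Delta_mul_le_sq {l a : ℝ} (hl : 1 ≤ l) (ha : 0 ≤ a) : Delta (l * a) ≤ l ^ 2 * Delta a := by
  have hd : ∀ x : ℝ, 0 ≤ x → HasDerivAt (fun x => l ^ 2 * Delta x - Delta (l * x))
      (l ^ 2 * (x / (1 + x)) - (l * x) / (1 + l * x) * l) x := fun x hx => by
    have hlx : 0 ≤ l * x := by positivity
    have h2 : HasDerivAt (fun x => l * x) l x := by simpa using (hasDerivAt_id x).const_mul l
    exact ((hasDerivAt_Delta (by linarith)).const_mul _).sub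
      (HasDerivAt.comp x (hasDerivAt_Delta (by linarith : -1 < l * x)) h2)
  have hm : MonotoneOn (fun x => l ^ 2 * Delta x - Delta (l * x)) (Ici 0) := by
    refine monotoneOn_of_deriv_nonneg (convex_Ici 0)
      (fun x hx => (hd x hx).continuousAt.continuousWithinAt) ?_ ?_
    · intro x hx
      rw [interior_Ici] at hx
      exact (hd x (le_of_lt hx)).differentiableAt.differentiableWithinAt
    · intro x hx
      rw [interior_Ici] at hx
      have hx := mem_Ioi.1 hx
      rw [(hd x hx.le).deriv]
      have h1 : x / (1 + l * x) ≤ x / (1 + x) := by gcongr; nlinarith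
      have : l * x / (1 + l * x) * l = l ^ 2 * (x / (1 + l * x)) := by ring
      rw [this]
      nlinarith [sq_nonneg l]
  have := hm (by simp : (0 : ℝ) ∈ Ici 0) ha ha
  simp [Delta_zero] at this
  linarith

lemma Delta_mul_le {l a : ℝ} (hl : 0 ≤ l) (ha : 0 ≤ a) :
    Delta (l * a) ≤ l * (max 1 l * Delta a) := by
  have hD := Delta_nonneg (by linarith : -1 < a)
  rcases le_total l 1 with h | h
  · rw [max_eq_left h, one_mul]; exact Delta_mul_le_of_le_one hl h ha
  · rw [max_eq_right h]; linarith [Delta_mul_le_sq h ha]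

lemma Delta_abs_le {t : ℝ} (ht : -1 < t) : Delta |t| ≤ Delta t := by
  rcases le_total 0 t with h | h
  · rw [abs_of_nonneg h]
  have hd : ∀ x : ℝ, x ∈ Ico (0 : ℝ) 1 → HasDerivAt (fun x => Delta (-x) - Delta x)
      ((-x) / (1 + -x) * (-1) - x / (1 + x)) x := fun x hx =>
    (HasDerivAt.comp x (hasDerivAt_Delta (by linarith [hx.2] : -1 < -x)) (hasDerivAt_neg x)).sub
      (hasDerivAt_Delta (by linarith [hx.1]))
  have hm : MonotoneOn (fun x => Delta (-x) - Delta x) (Ico 0 1) := by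
    refine monotoneOn_of_deriv_nonneg (convex_Ico 0 1)
      (fun x hx => (hd x hx).continuousAt.continuousWithinAt) ?_ ?_
    · intro x hx
      rw [interior_Ico] at hx
      exact (hd x ⟨hx.1.le, hx.2⟩).differentiableAt.differentiableWithinAt
    · intro x hx
      rw [interior_Ico] at hx
      rw [(hd x ⟨hx.1.le, hx.2⟩).deriv]
      have h1 := hx.1
      have h2 := hx.2
      have : x / (1 + x) ≤ x / (1 + -x) := by gcongr <;> linarith
      have e : (-x) / (1 + -x) * (-1) = x / (1 + -x) := by ring
      rw [e]; linarith
  have := hm (by simp : (0 : ℝ) ∈ Ico 0 1) (⟨by linarith, by linarith⟩ : -t ∈ Ico (0 : ℝ) 1)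
    (by linarith)
  simp at this
  rw [abs_of_nonpos h]
  linarith

/-- Subadditivity of `Δ` along the Euclidean norm. -/
lemma Delta_norm_le {n : ℕ} (v : EuclideanSpace ℝ (Fin n)) : Delta ‖v‖ ≤ ∑ k, Delta |v k| := by
  rcases (norm_nonneg v).eq_or_lt with h | h
  · rw [← h, Delta_zero]; exact Finset.sum_nonneg fun k _ => Delta_abs_nonneg _
  have hk : ∀ k, (|v k| / ‖v‖) ^ 2 * Delta ‖v‖ ≤ Delta |v k| := fun k => by
    rcases (abs_nonneg (v k)).eq_or_lt with h0 | h0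
    · rw [← h0]; simp [Delta_zero]
    have hle : |v k| ≤ ‖v‖ := by simpa using PiLp.norm_apply_le v k
    have := Delta_mul_le_sq (l := ‖v‖ / |v k|) (a := |v k|) ((one_le_div h0).2 hle) h0.le
    rw [div_mul_cancel₀ _ h0.ne'] at this
    rw [div_pow] at this ⊢
    rw [div_mul_eq_mul_div, div_le_iff₀ (by positivity)]
    rw [div_mul_eq_mul_div, le_div_iff₀ (by positivity)] at this
    linarith
  calc Delta ‖v‖ = ∑ k, (|v k| / ‖v‖) ^ 2 * Delta ‖v‖ := by
        rw [← Finset.sum_mul]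
        simp_rw [div_pow, ← Finset.sum_div, sq_abs]
        have : ‖v‖ ^ 2 = ∑ k, v k ^ 2 := by simpa using EuclideanSpace.norm_sq_eq v
        rw [← this, div_self (by positivity), one_mul]
    _ ≤ _ := Finset.sum_le_sum fun k _ => hk k

lemma lintegral_Ici_two_add_abs_le {r : ℝ} (hr : 0 ≤ r) :
    ∫⁻ y in Ici r, ENNReal.ofReal (2 + |y|) ∂gauss
      ≤ ENNReal.ofReal ((2 * √(2 * Real.pi) + 1) * gpdf r) := by
  have hi : Integrable (fun y : ℝ => 2 + |y|) gauss := (integrable_const _).add integrable_abs_gauss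
  rw [← ofReal_integral_eq_lintegral_ofReal hi.integrableOn (ae_of_all _ fun y => by positivity)]
  refine ENNReal.ofReal_le_ofReal ?_
  rw [integral_Ici_eq_integral_Ioi, integral_add (integrable_const _) integrable_abs_gauss.integrableOn]
  have h1 : ∫ y in Ioi r, |y| ∂gauss = gpdf r := by
    rw [setIntegral_congr_fun (g := fun y => y) measurableSet_Ioi fun y hy =>
      abs_of_nonneg (hr.trans (le_of_lt hy)), ← integral_indicator measurableSet_Ioi,
      integral_gauss, ← setIntegral_Ioi_id_gauss r, ← integral_indicator measurableSet_Ioi]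
    congr 1; ext y
    by_cases hy : y ∈ Ioi r <;> simp [hy]
  rw [h1]
  have := gauss_Ioi_le hr
  simp only [integral_const, smul_eq_mul, measureReal_restrict_apply MeasurableSet.univ, univ_inter]
  linarith

lemma lintegral_tail_two_add_abs_le (t : ℝ) :
    ∫⁻ y in {y | |t| ≤ |y|}, ENNReal.ofReal (2 + |y|) ∂gauss
      ≤ ENNReal.ofReal (4 * Real.pi * gpdf t) := by
  have hs : {y : ℝ | |t| ≤ |y|} ⊆ Ici |t| ∪ Neg.neg ⁻¹' Ici |t| := fun y (hy : |t| ≤ |y|) => by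
    rcases abs_cases y with ⟨h, _⟩ | ⟨h, _⟩
    · left; rw [h] at hy; exact hy
    · right; rw [h] at hy; exact hy
  have hq : gpdf |t| = gpdf t := by rcases abs_choice t with h | h <;> simp [h, gpdf_neg]
  have h1 := lintegral_Ici_two_add_abs_le (abs_nonneg t)
  have h2 : ∫⁻ y in Neg.neg ⁻¹' Ici |t|, ENNReal.ofReal (2 + |y|) ∂gauss
      = ∫⁻ y in Ici |t|, ENNReal.ofReal (2 + |y|) ∂gauss := by
    have hm : gauss.map Neg.neg = gauss := by
      have := gaussianReal_map_neg (μ := 0) (v := 1)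
      simpa using this
    conv_rhs => rw [← hm]
    rw [setLIntegral_map measurableSet_Ici (by fun_prop) measurable_neg]
    simp
  calc _ ≤ ∫⁻ y in Ici |t| ∪ Neg.neg ⁻¹' Ici |t|, ENNReal.ofReal (2 + |y|) ∂gauss :=
        lintegral_mono_set hs
    _ ≤ _ := lintegral_union_le _ _ _
    _ ≤ ENNReal.ofReal ((2 * √(2 * Real.pi) + 1) * gpdf t)
        + ENNReal.ofReal ((2 * √(2 * Real.pi) + 1) * gpdf t) := by
        rw [h2]; rw [hq] at h1; exact add_le_add h1 h1
    _ ≤ _ := by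
        have hp := gpdf_pos t
        rw [← ENNReal.ofReal_add (by positivity) (by positivity)]
        refine ENNReal.ofReal_le_ofReal ?_
        have h3 : √(2 * Real.pi) ≤ 2.6 := by
          rw [Real.sqrt_le_left (by norm_num)]
          have := Real.pi_lt_d2; norm_num at this ⊢; linarith
        have h4 := Real.pi_gt_d2
        have : 2 * (2 * √(2 * Real.pi) + 1) ≤ 4 * Real.pi := by linarith
        nlinarith

lemma Delta_abs_sub_le {h h' : ℝ → ℝ} (hd : ∀ x, HasDerivAt h (h' x) x) (hc : Continuous h')
    {x y : ℝ} (hxy : x < y) :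
    ENNReal.ofReal (Delta |h x - h y|) ≤ ENNReal.ofReal (1 + |x| + |y|) *
      ∫⁻ t in Ioc x y, ENNReal.ofReal (Delta |h' t|) := by
  set l := y - x with hl
  have hl0 : 0 < l := by linarith
  have hDc : ContinuousOn Delta (Ici 0) :=
    continuousOn_Delta.mono fun x (hx : 0 ≤ x) => (by linarith : (-1 : ℝ) < x)
  have hcD : ∀ c : ℝ, 0 ≤ c → Continuous fun t => Delta (c * |h' t|) := fun c hc0 =>
    hDc.comp_continuous (by fun_prop) fun t => by simp only [mem_Ici]; positivity
  have hcD1 : Continuous fun t => Delta |h' t| := by simpa using hcD 1 zero_le_one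
  have hvol : volume (Ioc x y) = ENNReal.ofReal l := by simp [hl]
  have hreal : volume.real (Ioc x y) = l := by rw [measureReal_def, hvol, ENNReal.toReal_ofReal hl0.le]
  have hJ := convexOn_Delta.map_set_average_le (μ := volume) (t := Ioc x y)
    (f := fun t => l * |h' t|) hDc isClosed_Ici (by simp [hxy]) (by simp)
    (ae_of_all _ fun t => by simp only [mem_Ici]; positivity)
    ((by fun_prop : Continuous fun t => l * |h' t|).integrableOn_Ioc)
    ((hcD l hl0.le).integrableOn_Ioc)
  rw [setAverage_eq, setAverage_eq, hreal, integral_const_mul, smul_eq_mul, smul_eq_mul,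
    inv_mul_cancel_left₀ hl0.ne'] at hJ
  have h1 : |h x - h y| ≤ ∫ t in Ioc x y, |h' t| := by
    have hftc := intervalIntegral.integral_eq_sub_of_hasDerivAt (a := x) (b := y)
      (fun t _ => hd t) (hc.intervalIntegrable _ _)
    rw [abs_sub_comm, ← hftc, ← intervalIntegral.integral_of_le hxy.le]
    exact intervalIntegral.abs_integral_le_integral_abs hxy.le
  have h2 : Delta |h x - h y| ≤ (1 + |x| + |y|) * ∫ t in Ioc x y, Delta |h' t| := by
    calc Delta |h x - h y| ≤ Delta (∫ t in Ioc x y, |h' t|) :=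
          Delta_mono (abs_nonneg _) h1
      _ ≤ l⁻¹ * ∫ t in Ioc x y, Delta (l * |h' t|) := hJ
      _ ≤ l⁻¹ * ∫ t in Ioc x y, l * (max 1 l * Delta |h' t|) := by
          refine mul_le_mul_of_nonneg_left ?_ (by positivity)
          exact setIntegral_mono_on (μ := volume) (hcD l hl0.le).integrableOn_Ioc
            (hcD1.const_mul _ |>.const_mul _).integrableOn_Ioc measurableSet_Ioc
            fun t _ => Delta_mul_le hl0.le (abs_nonneg _)
      _ = max 1 l * ∫ t in Ioc x y, Delta |h' t| := by
          rw [integral_const_mul, integral_const_mul, inv_mul_cancel_left₀ hl0.ne']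
      _ ≤ _ := by
          gcongr
          · exact setIntegral_nonneg measurableSet_Ioc fun t _ => Delta_abs_nonneg _
          · refine max_le (by linarith [abs_nonneg x, abs_nonneg y]) ?_
            linarith [le_abs_self y, neg_abs_le x]
  rw [← ofReal_integral_eq_lintegral_ofReal hcD1.integrableOn_Ioc
    (ae_of_all _ fun t => Delta_abs_nonneg _), ← ENNReal.ofReal_mul (by positivity)]
  exact ENNReal.ofReal_le_ofReal h2

lemma lintegral_fubini_kernel {μ ν : Measure ℝ} [SFinite μ] [SFinite ν] {K : ℝ → ℝ → ℝ → ℝ≥0∞}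
    {k : ℝ → ℝ≥0∞} (hK : Measurable fun z : ℝ × ℝ × ℝ => K z.1 z.2.1 z.2.2) (hk : Measurable k) :
    ∫⁻ x, ∫⁻ y, ∫⁻ t, K x y t * k t ∂ν ∂μ ∂μ = ∫⁻ t, (∫⁻ x, ∫⁻ y, K x y t ∂μ ∂μ) * k t ∂ν := by
  have hKkm : Measurable fun z : ℝ × ℝ × ℝ => K z.1 z.2.1 z.2.2 * k z.2.2 :=
    hK.mul (hk.comp (by fun_prop))
  calc _ = ∫⁻ x, ∫⁻ t, ∫⁻ y, K x y t * k t ∂μ ∂ν ∂μ := by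
        refine lintegral_congr fun x => ?_
        rw [lintegral_lintegral_swap]
        exact (hKkm.comp (by fun_prop : Measurable fun z : ℝ × ℝ => (x, z.1, z.2))).aemeasurable
    _ = ∫⁻ t, ∫⁻ x, ∫⁻ y, K x y t * k t ∂μ ∂μ ∂ν := by
        rw [lintegral_lintegral_swap]
        have : Measurable fun z : (ℝ × ℝ) × ℝ => K z.1.1 z.2 z.1.2 * k z.1.2 :=
          hKkm.comp (by fun_prop : Measurable fun z : (ℝ × ℝ) × ℝ => (z.1.1, z.2, z.1.2))
        exact this.lintegral_prod_right'.aemeasurable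
    _ = _ := by
        refine lintegral_congr fun t => ?_
        have hm2 : Measurable fun z : ℝ × ℝ => K z.1 z.2 t :=
          hK.comp (by fun_prop : Measurable fun z : ℝ × ℝ => (z.1, z.2, t))
        rw [← lintegral_mul_const _ hm2.lintegral_prod_right']
        refine lintegral_congr fun x => ?_
        rw [lintegral_mul_const]
        exact hm2.comp (by fun_prop : Measurable fun y : ℝ => (x, y))

/-- A Poincaré type inequality for the Gaussian measure on the line and the cost `Δ`. -/
lemma lintegral_Delta_le {h h' : ℝ → ℝ} (hd : ∀ x, HasDerivAt h (h' x) x) (hc : Continuous h')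
    (hi : Integrable h gauss) (h0 : ∫ x, h x ∂gauss = 0) :
    ∫⁻ x, ENNReal.ofReal (Delta |h x|) ∂gauss
      ≤ ENNReal.ofReal (8 * Real.pi) * ∫⁻ x, ENNReal.ofReal (Delta |h' x|) ∂gauss := by
  have hhc : Continuous h := continuous_iff_continuousAt.2 fun x => (hd x).continuousAt
  have hDc : ContinuousOn Delta (Ici 0) :=
    continuousOn_Delta.mono fun x (hx : 0 ≤ x) => (by linarith : (-1 : ℝ) < x)
  have hDabs : Continuous fun t => Delta |t| :=
    hDc.comp_continuous continuous_abs fun t => abs_nonneg t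
  have step1 : ∀ x, ENNReal.ofReal (Delta |h x|)
      ≤ ∫⁻ y, ENNReal.ofReal (Delta |h x - h y|) ∂gauss := fun x => by
    have hix : Integrable (fun y => h x - h y) gauss := (integrable_const _).sub hi
    have hiD : Integrable (fun y => Delta |h x - h y|) gauss :=
      hix.abs.mono' (hDabs.comp (by fun_prop : Continuous fun y => h x - h y)).aestronglyMeasurable
        (ae_of_all _ fun y => by
          rw [Real.norm_of_nonneg (Delta_abs_nonneg _)]; exact Delta_le_self (abs_nonneg _))
    have e1 : h x = ∫ y, (h x - h y) ∂gauss := by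
      rw [integral_sub (integrable_const _) hi, h0]; simp
    have h2 : |h x| ≤ ∫ y, |h x - h y| ∂gauss := by
      conv_lhs => rw [e1]
      exact abs_integral_le_integral_abs
    have hJ := convexOn_Delta.map_integral_le (μ := gauss) (f := fun y => |h x - h y|) hDc
      isClosed_Ici (ae_of_all _ fun y => mem_Ici.2 (abs_nonneg _)) hix.abs hiD
    rw [← ofReal_integral_eq_lintegral_ofReal hiD (ae_of_all _ fun y => Delta_abs_nonneg _)]
    exact ENNReal.ofReal_le_ofReal
      ((Delta_mono (abs_nonneg _) h2).trans hJ)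
  set k : ℝ → ℝ≥0∞ := fun t => ENNReal.ofReal (Delta |h' t|) with hk
  have hkm : Measurable k := (hDabs.comp hc).measurable.ennreal_ofReal
  let S : ℝ → Set ℝ := fun t => {y | |t| ≤ |y|}
  have hSm : ∀ t, MeasurableSet (S t) := fun t => measurableSet_le measurable_const (by fun_prop)
  have hS2 : MeasurableSet {z : ℝ × ℝ | |z.1| ≤ |z.2|} := measurableSet_le (by fun_prop) (by fun_prop)
  set K : ℝ → ℝ → ℝ → ℝ≥0∞ := fun x y t => ENNReal.ofReal (1 + |x| + |y|) *
    ((S t).indicator 1 x + (S t).indicator 1 y) with hK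
  have hind : Measurable fun z : ℝ × ℝ => (S z.1).indicator (1 : ℝ → ℝ≥0∞) z.2 := by
    have : (fun z : ℝ × ℝ => (S z.1).indicator (1 : ℝ → ℝ≥0∞) z.2)
        = {z : ℝ × ℝ | |z.1| ≤ |z.2|}.indicator 1 := by
      ext z; simp only [indicator, S, mem_ofPred_eq, Pi.one_apply]
    rw [this]; exact measurable_one.indicator hS2
  have hKm : Measurable fun z : ℝ × ℝ × ℝ => K z.1 z.2.1 z.2.2 := by
    refine Measurable.mul (by fun_prop) (Measurable.add ?_ ?_)
    · exact hind.comp (by fun_prop : Measurable fun z : ℝ × ℝ × ℝ => (z.2.2, z.1))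
    · exact hind.comp (by fun_prop : Measurable fun z : ℝ × ℝ × ℝ => (z.2.2, z.2.1))
  have step2 : ∀ x y, ENNReal.ofReal (Delta |h x - h y|) ≤ ∫⁻ t, K x y t * k t := by
    have key : ∀ x y, x < y → ENNReal.ofReal (Delta |h x - h y|) ≤ ∫⁻ t, K x y t * k t := by
      intro x y hxy
      refine (Delta_abs_sub_le hd hc hxy).trans ?_
      rw [← lintegral_const_mul _ hkm, ← lintegral_indicator measurableSet_Ioc]
      refine lintegral_mono fun t => ?_
      by_cases ht : t ∈ Ioc x y
      · simp only [ht, indicator_of_mem, hK]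
        gcongr
        have : (1 : ℝ≥0∞) ≤ (S t).indicator 1 x + (S t).indicator 1 y := by
          rcases le_total 0 t with h | h
          · have : y ∈ S t := by
              change |t| ≤ |y|
              rw [abs_of_nonneg h, abs_of_nonneg (h.trans ht.2)]; exact ht.2
            simp [this]
          · have : x ∈ S t := by
              change |t| ≤ |x|
              rw [abs_of_nonpos h, abs_of_nonpos (ht.1.le.trans h)]; linarith [ht.1]
            simp [this]
        calc _ = ENNReal.ofReal (1 + |x| + |y|) * 1 := by rw [mul_one]
          _ ≤ _ := by gcongr
      · simp [ht]
    intro x y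
    rcases lt_trichotomy x y with hxy | rfl | hxy
    · exact key x y hxy
    · simp [Delta_zero]
    · have := key y x hxy
      rw [abs_sub_comm] at this
      refine this.trans_eq (lintegral_congr fun t => ?_)
      simp only [hK]
      rw [add_comm (indicator _ _ _), show 1 + |y| + |x| = 1 + |x| + |y| by ring]
  have step3 : ∀ t, ∫⁻ x, ∫⁻ y, K x y t ∂gauss ∂gauss ≤ ENNReal.ofReal (8 * Real.pi * gpdf t) := by
    intro t
    have hone : ∀ x : ℝ, ∫⁻ y, ENNReal.ofReal (1 + |x| + |y|) ∂gauss ≤ ENNReal.ofReal (2 + |x|) := by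
      intro x
      have hi1 : Integrable (fun y : ℝ => 1 + |x| + |y|) gauss :=
        (integrable_const _).add integrable_abs_gauss
      rw [← ofReal_integral_eq_lintegral_ofReal hi1 (ae_of_all _ fun y => by positivity),
        integral_add (integrable_const _) integrable_abs_gauss]
      refine ENNReal.ofReal_le_ofReal ?_
      have := integral_abs_gauss_le
      simp only [integral_const, probReal_univ, smul_eq_mul, one_mul]
      linarith
    have hb : ∫⁻ x, (S t).indicator 1 x * ∫⁻ y, ENNReal.ofReal (1 + |x| + |y|) ∂gauss ∂gauss
        ≤ ENNReal.ofReal (4 * Real.pi * gpdf t) := by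
      refine le_trans ?_ (lintegral_tail_two_add_abs_le t)
      rw [← lintegral_indicator (hSm t)]
      refine lintegral_mono fun x => ?_
      by_cases hx : x ∈ S t
      · rw [indicator_of_mem hx, indicator_of_mem (show x ∈ {y | |t| ≤ |y|} from hx)]
        simpa using hone x
      · rw [indicator_of_notMem hx]; simp
    have hA : ∫⁻ x, ∫⁻ y, ENNReal.ofReal (1 + |x| + |y|) * (S t).indicator 1 x ∂gauss ∂gauss
        ≤ ENNReal.ofReal (4 * Real.pi * gpdf t) := by
      refine le_trans (le_of_eq (lintegral_congr fun x => ?_)) hb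
      rw [lintegral_mul_const _ (by fun_prop), mul_comm]
    have hB : ∫⁻ x, ∫⁻ y, ENNReal.ofReal (1 + |x| + |y|) * (S t).indicator 1 y ∂gauss ∂gauss
        ≤ ENNReal.ofReal (4 * Real.pi * gpdf t) := by
      rw [lintegral_lintegral_swap]
      · refine le_trans (le_of_eq ?_) hA
        refine lintegral_congr fun x => lintegral_congr fun y => ?_
        rw [show 1 + |y| + |x| = 1 + |x| + |y| by ring]
      · refine Measurable.aemeasurable ?_
        exact Measurable.mul (by fun_prop)
          ((measurable_one.indicator (hSm t)).comp measurable_snd)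
    have hpos := gpdf_pos t
    calc _ = ∫⁻ x, ∫⁻ y, (ENNReal.ofReal (1 + |x| + |y|) * (S t).indicator 1 x
          + ENNReal.ofReal (1 + |x| + |y|) * (S t).indicator 1 y) ∂gauss ∂gauss := by
          simp only [hK, mul_add]
      _ = (∫⁻ x, ∫⁻ y, ENNReal.ofReal (1 + |x| + |y|) * (S t).indicator 1 x ∂gauss ∂gauss)
          + ∫⁻ x, ∫⁻ y, ENNReal.ofReal (1 + |x| + |y|) * (S t).indicator 1 y ∂gauss ∂gauss := by
          rw [← lintegral_add_left]
          · refine lintegral_congr fun x => ?_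
            rw [lintegral_add_left]
            fun_prop
          · have : Measurable fun z : ℝ × ℝ =>
                ENNReal.ofReal (1 + |z.1| + |z.2|) * (S t).indicator 1 z.1 :=
              Measurable.mul (by fun_prop) ((measurable_one.indicator (hSm t)).comp measurable_fst)
            exact this.lintegral_prod_right'
      _ ≤ _ := add_le_add hA hB
      _ = _ := by rw [← ENNReal.ofReal_add (by positivity) (by positivity)]; ring_nf
  calc ∫⁻ x, ENNReal.ofReal (Delta |h x|) ∂gauss
      ≤ ∫⁻ x, ∫⁻ y, ∫⁻ t, K x y t * k t ∂volume ∂gauss ∂gauss :=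
        lintegral_mono fun x => (step1 x).trans (lintegral_mono fun y => step2 x y)
    _ = ∫⁻ t, (∫⁻ x, ∫⁻ y, K x y t ∂gauss ∂gauss) * k t := lintegral_fubini_kernel hKm hkm
    _ ≤ ∫⁻ t, ENNReal.ofReal (8 * Real.pi * gpdf t) * k t := by gcongr with t; exact step3 t
    _ = _ := by
        rw [lintegral_gauss hkm.aemeasurable, ← lintegral_const_mul _ (by fun_prop)]
        refine lintegral_congr fun t => ?_
        rw [ENNReal.ofReal_mul (by positivity)]; ring

/-- An integrable error term can be dropped in the limit. -/
lemma le_of_tendsto_of_integrable_error {a b ψ : ℝ → ℝ} {L R : ℝ} (ha : Tendsto a atTop (𝓝 L))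
    (hb : Tendsto b atTop (𝓝 R)) (hψ : Integrable ψ) (H : ∀ᶠ N in atTop, a N ≤ b N + ψ N) :
    L ≤ R := by
  by_contra hlt
  have hc : 0 < (L - R) / 2 := by linarith [not_le.1 hlt]
  have h1 : ∀ᶠ N in atTop, (L - R) / 2 < a N - b N :=
    (ha.sub hb).eventually (lt_mem_nhds (by linarith))
  obtain ⟨M, hM⟩ := (h1.and H).exists_forall_of_atTop
  have h2 : volume (Ici M) ≤ volume {x | (L - R) / 2 ≤ ψ x} :=
    measure_mono fun x hx => by
      have := hM x hx
      change (L - R) / 2 ≤ ψ x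
      linarith
  have h3 := hψ.measure_ge_lt_top hc
  rw [Real.volume_Ici] at h2
  exact absurd (h2.trans_lt h3) (lt_irrefl _)

lemma tendsto_intervalIntegral_neg_self {h : ℝ → ℝ} (hi : Integrable h) :
    Tendsto (fun N : ℝ => ∫ x in (-N)..N, h x) atTop (𝓝 (∫ x, h x)) :=
  intervalIntegral_tendsto_integral hi tendsto_neg_atTop_atBot tendsto_id

lemma lintegral_le_of_intervalIntegral_le {h b ψ : ℝ → ℝ} {R : ℝ} (hh : Continuous h)
    (h0 : ∀ x, 0 ≤ h x) (hb : Tendsto b atTop (𝓝 R)) (hψ : Integrable ψ)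
    (H : ∀ᶠ N in atTop, ∫ x in (-N)..N, h x ≤ b N + ψ N) :
    ∫⁻ x, ENNReal.ofReal (h x) ≤ ENNReal.ofReal R := by
  have hM : ∀ M : ℝ, 0 ≤ M → ∫⁻ x in Ioc (-M) M, ENNReal.ofReal (h x) ≤ ENNReal.ofReal R := by
    intro M hM
    rw [← ofReal_integral_eq_lintegral_ofReal hh.integrableOn_Ioc (ae_of_all _ h0),
      ← intervalIntegral.integral_of_le (by linarith)]
    refine ENNReal.ofReal_le_ofReal (le_of_tendsto_of_integrable_error tendsto_const_nhds hb hψ ?_)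
    filter_upwards [H, eventually_ge_atTop M] with N hN hMN
    refine le_trans ?_ hN
    exact intervalIntegral.integral_mono_interval (by linarith) (by linarith) hMN
      (ae_of_all _ h0) (hh.intervalIntegrable _ _)
  exact le_of_tendsto ((aecover_Ioc tendsto_neg_atTop_atBot tendsto_id
    (μ := volume)).lintegral_tendsto_of_countably_generated
      hh.measurable.ennreal_ofReal.aemeasurable)
    ((eventually_ge_atTop 0).mono fun M h => hM M h)

/-- Integration by parts for a primitive and a continuously differentiable function. -/
lemma integral_mul_eq_sub_of_primitive {f g w w' : ℝ → ℝ}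
    (hg : ∀ a b, IntervalIntegrable g volume a b) (hf : ∀ a b, f b - f a = ∫ t in a..b, g t)
    (hw : ∀ x, HasDerivAt w (w' x) x) (hw' : Continuous w') (a b : ℝ) :
    ∫ x in a..b, g x * w x = f b * w b - f a * w a - ∫ x in a..b, f x * w' x := by
  have e : f = fun x => f a + ∫ t in a..x, g t := by ext x; rw [← hf]; ring
  have hac : AbsolutelyContinuousOnInterval f a b := by
    rw [e]
    have hc : AbsolutelyContinuousOnInterval (fun _ : ℝ => f a) a b :=
      (contDiff_const (n := 1)).contDiffOn.absolutelyContinuousOnInterval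
    exact hc.add ((hg a b).absolutelyContinuousOnInterval_intervalIntegral left_mem_uIcc)
  have hdw : deriv w = w' := funext fun x => (hw x).deriv
  have hwac : AbsolutelyContinuousOnInterval w a b :=
    (contDiff_one_iff_deriv.2 ⟨fun x => (hw x).differentiableAt, by rw [hdw]; exact hw'⟩
      ).contDiffOn.absolutelyContinuousOnInterval
  have hibp := hac.integral_mul_deriv_eq_deriv_mul hwac
  have h2 : ∫ x in a..b, deriv f x * w x = ∫ x in a..b, g x * w x := by
    refine intervalIntegral.integral_congr_ae ?_
    filter_upwards [(hg a b).ae_hasDerivAt_integral] with x hx hxm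
    have h3 := (hx (uIoc_subset_uIcc hxm) a left_mem_uIcc).const_add (f a)
    rw [← e] at h3
    rw [h3.deriv]
  rw [h2, hdw] at hibp
  linarith

/-- The monotone transport map from the measure with density `f` with respect to the standard
Gaussian measure to the standard Gaussian measure. -/
def gaussTransport (f : ℝ → ℝ) (x : ℝ) : ℝ :=
  probit (∫⁻ t in Iic x, ENNReal.ofReal (f t) ∂gauss).toReal

/-- `f` is a probability density with respect to the standard Gaussian measure which is locally
absolutely continuous with derivative `g`, and whose Fisher information `∫ g² / f dγ` is finite. -/
structure FisherDensity (f g : ℝ → ℝ) : Prop where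
  nonneg : ∀ x, 0 ≤ f x
  meas : Measurable g
  intble : ∀ a b, IntervalIntegrable g volume a b
  ftc : ∀ a b, f b - f a = ∫ t in a..b, g t
  zero : ∀ x, f x = 0 → g x = 0
  mass : ∫⁻ x, ENNReal.ofReal (f x) ∂gauss = 1
  fisher : ∫⁻ x, ENNReal.ofReal (g x ^ 2 / f x) ∂gauss ≠ ∞

/-- The measure with density `f` with respect to the standard Gaussian measure. -/
abbrev gaussWith (f : ℝ → ℝ) : Measure ℝ := gauss.withDensity fun x => ENNReal.ofReal (f x)

lemma gaussTransport_eq_cdf (f : ℝ → ℝ) [IsProbabilityMeasure (gaussWith f)] (x : ℝ) :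
    gaussTransport f x = probit (cdf (gaussWith f) x) := by
  rw [gaussTransport, cdf_eq_real, measureReal_def, withDensity_apply _ measurableSet_Iic]

lemma nullSingletonClass_gaussWith (f : ℝ → ℝ) : NullSingletonClass (gaussWith f) :=
  ⟨fun x => withDensity_absolutelyContinuous _ _ (by simp)⟩

lemma measurable_gaussTransport (f : ℝ → ℝ) : Measurable (gaussTransport f) := by
  refine measurable_probit.comp (Measurable.ennreal_toReal (Monotone.measurable fun x y hxy => ?_))
  exact lintegral_mono_set (Iic_subset_Iic.2 hxy)

lemma map_gaussTransport {f : ℝ → ℝ} (hf : ∫⁻ x, ENNReal.ofReal (f x) ∂gauss = 1) :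
    (gaussWith f).map (gaussTransport f) = gauss := by
  have : IsProbabilityMeasure (gaussWith f) := ⟨by simpa using hf⟩
  have := nullSingletonClass_gaussWith f
  rw [← map_probit_cdf (gaussWith f)]
  exact congrArg (fun T => (gaussWith f).map T) (funext fun x => gaussTransport_eq_cdf f x)

lemma lintegral_gaussTransport {f : ℝ → ℝ} (hfm : Measurable f)
    (hf : ∫⁻ x, ENNReal.ofReal (f x) ∂gauss = 1) {h : ℝ → ℝ≥0∞} (hh : Measurable h) :
    ∫⁻ x, h (gaussTransport f x) * ENNReal.ofReal (f x) ∂gauss = ∫⁻ x, h x ∂gauss := by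
  conv_rhs => rw [← map_gaussTransport hf]
  rw [lintegral_map hh (measurable_gaussTransport f), lintegral_withDensity_eq_lintegral_mul]
  · simp [mul_comm]
  · fun_prop
  · exact hh.comp (measurable_gaussTransport f)

/-- A cheap form of the entropy inequality. -/
lemma mul_le_klFun_add_exp {s : ℝ} (hs : 0 ≤ s) (a : ℝ) : a * s ≤ klFun s + Real.exp a := by
  rcases hs.eq_or_lt with rfl | h
  · simp [klFun_zero]; positivity
  have h1 : Real.exp a = s * Real.exp (a - Real.log s) := by
    rw [Real.exp_sub, Real.exp_log h]; field_simp
  have h2 := Real.add_one_le_exp (a - Real.log s)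
  rw [klFun_apply, h1]
  nlinarith

namespace FisherDensity

variable {f g : ℝ → ℝ}

lemma cont (h : FisherDensity f g) : Continuous f := by
  have e : f = fun x => f 0 + ∫ t in (0 : ℝ)..x, g t := by ext x; rw [← h.ftc]; ring
  rw [e]
  exact continuous_const.add (intervalIntegral.continuous_primitive h.intble 0)

lemma isProbabilityMeasure (h : FisherDensity f g) : IsProbabilityMeasure (gaussWith f) :=
  ⟨by simpa using h.mass⟩

lemma integrable (h : FisherDensity f g) : Integrable f gauss := by
  refine ⟨h.cont.aestronglyMeasurable, ?_⟩
  rw [hasFiniteIntegral_iff_ofReal (ae_of_all _ h.nonneg), h.mass]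
  simp

lemma integral_eq_one (h : FisherDensity f g) : ∫ x, f x ∂gauss = 1 := by
  rw [integral_eq_lintegral_of_nonneg_ae (ae_of_all _ h.nonneg) h.cont.aestronglyMeasurable, h.mass]
  simp

lemma integrable_fisher (h : FisherDensity f g) : Integrable (fun x => g x ^ 2 / f x) gauss := by
  refine ⟨((h.meas.pow_const 2).div h.cont.measurable).aestronglyMeasurable, ?_⟩
  rw [hasFiniteIntegral_iff_ofReal (ae_of_all _ fun x => div_nonneg (sq_nonneg _) (h.nonneg x))]
  exact h.fisher.lt_top

lemma mul_le (h : FisherDensity f g) (x y : ℝ) :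
    |g x * y| ≤ g x ^ 2 / f x / 2 + f x * y ^ 2 / 2 := by
  rcases (h.nonneg x).eq_or_lt with h0 | h0
  · rw [h.zero x h0.symm, ← h0]; simp
  have : 0 ≤ (|g x| - f x * |y|) ^ 2 / f x := by positivity
  have e : (|g x| - f x * |y|) ^ 2 / f x = g x ^ 2 / f x - 2 * |g x * y| + f x * y ^ 2 := by
    rw [abs_mul, ← sq_abs (g x), ← sq_abs y]; field_simp; ring
  linarith

lemma integrable_deriv (h : FisherDensity f g) : Integrable g gauss := by
  refine ((h.integrable_fisher.div_const 2).add (h.integrable.div_const 2)).mono'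
    h.meas.aestronglyMeasurable (ae_of_all _ fun x => ?_)
  simpa using h.mul_le x 1

lemma integrable_comp_gaussTransport (h : FisherDensity f g) {u : ℝ → ℝ} (hu : Integrable u gauss)
    (hum : Measurable u) : Integrable (fun x => u (gaussTransport f x) * f x) gauss := by
  refine ⟨((hum.comp (measurable_gaussTransport f)).mul h.cont.measurable).aestronglyMeasurable, ?_⟩
  have := hu.2
  rw [HasFiniteIntegral, ← lintegral_gaussTransport h.cont.measurable h.mass (by fun_prop)] at this
  refine lt_of_le_of_lt (le_of_eq (lintegral_congr fun x => ?_)) this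
  rw [enorm_mul, Real.enorm_of_nonneg (h.nonneg x)]

lemma integral_comp_gaussTransport (h : FisherDensity f g) {u : ℝ → ℝ} (hum : Measurable u) :
    ∫ x, u (gaussTransport f x) * f x ∂gauss = ∫ x, u x ∂gauss := by
  conv_rhs => rw [← map_gaussTransport h.mass]
  rw [integral_map (measurable_gaussTransport f).aemeasurable hum.aestronglyMeasurable,
    integral_withDensity_eq_integral_toReal_smul
      h.cont.measurable.ennreal_ofReal (by simp)]
  refine integral_congr_ae (ae_of_all _ fun x => ?_)
  simp [ENNReal.toReal_ofReal (h.nonneg x), mul_comm]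

lemma integrable_id_mul (h : FisherDensity f g)
    (hD : Integrable (fun x => klFun (f x)) gauss) : Integrable (fun x => x * f x) gauss := by
  refine (hD.add integrable_exp_abs_gauss).mono'
    (by have := h.cont; fun_prop : Continuous fun x => x * f x).aestronglyMeasurable
    (ae_of_all _ fun x => ?_)
  rw [Real.norm_eq_abs, abs_mul, abs_of_nonneg (h.nonneg x)]
  exact mul_le_klFun_add_exp (h.nonneg x) |x|

/-- `∫ f' dγ = ∫ x f dγ`. -/
lemma integral_deriv_eq (h : FisherDensity f g) (hD : Integrable (fun x => klFun (f x)) gauss) :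
    ∫ x, g x ∂gauss = ∫ x, x * f x ∂gauss := by
  have hc := h.cont
  have i1 : Integrable fun x => g x * gpdf x := (integrable_gauss_iff _).1 h.integrable_deriv
  have i2 : Integrable fun x => x * f x * gpdf x :=
    (integrable_gauss_iff _).1 (h.integrable_id_mul hD)
  have i3 : Integrable fun x => f x * gpdf x := (integrable_gauss_iff _).1 h.integrable
  rw [integral_gauss, integral_gauss]
  have key : ∀ N : ℝ, (∫ x in (-N)..N, g x * gpdf x) - ∫ x in (-N)..N, x * f x * gpdf x
      = f N * gpdf N - f (-N) * gpdf (-N) := by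
    intro N
    rw [integral_mul_eq_sub_of_primitive h.intble h.ftc hasDerivAt_gpdf
      (by have := continuous_gpdf; fun_prop)]
    have : ∫ x in (-N)..N, f x * (-x * gpdf x) = - ∫ x in (-N)..N, x * f x * gpdf x := by
      rw [← intervalIntegral.integral_neg]; congr 1; ext x; ring
    rw [this]; ring
  have t1 := (tendsto_intervalIntegral_neg_self i1).sub (tendsto_intervalIntegral_neg_self i2)
  have i4 : Integrable fun N => f N * gpdf N + f (-N) * gpdf (-N) := i3.add i3.comp_neg
  have hp : ∀ x, 0 ≤ f x * gpdf x := fun x => mul_nonneg (h.nonneg x) (gpdf_pos x).le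
  have a1 := le_of_tendsto_of_integrable_error t1 (tendsto_const_nhds (x := (0 : ℝ))) i4
    (Eventually.of_forall fun N => by
      have := hp N; have := hp (-N)
      rw [key]; linarith)
  have a2 := le_of_tendsto_of_integrable_error t1.neg (tendsto_const_nhds (x := (0 : ℝ))) i4
    (Eventually.of_forall fun N => by
      have := hp N; have := hp (-N)
      rw [key]; linarith)
  linarith

end FisherDensity

lemma strictMonoOn_probit : StrictMonoOn probit (Ioo 0 1) := fun x hx y hy hxy => by
  rw [← strictMono_cdf_gauss.lt_iff_lt, cdf_probit hx, cdf_probit hy]; exact hxy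

lemma hasDerivAt_probit {y : ℝ} (hy : y ∈ Ioo (0 : ℝ) 1) :
    HasDerivAt probit (gpdf (probit y))⁻¹ y := by
  have himg : probit '' Ioo 0 1 = univ := eq_univ_of_forall fun z =>
    ⟨cdf gauss z, cdf_mem_Ioo strictMono_cdf_gauss z, probit_cdf z⟩
  have hc : ContinuousAt probit y :=
    strictMonoOn_probit.continuousAt_of_image_mem_nhds (Ioo_mem_nhds hy.1 hy.2) (by simp [himg])
  refine HasDerivAt.of_local_left_inverse hc (hasDerivAt_cdf_gauss _) (gpdf_pos _).ne' ?_
  filter_upwards [Ioo_mem_nhds hy.1 hy.2] with z hz using cdf_probit hz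

lemma log_gpdf (x : ℝ) : Real.log (gpdf x) = -Real.log (√(2 * Real.pi)) - x ^ 2 / 2 := by
  rw [gpdf_eq, Real.log_mul (by positivity) (Real.exp_pos _).ne', Real.log_exp, Real.log_inv]
  ring

namespace FisherDensity

variable {f g : ℝ → ℝ}

lemma gaussWith_eq (h : FisherDensity f g) :
    gaussWith f = volume.withDensity fun x => ENNReal.ofReal (f x * gpdf x) := by
  rw [gaussWith, gauss_eq, ← withDensity_mul _ (by fun_prop)
    h.cont.measurable.ennreal_ofReal]
  congr 1; ext x
  rw [Pi.mul_apply, mul_comm, ENNReal.ofReal_mul (h.nonneg x)]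

lemma hasDerivAt_cdf (h : FisherDensity f g) (x : ℝ) :
    HasDerivAt (cdf (gaussWith f)) (f x * gpdf x) x := by
  have := h.isProbabilityMeasure
  have hq := continuous_gpdf
  have hc := h.cont
  rw [h.gaussWith_eq] at this ⊢
  exact hasDerivAt_cdf_withDensity (by fun_prop)
    (fun x => mul_nonneg (h.nonneg x) (gpdf_pos x).le) ((integrable_gauss_iff _).1 h.integrable) x

section Pos

variable (h : FisherDensity f g) (hpos : ∀ x, 0 < f x)
include h hpos

lemma strictMono_cdf : StrictMono (cdf (gaussWith f)) :=
  strictMono_of_hasDerivAt_pos h.hasDerivAt_cdf fun x => mul_pos (hpos x) (gpdf_pos x)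

lemma hasDerivAt_gaussTransport (x : ℝ) :
    HasDerivAt (gaussTransport f) (f x * gpdf x / gpdf (gaussTransport f x)) x := by
  have := h.isProbabilityMeasure
  have e : gaussTransport f = probit ∘ cdf (gaussWith f) := funext fun x => gaussTransport_eq_cdf f x
  have h1 := HasDerivAt.comp x (hasDerivAt_probit (cdf_mem_Ioo (h.strictMono_cdf hpos) x))
    (h.hasDerivAt_cdf x)
  rw [← e, ← gaussTransport_eq_cdf] at h1
  exact h1.congr_deriv (by ring)

lemma continuous_gaussTransport : Continuous (gaussTransport f) :=
  continuous_iff_continuousAt.2 fun x => (h.hasDerivAt_gaussTransport hpos x).continuousAt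

lemma strictMono_gaussTransport : StrictMono (gaussTransport f) :=
  strictMono_of_hasDerivAt_pos (h.hasDerivAt_gaussTransport hpos)
    fun x => div_pos (mul_pos (hpos x) (gpdf_pos x)) (gpdf_pos _)

omit hpos in
lemma surjective_gaussTransport : Function.Surjective (gaussTransport f) := fun z => by
  have := h.isProbabilityMeasure
  have := nullSingletonClass_gaussWith f
  obtain ⟨x, hx⟩ := exists_cdf_eq (μ := gaussWith f) (cdf_mem_Ioo strictMono_cdf_gauss z)
  exact ⟨x, by rw [gaussTransport_eq_cdf, hx, probit_cdf]⟩

/-- The inverse of the transport map is differentiable. -/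
lemma exists_inverse : ∃ U : ℝ → ℝ, (∀ x, U (gaussTransport f x) = x) ∧
    (∀ z, HasDerivAt U (gpdf z / (f (U z) * gpdf (U z))) z) := by
  set e := (h.strictMono_gaussTransport hpos).orderIsoOfSurjective _
    (h.surjective_gaussTransport) with he
  have hT : ∀ x, e x = gaussTransport f x := fun x => rfl
  refine ⟨e.symm, fun x => by rw [← hT, e.symm_apply_apply], fun z => ?_⟩
  have hz : gaussTransport f (e.symm z) = z := by rw [← hT, e.apply_symm_apply]
  have h1 := HasDerivAt.of_local_left_inverse (e.symm.continuous.continuousAt (x := z))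
    (h.hasDerivAt_gaussTransport hpos (e.symm z))
    (div_pos (mul_pos (hpos _) (gpdf_pos _)) (gpdf_pos _)).ne'
    (Eventually.of_forall fun y => by rw [← hT, e.apply_symm_apply])
  rw [hz, inv_div] at h1
  exact h1

omit h hpos in
lemma integrable_bdry {T : ℝ → ℝ} {w : ℝ → ℝ} (hi : Integrable fun x => T x * w x)
    (hw : ∀ x, 0 ≤ w x) :
    Integrable fun N => |T N| * w N + |T (-N)| * w (-N) := by
  have : Integrable fun x => |T x| * w x := by
    refine hi.abs.congr (ae_of_all _ fun x => ?_)
    simp [abs_mul, abs_of_nonneg (hw x)]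
  exact this.add this.comp_neg

/-- The basic one-sided estimate behind the logarithmic Sobolev and HWI inequalities, on a bounded
interval. -/
lemma intervalIntegral_entropy_le {N : ℝ} (hN : 0 ≤ N) :
    ∫ x in (-N)..N, (f x * Real.log (f x) + f x * (x - gaussTransport f x) ^ 2 / 2) * gpdf x
      ≤ (∫ x in (-N)..N, g x * (x - gaussTransport f x) * gpdf x)
        + (|gaussTransport f N| * (f N * gpdf N)
          + |gaussTransport f (-N)| * (f (-N) * gpdf (-N))) := by
  set T := gaussTransport f with hT
  have hTc : Continuous T := h.continuous_gaussTransport hpos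
  have hqc := continuous_gpdf
  have hfc := h.cont
  set T' : ℝ → ℝ := fun x => f x * gpdf x / gpdf (T x) with hT'
  have hT'pos : ∀ x, 0 < T' x := fun x => div_pos (mul_pos (hpos x) (gpdf_pos x)) (gpdf_pos _)
  have hT'c : Continuous T' := by
    refine Continuous.div (by fun_prop) (by fun_prop) fun x => (gpdf_pos _).ne'
  have hlogc : Continuous fun x => Real.log (f x) := hfc.log fun x => (hpos x).ne'
  have hw : ∀ x, HasDerivAt (fun x => (x - T x) * gpdf x)
      ((1 - T' x) * gpdf x + (x - T x) * (-x * gpdf x)) x := fun x =>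
    ((hasDerivAt_id x).sub (h.hasDerivAt_gaussTransport hpos x)).mul (hasDerivAt_gpdf x)
  have ibp := integral_mul_eq_sub_of_primitive h.intble h.ftc hw (by fun_prop) (-N) N
  have e1 : ∫ x in (-N)..N, g x * (x - T x) * gpdf x
      = ∫ x in (-N)..N, g x * ((x - T x) * gpdf x) := by simp only [mul_assoc]
  have hpt : ∀ x, (f x * Real.log (f x) + f x * (x - T x) ^ 2 / 2) * gpdf x
      ≤ -(f x * ((1 - T' x) * gpdf x + (x - T x) * (-x * gpdf x))) := by
    intro x
    have hl : Real.log (T' x) = Real.log (f x) + (T x) ^ 2 / 2 - x ^ 2 / 2 := by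
      rw [hT', Real.log_div (mul_pos (hpos x) (gpdf_pos x)).ne' (gpdf_pos _).ne',
        Real.log_mul (hpos x).ne' (gpdf_pos x).ne', log_gpdf, log_gpdf]
      ring
    have h2 := Real.log_le_sub_one_of_pos (hT'pos x)
    have h3 : 0 ≤ f x * gpdf x * (T' x - 1 - Real.log (T' x)) :=
      mul_nonneg (mul_pos (hpos x) (gpdf_pos x)).le (by linarith)
    rw [hl] at h3
    nlinarith
  have hle : ∫ x in (-N)..N, (f x * Real.log (f x) + f x * (x - T x) ^ 2 / 2) * gpdf x
      ≤ ∫ x in (-N)..N, -(f x * ((1 - T' x) * gpdf x + (x - T x) * (-x * gpdf x))) :=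
    intervalIntegral.integral_mono_on (by linarith)
      ((by fun_prop : Continuous _).intervalIntegrable _ _)
      ((by fun_prop : Continuous _).intervalIntegrable _ _) fun x _ => hpt x
  rw [intervalIntegral.integral_neg] at hle
  have b1 : 0 ≤ N * (f N * gpdf N) := mul_nonneg hN (mul_pos (hpos _) (gpdf_pos _)).le
  have b2 : 0 ≤ N * (f (-N) * gpdf (-N)) := mul_nonneg hN (mul_pos (hpos _) (gpdf_pos _)).le
  have b3 : T N * (f N * gpdf N) ≤ |T N| * (f N * gpdf N) :=
    mul_le_mul_of_nonneg_right (le_abs_self _) (mul_pos (hpos _) (gpdf_pos _)).le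
  have b4 : -T (-N) * (f (-N) * gpdf (-N)) ≤ |T (-N)| * (f (-N) * gpdf (-N)) :=
    mul_le_mul_of_nonneg_right (neg_le_abs _) (mul_pos (hpos _) (gpdf_pos _)).le
  rw [e1, ibp]
  linarith

lemma integrable_bdry_gaussTransport : Integrable fun N =>
    |gaussTransport f N| * (f N * gpdf N) + |gaussTransport f (-N)| * (f (-N) * gpdf (-N)) := by
  refine integrable_bdry ?_ fun x => (mul_pos (hpos x) (gpdf_pos x)).le
  have := (integrable_gauss_iff _).1
    (h.integrable_comp_gaussTransport integrable_id_gauss measurable_id)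
  simpa [mul_assoc] using this

/-- The logarithmic Sobolev inequality for positive densities. -/
lemma entropy_le_of_pos : ∫⁻ x, ENNReal.ofReal (klFun (f x)) ∂gauss
    ≤ ENNReal.ofReal ((∫ x, g x ^ 2 / f x ∂gauss) / 2) := by
  set T := gaussTransport f with hT
  have hTc : Continuous T := h.continuous_gaussTransport hpos
  have hqc := continuous_gpdf
  have hfc := h.cont
  have hlogc : Continuous fun x => Real.log (f x) := hfc.log fun x => (hpos x).ne'
  have hkc : Continuous fun x => klFun (f x) := continuous_klFun.comp hfc
  have i1 : Integrable fun x => g x ^ 2 / f x * gpdf x :=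
    (integrable_gauss_iff _).1 h.integrable_fisher
  have i2 : Integrable fun x => f x * gpdf x := (integrable_gauss_iff _).1 h.integrable
  have i3 : Integrable gpdf := integrable_gaussianPDFReal 0 1
  rw [lintegral_gauss hkc.measurable.ennreal_ofReal.aemeasurable]
  simp_rw [← fun x => ENNReal.ofReal_mul (q := gpdf x) (klFun_nonneg (h.nonneg x))]
  have hb : Tendsto (fun N : ℝ => (∫ x in (-N)..N, g x ^ 2 / f x * gpdf x) / 2
      + ((∫ x in (-N)..N, gpdf x) - ∫ x in (-N)..N, f x * gpdf x)) atTop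
      (𝓝 ((∫ x, g x ^ 2 / f x ∂gauss) / 2)) := by
    have := ((tendsto_intervalIntegral_neg_self i1).div_const 2).add
      ((tendsto_intervalIntegral_neg_self i3).sub (tendsto_intervalIntegral_neg_self i2))
    rwa [← integral_gauss f, h.integral_eq_one, integral_gaussianPDFReal_eq_one _ (by simp), sub_self,
      add_zero, ← integral_gauss (fun x => g x ^ 2 / f x)] at this
  refine lintegral_le_of_intervalIntegral_le (by fun_prop)
    (fun x => mul_nonneg (klFun_nonneg (h.nonneg x)) (gpdf_pos x).le) hb
    (h.integrable_bdry_gaussTransport hpos) ?_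
  filter_upwards [eventually_ge_atTop 0] with N hN
  have key := h.intervalIntegral_entropy_le hpos hN
  have c1 : Continuous fun x => (f x * Real.log (f x) + f x * (x - T x) ^ 2 / 2) * gpdf x := by
    fun_prop
  have ig : IntervalIntegrable (fun x => g x * (x - T x) * gpdf x) volume (-N) N := by
    simp only [mul_assoc]
    exact (h.intble _ _).mul_continuousOn (by fun_prop : Continuous _).continuousOn
  have e1 : ∫ x in (-N)..N, klFun (f x) * gpdf x
      = (∫ x in (-N)..N, (f x * Real.log (f x) + f x * (x - T x) ^ 2 / 2) * gpdf x)
        - (∫ x in (-N)..N, f x * (x - T x) ^ 2 / 2 * gpdf x)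
        + ((∫ x in (-N)..N, gpdf x) - ∫ x in (-N)..N, f x * gpdf x) := by
    rw [← intervalIntegral.integral_sub (c1.intervalIntegrable _ _)
      ((by fun_prop : Continuous _).intervalIntegrable _ _),
      ← intervalIntegral.integral_sub (hqc.intervalIntegrable _ _)
      ((by fun_prop : Continuous _).intervalIntegrable _ _),
      ← intervalIntegral.integral_add ((by fun_prop : Continuous _).intervalIntegrable _ _)
      ((by fun_prop : Continuous _).intervalIntegrable _ _)]
    congr 1; ext x; rw [klFun_apply]; ring
  have e2 : ∫ x in (-N)..N, g x * (x - T x) * gpdf x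
      ≤ ∫ x in (-N)..N, (g x ^ 2 / f x * gpdf x / 2 + f x * (x - T x) ^ 2 / 2 * gpdf x) := by
    refine intervalIntegral.integral_mono_on (by linarith) ig
      (((i1.div_const 2).intervalIntegrable).add
        ((by fun_prop : Continuous _).intervalIntegrable _ _)) fun x _ => ?_
    have := (le_abs_self _).trans (h.mul_le x (x - T x))
    have hq := (gpdf_pos x).le
    calc _ ≤ (g x ^ 2 / f x / 2 + f x * (x - T x) ^ 2 / 2) * gpdf x := by gcongr
      _ = _ := by ring
  rw [intervalIntegral.integral_add (i1.div_const 2).intervalIntegrable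
    ((by fun_prop : Continuous _).intervalIntegrable _ _), intervalIntegral.integral_div] at e2
  rw [e1]
  linarith

end Pos

end FisherDensity

namespace FisherDensity

variable {f g : ℝ → ℝ}

lemma lintegral_comp_inverse (h : FisherDensity f g) {U : ℝ → ℝ}
    (hU : ∀ x, U (gaussTransport f x) = x) (hUm : Measurable U) {v : ℝ → ℝ≥0∞} (hv : Measurable v) :
    ∫⁻ z, v (U z) ∂gauss = ∫⁻ x, v x * ENNReal.ofReal (f x) ∂gauss := by
  rw [← lintegral_gaussTransport (h := fun z => v (U z)) h.cont.measurable h.mass (hv.comp hUm)]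
  simp [hU]

lemma integral_comp_inverse (h : FisherDensity f g) {U : ℝ → ℝ}
    (hU : ∀ x, U (gaussTransport f x) = x) (hUm : Measurable U) {v : ℝ → ℝ} (hv : Measurable v) :
    ∫ z, v (U z) ∂gauss = ∫ x, v x * f x ∂gauss := by
  rw [← h.integral_comp_gaussTransport (u := fun z => v (U z)) (hv.comp hUm)]
  simp [hU]

lemma integrable_comp_inverse (h : FisherDensity f g) {U : ℝ → ℝ}
    (hU : ∀ x, U (gaussTransport f x) = x) (hUm : Measurable U) {v : ℝ → ℝ} (hv : Measurable v)
    (hi : Integrable (fun x => v x * f x) gauss) : Integrable (fun z => v (U z)) gauss := by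
  refine ⟨(hv.comp hUm).aestronglyMeasurable, ?_⟩
  have := hi.2
  rw [HasFiniteIntegral] at this ⊢
  rw [h.lintegral_comp_inverse hU hUm (v := fun x => ‖v x‖ₑ) (by fun_prop)]
  refine lt_of_le_of_lt (le_of_eq (lintegral_congr fun x => ?_)) this
  rw [enorm_mul, Real.enorm_of_nonneg (h.nonneg x)]

lemma integrable_mul_log (h : FisherDensity f g) (hD : Integrable (fun x => klFun (f x)) gauss) :
    Integrable (fun x => f x * Real.log (f x)) gauss := by
  refine ((hD.add h.integrable).sub (integrable_const 1)).congr (ae_of_all _ fun x => ?_)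
  simp [klFun_apply]

lemma integral_klFun (h : FisherDensity f g) (hD : Integrable (fun x => klFun (f x)) gauss) :
    ∫ x, klFun (f x) ∂gauss = ∫ x, f x * Real.log (f x) ∂gauss := by
  have : ∀ x, klFun (f x) = f x * Real.log (f x) + (1 - f x) := fun x => by rw [klFun_apply]; ring
  simp_rw [this]
  have hi : Integrable (fun x => 1 - f x) gauss := (integrable_const 1).sub h.integrable
  rw [integral_add (h.integrable_mul_log hD) hi,
    integral_sub (integrable_const 1) h.integrable, h.integral_eq_one]
  simp

/-- Talagrand's transport inequality for positive densities, with a remainder term. -/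
lemma talagrand_of_pos (h : FisherDensity f g) (hpos : ∀ x, 0 < f x)
    (hD : Integrable (fun x => klFun (f x)) gauss) {U u : ℝ → ℝ}
    (hU : ∀ x, U (gaussTransport f x) = x) (hu : u = fun z => gpdf z / (f (U z) * gpdf (U z)))
    (hUd : ∀ z, HasDerivAt U (u z) z) :
    ∫⁻ z, ENNReal.ofReal ((U z - z) ^ 2 / 2 + Delta (u z - 1)) ∂gauss
      ≤ ENNReal.ofReal (∫ x, klFun (f x) ∂gauss) := by
  have hqc := continuous_gpdf
  have hfc := h.cont
  have hUc : Continuous U := continuous_iff_continuousAt.2 fun z => (hUd z).continuousAt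
  have hu0 : ∀ z, 0 < u z := fun z => by
    rw [hu]; exact div_pos (gpdf_pos z) (mul_pos (hpos _) (gpdf_pos _))
  have huc : Continuous u := by
    rw [hu]
    exact Continuous.div (by fun_prop) (by fun_prop) fun z => (mul_pos (hpos _) (gpdf_pos _)).ne'
  have hlu : Continuous fun z => Real.log (u z) := huc.log fun z => (hu0 z).ne'
  have hD1 : ∀ z, Delta (u z - 1) = u z - 1 - Real.log (u z) := fun z => by
    rw [Delta, add_sub_cancel]
  have hm : Measurable fun x => Real.log (f x) := hfc.measurable.log
  have il : Integrable (fun z => Real.log (f (U z))) gauss :=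
    h.integrable_comp_inverse hU hUc.measurable hm
      ((h.integrable_mul_log hD).congr (ae_of_all _ fun x => mul_comm _ _))
  have hlim : Tendsto (fun N : ℝ => ∫ z in (-N)..N, Real.log (f (U z)) * gpdf z) atTop
      (𝓝 (∫ x, klFun (f x) ∂gauss)) := by
    have := tendsto_intervalIntegral_neg_self ((integrable_gauss_iff _).1 il)
    rw [← integral_gauss (fun z => Real.log (f (U z))),
      h.integral_comp_inverse hU hUc.measurable hm] at this
    simp_rw [mul_comm (Real.log _) (f _)] at this
    rwa [h.integral_klFun hD]
  have hlogU : ∀ z, Real.log (f (U z))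
      = (U z - z) ^ 2 / 2 + z * (U z - z) - Real.log (u z) := fun z => by
    rw [hu]
    simp only
    rw [Real.log_div (gpdf_pos z).ne' (mul_pos (hpos _) (gpdf_pos _)).ne',
      Real.log_mul (hpos _).ne' (gpdf_pos _).ne', log_gpdf, log_gpdf]
    ring
  have hiU : Integrable (fun z => U z - z) gauss :=
    (h.integrable_comp_inverse hU hUc.measurable measurable_id (h.integrable_id_mul hD)).sub
      integrable_id_gauss
  have hc : Continuous fun z => ((U z - z) ^ 2 / 2 + (u z - 1 - Real.log (u z))) * gpdf z := by
    fun_prop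
  simp_rw [hD1]
  rw [lintegral_gauss (by fun_prop)]
  have h0 : ∀ z, 0 ≤ (U z - z) ^ 2 / 2 + (u z - 1 - Real.log (u z)) := fun z => by
    have := Real.log_le_sub_one_of_pos (hu0 z)
    have := sq_nonneg (U z - z)
    linarith
  simp_rw [← fun z => ENNReal.ofReal_mul (q := gpdf z) (h0 z)]
  refine lintegral_le_of_intervalIntegral_le hc
    (fun z => mul_nonneg (h0 z) (gpdf_pos z).le) hlim
    (integrable_bdry (T := fun z => U z - z) ((integrable_gauss_iff _).1 hiU)
      fun z => (gpdf_pos z).le) ?_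
  filter_upwards with N
  have hftc := intervalIntegral.integral_eq_sub_of_hasDerivAt (a := -N) (b := N)
    (f := fun z => (U z - z) * gpdf z)
    (f' := fun z => (u z - 1) * gpdf z + (U z - z) * (-z * gpdf z))
    (fun z _ => ((hUd z).sub (hasDerivAt_id z)).mul (hasDerivAt_gpdf z))
    ((by fun_prop : Continuous _).intervalIntegrable _ _)
  have e : ∫ z in (-N)..N, ((U z - z) ^ 2 / 2 + (u z - 1 - Real.log (u z))) * gpdf z
      = (∫ z in (-N)..N, Real.log (f (U z)) * gpdf z)
        + ∫ z in (-N)..N, ((u z - 1) * gpdf z + (U z - z) * (-z * gpdf z)) := by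
    rw [← intervalIntegral.integral_add ((integrable_gauss_iff _).1 il).intervalIntegrable
      ((by fun_prop : Continuous _).intervalIntegrable _ _)]
    congr 1; ext z; rw [hlogU]; ring
  rw [e, hftc]
  have b1 := mul_le_mul_of_nonneg_right (le_abs_self (U N - N)) (gpdf_pos N).le
  have b2 := mul_le_mul_of_nonneg_right (neg_le_abs (U (-N) - -N)) (gpdf_pos (-N)).le
  linarith

lemma cheeger_of_pos (h : FisherDensity f g) (hpos : ∀ x, 0 < f x)
    (hD : Integrable (fun x => klFun (f x)) gauss) :
    ∃ B : ℝ, 0 ≤ B ∧ Integrable (fun x => f x * (x - gaussTransport f x) ^ 2) gauss ∧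
      (∫ x, f x * (x - gaussTransport f x) ^ 2 ∂gauss) / 2 + B ≤ ∫ x, klFun (f x) ∂gauss ∧
      ∫⁻ x, ENNReal.ofReal (Delta |x - (∫ y, y * f y ∂gauss) - gaussTransport f x| * f x) ∂gauss
        ≤ ENNReal.ofReal (8 * Real.pi * B) := by
  obtain ⟨U, hU, hUd⟩ := h.exists_inverse hpos
  have hUc : Continuous U := continuous_iff_continuousAt.2 fun z => (hUd z).continuousAt
  have hqc := continuous_gpdf
  have hfc := h.cont
  set u : ℝ → ℝ := fun z => gpdf z / (f (U z) * gpdf (U z)) with hu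
  have hu0 : ∀ z, 0 < u z := fun z => div_pos (gpdf_pos z) (mul_pos (hpos _) (gpdf_pos _))
  have huc : Continuous u :=
    Continuous.div (by fun_prop) (by fun_prop) fun z => (mul_pos (hpos _) (gpdf_pos _)).ne'
  have htal := h.talagrand_of_pos hpos hD hU hu hUd
  have hD0 : ∀ z, 0 ≤ Delta (u z - 1) := fun z => Delta_nonneg (by linarith [hu0 z])
  have hDm : Measurable fun z => Delta (u z - 1) := measurable_Delta.comp (by fun_prop)
  have hkl0 : 0 ≤ ∫ x, klFun (f x) ∂gauss := integral_nonneg fun x => klFun_nonneg (h.nonneg x)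
  have hsum : ∫⁻ z, ENNReal.ofReal ((U z - z) ^ 2 / 2) ∂gauss
      + ∫⁻ z, ENNReal.ofReal (Delta (u z - 1)) ∂gauss ≤ ENNReal.ofReal (∫ x, klFun (f x) ∂gauss) := by
    rw [← lintegral_add_left (by fun_prop)]
    refine le_of_eq_of_le (lintegral_congr fun z => ?_) htal
    rw [ENNReal.ofReal_add (by positivity) (hD0 z)]
  have i1 : Integrable (fun z => (U z - z) ^ 2 / 2) gauss := by
    refine ⟨(by fun_prop : Continuous _).aestronglyMeasurable, ?_⟩
    rw [hasFiniteIntegral_iff_ofReal (ae_of_all _ fun z => by positivity)]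
    exact (le_self_add.trans hsum).trans_lt ENNReal.ofReal_lt_top
  have i2 : Integrable (fun z => Delta (u z - 1)) gauss := by
    refine ⟨hDm.aestronglyMeasurable, ?_⟩
    rw [hasFiniteIntegral_iff_ofReal (ae_of_all _ hD0)]
    exact (le_add_self.trans hsum).trans_lt ENNReal.ofReal_lt_top
  have hTm := measurable_gaussTransport f
  have i3 : Integrable (fun x => f x * (x - gaussTransport f x) ^ 2) gauss := by
    have := h.integrable_comp_gaussTransport (i1.mul_const 2) (by fun_prop)
    refine this.congr (ae_of_all _ fun x => ?_)
    simp only [hU]; ring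
  have e3 : (∫ x, f x * (x - gaussTransport f x) ^ 2 ∂gauss) / 2
      = ∫ z, (U z - z) ^ 2 / 2 ∂gauss := by
    rw [← h.integral_comp_gaussTransport (by fun_prop : Measurable fun z => (U z - z) ^ 2 / 2),
      ← integral_div]
    refine integral_congr_ae (ae_of_all _ fun x => ?_)
    simp only [hU]; ring
  refine ⟨∫ z, Delta (u z - 1) ∂gauss, integral_nonneg hD0, i3, ?_, ?_⟩
  · rw [← ofReal_integral_eq_lintegral_ofReal i1 (ae_of_all _ fun z => by positivity),
      ← ofReal_integral_eq_lintegral_ofReal i2 (ae_of_all _ hD0),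
      ← ENNReal.ofReal_add (integral_nonneg fun z => by positivity) (integral_nonneg hD0),
      ENNReal.ofReal_le_ofReal_iff hkl0] at hsum
    rw [e3]; exact hsum
  · set m := ∫ y, y * f y ∂gauss with hm
    have iU : Integrable U gauss :=
      h.integrable_comp_inverse hU hUc.measurable measurable_id (h.integrable_id_mul hD)
    have eU : ∫ z, U z ∂gauss = m := h.integral_comp_inverse hU hUc.measurable measurable_id
    have hd : ∀ z, HasDerivAt (fun z => U z - z - m) (u z - 1) z := fun z =>
      ((hUd z).sub (hasDerivAt_id z)).sub_const m
    have iV : Integrable (fun z => U z - z) gauss := iU.sub integrable_id_gauss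
    have hch := lintegral_Delta_le hd (by fun_prop) (iV.sub (integrable_const m)) (by
        rw [integral_sub iV (integrable_const m),
          integral_sub iU integrable_id_gauss, eU, integral_id_gauss]; simp)
    have e1 : ∫⁻ x, ENNReal.ofReal (Delta |x - m - gaussTransport f x| * f x) ∂gauss
        = ∫⁻ z, ENNReal.ofReal (Delta |U z - z - m|) ∂gauss := by
      have hmD : Measurable fun z => ENNReal.ofReal (Delta |U z - z - m|) :=
        (measurable_Delta.comp (by fun_prop)).ennreal_ofReal
      rw [← lintegral_gaussTransport h.cont.measurable h.mass hmD]
      refine lintegral_congr fun x => ?_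
      rw [ENNReal.ofReal_mul (Delta_abs_nonneg _), hU, sub_right_comm]
    rw [e1]
    refine hch.trans ?_
    rw [ENNReal.ofReal_mul (p := 8 * Real.pi) (by positivity), ofReal_integral_eq_lintegral_ofReal i2 (ae_of_all _ hD0)]
    gcongr with z
    exact Delta_abs_le (by linarith [hu0 z])

/-- The HWI inequality for positive densities. -/
lemma hwi_of_pos (h : FisherDensity f g) (hpos : ∀ x, 0 < f x)
    (hD : Integrable (fun x => klFun (f x)) gauss)
    (hW : Integrable (fun x => f x * (x - gaussTransport f x) ^ 2) gauss) :
    Integrable (fun x => g x * (x - gaussTransport f x)) gauss ∧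
    (∫ x, klFun (f x) ∂gauss) + (∫ x, f x * (x - gaussTransport f x) ^ 2 ∂gauss) / 2
      ≤ ∫ x, g x * (x - gaussTransport f x) ∂gauss := by
  have hTm := measurable_gaussTransport f
  have hgm := h.meas
  have ig : Integrable (fun x => g x * (x - gaussTransport f x)) gauss := by
    refine ((h.integrable_fisher.div_const 2).add (hW.div_const 2)).mono'
      (by fun_prop : Measurable _).aestronglyMeasurable (ae_of_all _ fun x => ?_)
    exact h.mul_le x _
  refine ⟨ig, ?_⟩
  have i0 : Integrable (fun x => f x * Real.log (f x) + f x * (x - gaussTransport f x) ^ 2 / 2)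
      gauss := (h.integrable_mul_log hD).add (hW.div_const 2)
  have e0 : ∫ x, (f x * Real.log (f x) + f x * (x - gaussTransport f x) ^ 2 / 2) ∂gauss
      = (∫ x, klFun (f x) ∂gauss) + (∫ x, f x * (x - gaussTransport f x) ^ 2 ∂gauss) / 2 := by
    rw [integral_add (h.integrable_mul_log hD) (hW.div_const 2), h.integral_klFun hD, integral_div]
  rw [← e0, integral_gauss, integral_gauss]
  exact le_of_tendsto_of_integrable_error
    (tendsto_intervalIntegral_neg_self ((integrable_gauss_iff _).1 i0))
    (tendsto_intervalIntegral_neg_self ((integrable_gauss_iff _).1 ig))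
    (h.integrable_bdry_gaussTransport hpos)
    ((eventually_ge_atTop 0).mono fun N hN => h.intervalIntegral_entropy_le hpos hN)

lemma integrable_klFun_of_pos (h : FisherDensity f g) (hpos : ∀ x, 0 < f x) :
    Integrable (fun x => klFun (f x)) gauss := by
  refine ⟨(continuous_klFun.comp h.cont).aestronglyMeasurable, ?_⟩
  rw [hasFiniteIntegral_iff_ofReal (ae_of_all _ fun x => klFun_nonneg (h.nonneg x))]
  exact (h.entropy_le_of_pos hpos).trans_lt ENNReal.ofReal_lt_top

/-- The deficit estimate in dimension one for positive densities, in linearized form. -/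
lemma deficit_of_pos (h : FisherDensity f g) (hpos : ∀ x, 0 < f x) {s : ℝ} (hs : 0 < s) :
    ∫⁻ x, ENNReal.ofReal (Delta |x - (∫ y, y * f y ∂gauss) - gaussTransport f x| * f x) ∂gauss
      ≤ ENNReal.ofReal (8 * Real.pi *
        (s * ((∫ x, g x ^ 2 / f x ∂gauss) / 2 - ∫ x, klFun (f x) ∂gauss)
          + ((∫ x, klFun (f x) ∂gauss) - (∫ y, y * f y ∂gauss) ^ 2 / 2) / s)) ∧
    ∫ x, f x * (x - gaussTransport f x) ^ 2 ∂gauss ≤ 2 * ∫ x, klFun (f x) ∂gauss ∧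
    (∫ y, y * f y ∂gauss) ^ 2 ≤ 2 * ∫ x, klFun (f x) ∂gauss := by
  have hD := h.integrable_klFun_of_pos hpos
  obtain ⟨B, hB0, hW, hB, hA⟩ := h.cheeger_of_pos hpos hD
  obtain ⟨ig, hwi⟩ := h.hwi_of_pos hpos hD hW
  set T := gaussTransport f with hT
  set m := ∫ y, y * f y ∂gauss with hm
  set J := ∫ x, g x ^ 2 / f x ∂gauss with hJ
  set D := ∫ x, klFun (f x) ∂gauss with hDdef
  set W := ∫ x, f x * (x - T x) ^ 2 ∂gauss with hWdef
  set G := ∫ x, g x * (x - T x) ∂gauss with hG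
  have iT : Integrable (fun x => T x * f x) gauss :=
    h.integrable_comp_gaussTransport integrable_id_gauss measurable_id
  have eT : ∫ x, T x * f x ∂gauss = 0 := by
    have := h.integral_comp_gaussTransport measurable_id
    simp only [id] at this
    rw [this, integral_id_gauss]
  have ix := h.integrable_id_mul hD
  have iV : Integrable (fun x => f x * (x - T x)) gauss :=
    (ix.sub iT).congr (ae_of_all _ fun x => by simp only [Pi.sub_apply]; ring)
  have eV : ∫ x, f x * (x - T x) ∂gauss = m := by
    have : ∫ x, (x * f x - T x * f x) ∂gauss = m := by rw [integral_sub ix iT, eT, sub_zero]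
    rw [← this]; congr 1; ext x; ring
  have eg : ∫ x, g x ∂gauss = m := h.integral_deriv_eq hD
  have hlin : ∀ c1 c2 c3 c4 c5 c6 : ℝ, Integrable (fun x => c1 * (g x ^ 2 / f x)
        + c2 * (g x * (x - T x)) + c3 * g x + c4 * (f x * (x - T x) ^ 2) + c5 * (f x * (x - T x))
        + c6 * f x) gauss ∧ ∫ x, (c1 * (g x ^ 2 / f x)
        + c2 * (g x * (x - T x)) + c3 * g x + c4 * (f x * (x - T x) ^ 2) + c5 * (f x * (x - T x))
        + c6 * f x) ∂gauss = c1 * J + c2 * G + c3 * m + c4 * W + c5 * m + c6 := by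
    intro c1 c2 c3 c4 c5 c6
    have j1 := h.integrable_fisher.const_mul c1
    have j2 := ig.const_mul c2
    have j3 := h.integrable_deriv.const_mul c3
    have j4 := hW.const_mul c4
    have j5 := iV.const_mul c5
    have j6 := h.integrable.const_mul c6
    have k2 : Integrable (fun x => c1 * (g x ^ 2 / f x) + c2 * (g x * (x - T x))) gauss :=
      j1.add j2
    have k3 : Integrable (fun x => c1 * (g x ^ 2 / f x) + c2 * (g x * (x - T x)) + c3 * g x)
      gauss := k2.add j3
    have k4 : Integrable (fun x => c1 * (g x ^ 2 / f x) + c2 * (g x * (x - T x)) + c3 * g x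
      + c4 * (f x * (x - T x) ^ 2)) gauss := k3.add j4
    have k5 : Integrable (fun x => c1 * (g x ^ 2 / f x) + c2 * (g x * (x - T x)) + c3 * g x
      + c4 * (f x * (x - T x) ^ 2) + c5 * (f x * (x - T x))) gauss := k4.add j5
    refine ⟨k5.add j6, ?_⟩
    rw [integral_add k5 j6, integral_add k4 j5, integral_add k3 j4, integral_add k2 j3,
      integral_add j1 j2]
    simp only [integral_const_mul]
    rw [h.integral_eq_one, eV, eg, mul_one]
  have l1 := hlin 0 1 (-m) (-1) m 0
  have l2 := hlin (s / 2) (-s) 0 (s / 2 + 1 / (2 * s)) (-(m / s)) (m ^ 2 / (2 * s))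
  have l3 := hlin 0 0 0 1 (-2 * m) (m ^ 2)
  have hvar := integral_nonneg (μ := gauss) (f := fun x => f x * (x - T x - m) ^ 2)
    fun x => mul_nonneg (h.nonneg x) (sq_nonneg _)
  have evar : ∫ x, f x * (x - T x - m) ^ 2 ∂gauss = W - m ^ 2 := by
    rw [show W - m ^ 2 = 0 * J + 0 * G + 0 * m + 1 * W + -2 * m * m + m ^ 2 by ring, ← l3.2]
    congr 1; ext x; ring
  rw [evar] at hvar
  have hle := integral_mono (μ := gauss) l1.1 l2.1 fun x => by
    simp only
    have hx := hpos x
    set R := g x / f x - (x - T x) with hR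
    set V := x - T x - m with hV
    have hg : g x = f x * (R + V + m) := by rw [hR, hV]; field_simp; ring
    have e1 : 0 * (g x ^ 2 / f x) + 1 * (g x * (x - T x)) + -m * g x + -1 * (f x * (x - T x) ^ 2)
        + m * (f x * (x - T x)) + 0 * f x = f x * (R * V) := by
      rw [hg, show x - T x = V + m by rw [hV]; ring]; ring
    have e2 : s / 2 * (g x ^ 2 / f x) + -s * (g x * (x - T x)) + 0 * g x
        + (s / 2 + 1 / (2 * s)) * (f x * (x - T x) ^ 2) + -(m / s) * (f x * (x - T x))
        + m ^ 2 / (2 * s) * f x = f x * (s / 2 * R ^ 2 + V ^ 2 / (2 * s)) := by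
      rw [hg, show x - T x = V + m by rw [hV]; ring]
      field_simp; ring
    rw [e1, e2]
    have h3 : 0 ≤ (s * R - V) ^ 2 / (2 * s) := by positivity
    have h4 : (s * R - V) ^ 2 / (2 * s) = s / 2 * R ^ 2 + V ^ 2 / (2 * s) - R * V := by
      field_simp; ring
    exact mul_le_mul_of_nonneg_left (by linarith) hx.le
  rw [l1.2, l2.2] at hle
  refine ⟨hA.trans (ENNReal.ofReal_le_ofReal (mul_le_mul_of_nonneg_left ?_ (by positivity))),
    by linarith, by linarith⟩
  have e3 : s / 2 * J + -s * G + 0 * m + (s / 2 + 1 / (2 * s)) * W + -(m / s) * m + m ^ 2 / (2 * s)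
      = s * (J / 2 - G + W / 2) + (W / 2 - m ^ 2 / 2) / s := by field_simp; ring
  rw [e3] at hle
  have h5 : s * (J / 2 - G + W / 2) ≤ s * (J / 2 - D) :=
    mul_le_mul_of_nonneg_left (by linarith) hs.le
  have h6 : (W / 2 - m ^ 2 / 2) / s ≤ (D - m ^ 2 / 2) / s := by gcongr; linarith
  linarith

end FisherDensity

/-- A version of Fatou's lemma with convergence required only where the limit does not vanish. -/
lemma lintegral_le_of_tendsto_of_ne_zero {α : Type*} [MeasurableSpace α] {μ : Measure α}
    {F : ℕ → α → ℝ≥0∞} {G : α → ℝ≥0∞} (hF : ∀ n, Measurable (F n))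
    (h : ∀ᵐ x ∂μ, G x = 0 ∨ Tendsto (fun n => F n x) atTop (𝓝 (G x)))
    {c : ℕ → ℝ} {R : ℝ} (hc : Tendsto c atTop (𝓝 R))
    (hle : ∀ n, ∫⁻ x, F n x ∂μ ≤ ENNReal.ofReal (c n)) :
    ∫⁻ x, G x ∂μ ≤ ENNReal.ofReal R := by
  calc ∫⁻ x, G x ∂μ ≤ ∫⁻ x, liminf (fun n => F n x) atTop ∂μ := by
        refine lintegral_mono_ae (h.mono fun x hx => ?_)
        rcases hx with h0 | h1
        · rw [h0]; exact bot_le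
        · exact h1.liminf_eq.ge
    _ ≤ liminf (fun n => ∫⁻ x, F n x ∂μ) atTop := lintegral_liminf_le hF
    _ ≤ liminf (fun n => ENNReal.ofReal (c n)) atTop :=
        liminf_le_liminf (Eventually.of_forall hle)
    _ = ENNReal.ofReal R := (ENNReal.tendsto_ofReal hc).liminf_eq

namespace FisherDensity

variable {f g : ℝ → ℝ}

lemma fisher_mix_le (h : FisherDensity f g) {ε : ℝ} (h0 : 0 < ε) (h1 : ε ≤ 1) (x : ℝ) :
    ((1 - ε) * g x) ^ 2 / ((1 - ε) * f x + ε) ≤ g x ^ 2 / f x := by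
  rcases (h.nonneg x).eq_or_lt with hx | hx
  · rw [h.zero x hx.symm]; simp
  have hp : 0 < (1 - ε) * f x + ε := by nlinarith
  rw [div_le_div_iff₀ hp hx]
  have h2 : (1 - ε) ^ 2 * f x ≤ (1 - ε) * f x + ε := by nlinarith [mul_nonneg h0.le hx.le]
  nlinarith [mul_le_mul_of_nonneg_left h2 (sq_nonneg (g x))]

/-- Mixing a density with the Gaussian density. -/
lemma mix (h : FisherDensity f g) {ε : ℝ} (h0 : 0 < ε) (h1 : ε ≤ 1) :
    FisherDensity (fun x => (1 - ε) * f x + ε) (fun x => (1 - ε) * g x) where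
  nonneg x := by have := h.nonneg x; nlinarith
  meas := h.meas.const_mul _
  intble a b := (h.intble a b).const_mul _
  ftc a b := by rw [intervalIntegral.integral_const_mul, ← h.ftc]; ring
  zero x hx := by have := h.nonneg x; nlinarith
  mass := by
    have hc := h.cont
    have hn : ∀ x, 0 ≤ (1 - ε) * f x + ε := fun x => by have := h.nonneg x; nlinarith
    have hi : Integrable (fun x => (1 - ε) * f x) gauss := h.integrable.const_mul _
    rw [← ofReal_integral_eq_lintegral_ofReal (f := fun x => (1 - ε) * f x + ε)
      (hi.add (integrable_const ε)) (ae_of_all _ hn), integral_add hi (integrable_const ε), integral_const_mul, h.integral_eq_one]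
    simp
  fisher := by
    refine ne_top_of_le_ne_top h.fisher (lintegral_mono fun x => ENNReal.ofReal_le_ofReal ?_)
    exact h.fisher_mix_le h0 h1 x

lemma klFun_mix_le (h : FisherDensity f g) {ε : ℝ} (h0 : 0 < ε) (h1 : ε ≤ 1) (x : ℝ) :
    klFun ((1 - ε) * f x + ε) ≤ klFun (f x) := by
  have := convexOn_klFun.2 (show f x ∈ Ici 0 from h.nonneg x) (show (1 : ℝ) ∈ Ici 0 by simp)
    (show 0 ≤ 1 - ε by linarith) h0.le (by ring)
  simp only [smul_eq_mul, mul_one, klFun_one, mul_zero, add_zero] at this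
  have := klFun_nonneg (h.nonneg x)
  nlinarith

lemma tendsto_gaussTransport_mix (h : FisherDensity f g) {ε : ℕ → ℝ} (h0 : ∀ n, 0 < ε n)
    (h1 : ∀ n, ε n ≤ 1) (hε : Tendsto ε atTop (𝓝 0)) {x : ℝ}
    (hx : cdf (gaussWith f) x ∈ Ioo (0 : ℝ) 1) :
    Tendsto (fun n => gaussTransport (fun y => (1 - ε n) * f y + ε n) x) atTop
      (𝓝 (gaussTransport f x)) := by
  have := h.isProbabilityMeasure
  have e : ∀ n, gaussTransport (fun y => (1 - ε n) * f y + ε n) x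
      = probit ((1 - ε n) * cdf (gaussWith f) x + ε n * cdf gauss x) := fun n => by
    have hm := h.mix (h0 n) (h1 n)
    have := hm.isProbabilityMeasure
    have hn := h.nonneg
    have hi : Integrable (fun x => (1 - ε n) * f x) gauss := h.integrable.const_mul _
    rw [gaussTransport, ← ofReal_integral_eq_lintegral_ofReal hm.integrable.integrableOn
      (ae_of_all _ hm.nonneg), ENNReal.toReal_ofReal (integral_nonneg hm.nonneg),
      integral_add hi.integrableOn (integrable_const _), integral_const_mul]
    congr 2
    · rw [cdf_eq_real, measureReal_def, withDensity_apply _ measurableSet_Iic,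
        ← ofReal_integral_eq_lintegral_ofReal h.integrable.integrableOn (ae_of_all _ hn),
        ENNReal.toReal_ofReal (integral_nonneg hn)]
    · rw [cdf_eq_real]
      simp [mul_comm]
  simp_rw [e]
  rw [gaussTransport_eq_cdf]
  refine (hasDerivAt_probit hx).continuousAt.tendsto.comp ?_
  have := ((tendsto_const_nhds (x := (1 : ℝ))).sub hε).mul_const (cdf (gaussWith f) x) |>.add
    (hε.mul_const (cdf gauss x))
  simpa using this

lemma ae_cdf_mem (h : FisherDensity f g) :
    ∀ᵐ x ∂gauss, f x = 0 ∨ cdf (gaussWith f) x ∈ Ioo (0 : ℝ) 1 := by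
  have := h.isProbabilityMeasure
  have := nullSingletonClass_gaussWith f
  have h1 := ae_cdf_mem_Ioo (gaussWith f)
  rw [ae_withDensity_iff h.cont.measurable.ennreal_ofReal] at h1
  filter_upwards [h1] with x hx
  by_cases h0 : f x = 0
  · exact Or.inl h0
  · exact Or.inr (hx (by simpa using lt_of_le_of_ne (h.nonneg x) (Ne.symm h0)))

/-- The deficit estimate in dimension one, in linearized form, together with the logarithmic Sobolev
and the transport inequality. -/
lemma deficit (h : FisherDensity f g) :
    Integrable (fun x => klFun (f x)) gauss ∧
    ∫ x, klFun (f x) ∂gauss ≤ (∫ x, g x ^ 2 / f x ∂gauss) / 2 ∧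
    ∫⁻ x, ENNReal.ofReal (f x * (x - gaussTransport f x) ^ 2) ∂gauss
      ≤ ENNReal.ofReal (2 * ∫ x, klFun (f x) ∂gauss) ∧
    (∫ y, y * f y ∂gauss) ^ 2 ≤ 2 * ∫ x, klFun (f x) ∂gauss ∧
    ∀ s : ℝ, 0 < s →
    ∫⁻ x, ENNReal.ofReal (Delta |x - (∫ y, y * f y ∂gauss) - gaussTransport f x| * f x) ∂gauss
      ≤ ENNReal.ofReal (8 * Real.pi *
        (s * ((∫ x, g x ^ 2 / f x ∂gauss) / 2 - ∫ x, klFun (f x) ∂gauss)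
          + ((∫ x, klFun (f x) ∂gauss) - (∫ y, y * f y ∂gauss) ^ 2 / 2) / s)) := by
  set ε : ℕ → ℝ := fun n => 1 / ((n : ℝ) + 1) with hεdef
  have h0 : ∀ n, 0 < ε n := fun n => by positivity
  have h1 : ∀ n, ε n ≤ 1 := fun n => by
    rw [hεdef, div_le_one (by positivity)]; simp
  have hε : Tendsto ε atTop (𝓝 0) := tendsto_one_div_add_atTop_nhds_zero_nat
  have hε1 : Tendsto (fun n => 1 - ε n) atTop (𝓝 1) := by
    simpa using (tendsto_const_nhds (x := (1 : ℝ))).sub hε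
  have hm : ∀ n, FisherDensity (fun x => (1 - ε n) * f x + ε n) (fun x => (1 - ε n) * g x) :=
    fun n => h.mix (h0 n) (h1 n)
  have hpos : ∀ n x, 0 < (1 - ε n) * f x + ε n := fun n x => by
    have := mul_nonneg (sub_nonneg.2 (h1 n)) (h.nonneg x); linarith [h0 n]
  have hft : ∀ x, Tendsto (fun n => (1 - ε n) * f x + ε n) atTop (𝓝 (f x)) := fun x => by
    simpa using (hε1.mul_const (f x)).add hε
  have hkt : ∀ x, Tendsto (fun n => klFun ((1 - ε n) * f x + ε n)) atTop (𝓝 (klFun (f x))) :=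
    fun x => (continuous_klFun.tendsto _).comp (hft x)
  have hfc := h.cont
  have hJn : ∀ n, ∫ x, ((1 - ε n) * g x) ^ 2 / ((1 - ε n) * f x + ε n) ∂gauss
      ≤ ∫ x, g x ^ 2 / f x ∂gauss := fun n =>
    integral_mono (hm n).integrable_fisher h.integrable_fisher (h.fisher_mix_le (h0 n) (h1 n))
  have hJ0 : 0 ≤ ∫ x, g x ^ 2 / f x ∂gauss :=
    integral_nonneg fun x => div_nonneg (sq_nonneg _) (h.nonneg x)
  have hkm : ∀ n, Measurable fun x => ENNReal.ofReal (klFun ((1 - ε n) * f x + ε n)) := fun n =>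
    (continuous_klFun.comp (by fun_prop)).measurable.ennreal_ofReal
  have hDle : ∫⁻ x, ENNReal.ofReal (klFun (f x)) ∂gauss
      ≤ ENNReal.ofReal ((∫ x, g x ^ 2 / f x ∂gauss) / 2) := by
    refine lintegral_le_of_tendsto_of_ne_zero hkm
      (ae_of_all _ fun x => Or.inr (ENNReal.tendsto_ofReal (hkt x)))
      (tendsto_const_nhds (x := (∫ x, g x ^ 2 / f x ∂gauss) / 2)) fun n => ?_
    exact ((hm n).entropy_le_of_pos (hpos n)).trans
      (ENNReal.ofReal_le_ofReal (by linarith [hJn n]))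
  have hk0 : ∀ x, 0 ≤ klFun (f x) := fun x => klFun_nonneg (h.nonneg x)
  have hD : Integrable (fun x => klFun (f x)) gauss := by
    refine ⟨(continuous_klFun.comp h.cont).aestronglyMeasurable, ?_⟩
    rw [hasFiniteIntegral_iff_ofReal (ae_of_all _ hk0)]
    exact hDle.trans_lt ENNReal.ofReal_lt_top
  have hDlim : Tendsto (fun n => ∫ x, klFun ((1 - ε n) * f x + ε n) ∂gauss) atTop
      (𝓝 (∫ x, klFun (f x) ∂gauss)) := by
    refine tendsto_integral_of_dominated_convergence _
      (fun n => (continuous_klFun.comp (by fun_prop)).aestronglyMeasurable) hD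
      (fun n => ae_of_all _ fun x => ?_) (ae_of_all _ hkt)
    rw [Real.norm_of_nonneg (klFun_nonneg (hpos n x).le)]
    exact h.klFun_mix_le (h0 n) (h1 n) x
  have ix := h.integrable_id_mul hD
  have hmn : ∀ n, ∫ y, y * ((1 - ε n) * f y + ε n) ∂gauss = (1 - ε n) * ∫ y, y * f y ∂gauss := by
    intro n
    have : ∀ y, y * ((1 - ε n) * f y + ε n) = (1 - ε n) * (y * f y) + ε n * y := fun y => by ring
    simp_rw [this]
    rw [integral_add (ix.const_mul _) (integrable_id_gauss.const_mul _), integral_const_mul,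
      integral_const_mul, integral_id_gauss, mul_zero, add_zero]
  have hmlim : Tendsto (fun n => ∫ y, y * ((1 - ε n) * f y + ε n) ∂gauss) atTop
      (𝓝 (∫ y, y * f y ∂gauss)) := by
    simp_rw [hmn]; simpa using hε1.mul_const (∫ y, y * f y ∂gauss)
  have hTlim := fun x => h.tendsto_gaussTransport_mix h0 h1 hε (x := x)
  have hTm := measurable_gaussTransport
  refine ⟨hD, ?_, ?_, ?_, fun s hs => ?_⟩
  · rwa [← ofReal_integral_eq_lintegral_ofReal hD (ae_of_all _ hk0),
      ENNReal.ofReal_le_ofReal_iff (by positivity)] at hDle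
  · refine lintegral_le_of_tendsto_of_ne_zero (F := fun n x => ENNReal.ofReal
      (((1 - ε n) * f x + ε n) * (x - gaussTransport (fun y => (1 - ε n) * f y + ε n) x) ^ 2))
      (fun n => by have := hTm (fun y => (1 - ε n) * f y + ε n); fun_prop) ?_ (hDlim.const_mul 2)
      fun n => ?_
    · filter_upwards [h.ae_cdf_mem] with x hx
      refine hx.imp (fun hx => by simp [hx]) fun hx => ?_
      exact ENNReal.tendsto_ofReal ((hft x).mul ((tendsto_const_nhds.sub (hTlim x hx)).pow 2))
    · obtain ⟨B, -, hW, -⟩ := (hm n).cheeger_of_pos (hpos n) ((hm n).integrable_klFun_of_pos (hpos n))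
      rw [← ofReal_integral_eq_lintegral_ofReal hW
        (ae_of_all _ fun x => mul_nonneg (hpos n x).le (sq_nonneg _))]
      exact ENNReal.ofReal_le_ofReal ((hm n).deficit_of_pos (hpos n) one_pos).2.1
  · exact le_of_tendsto_of_tendsto' (hmlim.pow 2) (hDlim.const_mul 2)
      fun n => ((hm n).deficit_of_pos (hpos n) one_pos).2.2
  · have hclim : Tendsto (fun n => 8 * Real.pi *
        (s * ((∫ x, g x ^ 2 / f x ∂gauss) / 2 - ∫ x, klFun ((1 - ε n) * f x + ε n) ∂gauss)
          + ((∫ x, klFun ((1 - ε n) * f x + ε n) ∂gauss)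
            - (∫ y, y * ((1 - ε n) * f y + ε n) ∂gauss) ^ 2 / 2) / s)) atTop
        (𝓝 (8 * Real.pi * (s * ((∫ x, g x ^ 2 / f x ∂gauss) / 2 - ∫ x, klFun (f x) ∂gauss)
          + ((∫ x, klFun (f x) ∂gauss) - (∫ y, y * f y ∂gauss) ^ 2 / 2) / s))) :=
      (((hDlim.const_sub _).const_mul s).add
        ((hDlim.sub ((hmlim.pow 2).div_const 2)).div_const s)).const_mul _
    refine lintegral_le_of_tendsto_of_ne_zero (F := fun n x => ENNReal.ofReal
      (Delta |x - (∫ y, y * ((1 - ε n) * f y + ε n) ∂gauss)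
        - gaussTransport (fun y => (1 - ε n) * f y + ε n) x| * ((1 - ε n) * f x + ε n)))
      (fun n => ?_) ?_ hclim fun n => ?_
    · have := hTm (fun y => (1 - ε n) * f y + ε n)
      have hD' := measurable_Delta
      fun_prop
    · filter_upwards [h.ae_cdf_mem] with x hx
      refine hx.imp (fun hx => by simp [hx]) fun hx => ?_
      refine ENNReal.tendsto_ofReal (Tendsto.mul ?_ (hft x))
      have hc : ContinuousAt Delta |x - (∫ y, y * f y ∂gauss) - gaussTransport f x| :=
        (hasDerivAt_Delta (by linarith [abs_nonneg (x - (∫ y, y * f y ∂gauss)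
          - gaussTransport f x)])).continuousAt
      exact hc.tendsto.comp ((tendsto_const_nhds.sub hmlim).sub (hTlim x hx)).abs
    · refine ((hm n).deficit_of_pos (hpos n) hs).1.trans (ENNReal.ofReal_le_ofReal ?_)
      have := hJn n
      gcongr

/-- The deficit estimate in additive form. -/
lemma deficit_add (h : FisherDensity f g) {s : ℝ} (hs : 0 < s) :
    ∫⁻ x, ENNReal.ofReal (Delta |x - (∫ y, y * f y ∂gauss) - gaussTransport f x| * f x) ∂gauss
      + ENNReal.ofReal (8 * Real.pi * s) * ∫⁻ x, ENNReal.ofReal (klFun (f x)) ∂gauss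
      + ENNReal.ofReal (4 * Real.pi / s) * ENNReal.ofReal ((∫ y, y * f y ∂gauss) ^ 2)
    ≤ ENNReal.ofReal (4 * Real.pi * s) * ∫⁻ x, ENNReal.ofReal (g x ^ 2 / f x) ∂gauss
      + ENNReal.ofReal (8 * Real.pi / s) * ∫⁻ x, ENNReal.ofReal (klFun (f x)) ∂gauss := by
  obtain ⟨hD, hDJ, -, hmD, hA⟩ := h.deficit
  have hA := hA s hs
  have hk0 : ∀ x, 0 ≤ klFun (f x) := fun x => klFun_nonneg (h.nonneg x)
  have hf0 : ∀ x, 0 ≤ g x ^ 2 / f x := fun x => div_nonneg (sq_nonneg _) (h.nonneg x)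
  rw [← ofReal_integral_eq_lintegral_ofReal hD (ae_of_all _ hk0),
    ← ofReal_integral_eq_lintegral_ofReal h.integrable_fisher (ae_of_all _ hf0)]
  have hD0 : 0 ≤ ∫ x, klFun (f x) ∂gauss := integral_nonneg hk0
  have hJ0 : 0 ≤ ∫ x, g x ^ 2 / f x ∂gauss := integral_nonneg hf0
  set m := ∫ y, y * f y ∂gauss
  set D := ∫ x, klFun (f x) ∂gauss
  set J := ∫ x, g x ^ 2 / f x ∂gauss
  have hR : 0 ≤ 8 * Real.pi * (s * (J / 2 - D) + (D - m ^ 2 / 2) / s) := by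
    have : 0 ≤ s * (J / 2 - D) := mul_nonneg hs.le (by linarith)
    have : 0 ≤ (D - m ^ 2 / 2) / s := div_nonneg (by linarith) hs.le
    positivity
  rw [← ENNReal.ofReal_mul (by positivity), ← ENNReal.ofReal_mul (by positivity),
    ← ENNReal.ofReal_mul (by positivity), ← ENNReal.ofReal_mul (by positivity),
    ← ENNReal.ofReal_add (by positivity) (by positivity)]
  refine (add_le_add_left (add_le_add_left hA _) _).trans ?_
  rw [← ENNReal.ofReal_add hR (by positivity),
    ← ENNReal.ofReal_add (by positivity) (by positivity)]
  refine ENNReal.ofReal_le_ofReal (le_of_eq ?_)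
  field_simp; ring

end FisherDensity

/-- The standard Gaussian measure on `Fin n → ℝ`. -/
abbrev stdPi (n : ℕ) : Measure (Fin n → ℝ) := Measure.pi fun _ => gauss

/-- Integration of the coordinates in `s` with respect to the standard Gaussian measure. -/
abbrev marg {n : ℕ} (s : Finset (Fin n)) (h : (Fin n → ℝ) → ℝ≥0∞) : (Fin n → ℝ) → ℝ≥0∞ :=
  lmarginal (fun _ => gauss) s h

/-- The coordinates from `j` on. -/
def tailSet (n j : ℕ) : Finset (Fin n) := Finset.univ.filter fun i => j ≤ (i : ℕ)

lemma mem_tailSet {n j : ℕ} {i : Fin n} : i ∈ tailSet n j ↔ j ≤ (i : ℕ) := by simp [tailSet]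

lemma tailSet_zero (n : ℕ) : tailSet n 0 = Finset.univ := by simp [tailSet]

lemma tailSet_self (n : ℕ) : tailSet n n = ∅ := by
  ext i; simp [mem_tailSet]

lemma notMem_tailSet_succ {n : ℕ} (k : Fin n) : k ∉ tailSet n (k + 1) := by simp [mem_tailSet]

lemma mem_tailSet_self {n : ℕ} (k : Fin n) : k ∈ tailSet n k := by simp [mem_tailSet]

lemma tailSet_eq_insert {n : ℕ} (k : Fin n) : tailSet n k = insert k (tailSet n (k + 1)) := by
  ext i; simp [mem_tailSet, Fin.ext_iff]; omega

/-- The function `c` does not depend on the coordinates in `s`. -/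
def FreeOf {n : ℕ} {α : Type*} (s : Finset (Fin n)) (c : (Fin n → ℝ) → α) : Prop :=
  ∀ ⦃x y : Fin n → ℝ⦄, (∀ i ∉ s, x i = y i) → c x = c y

section

variable {n : ℕ} {s : Finset (Fin n)}

lemma freeOf_marg (s : Finset (Fin n)) (h : (Fin n → ℝ) → ℝ≥0∞) : FreeOf s (marg s h) :=
  fun _ _ hxy => lmarginal_congr _ h hxy

lemma FreeOf.updateFinset {α : Type*} {c : (Fin n → ℝ) → α} (hc : FreeOf s c) (x : Fin n → ℝ)
    (y : s → ℝ) : c (Function.updateFinset x s y) = c x :=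
  hc fun i hi => by simp [Function.updateFinset, hi]

lemma FreeOf.update {α : Type*} {c : (Fin n → ℝ) → α} (hc : FreeOf s c) {k : Fin n} (hk : k ∈ s)
    (x : Fin n → ℝ) (t : ℝ) : c (Function.update x k t) = c x :=
  hc fun i hi => Function.update_of_ne (fun e => hi (by rw [e]; exact hk)) _ _

lemma measurable_marg {h : (Fin n → ℝ) → ℝ≥0∞} (hh : Measurable h) : Measurable (marg s h) :=
  hh.lmarginal _

lemma marg_mul {c h : (Fin n → ℝ) → ℝ≥0∞} (hc : FreeOf s c) (hh : Measurable h) :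
    marg s (fun x => c x * h x) = fun x => c x * marg s h x := by
  ext x
  simp only [marg, lmarginal]
  rw [← lintegral_const_mul]
  · simp_rw [hc.updateFinset]
  · exact hh.comp measurable_updateFinset

lemma marg_of_freeOf {c : (Fin n → ℝ) → ℝ≥0∞} (hc : FreeOf s c) : marg s c = c := by
  ext x
  simp only [marg, lmarginal]
  simp_rw [hc.updateFinset]
  simp

lemma lintegral_marg {h : (Fin n → ℝ) → ℝ≥0∞} (hh : Measurable h) :
    ∫⁻ x, marg s h x ∂stdPi n = ∫⁻ x, h x ∂stdPi n :=
  lintegral_eq_of_lmarginal_eq s (measurable_marg hh) hh (marg_of_freeOf (freeOf_marg s h))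

lemma lintegral_mul_marg {c h : (Fin n → ℝ) → ℝ≥0∞} (hc : FreeOf s c) (hcm : Measurable c)
    (hh : Measurable h) :
    ∫⁻ x, c x * marg s h x ∂stdPi n = ∫⁻ x, c x * h x ∂stdPi n := by
  rw [← lintegral_marg (s := s) (h := fun x => c x * h x) (hcm.mul hh)]
  exact lintegral_congr fun x => (congrFun (marg_mul hc hh) x).symm

lemma lintegral_lintegral_update {h : (Fin n → ℝ) → ℝ≥0∞} (hh : Measurable h) (k : Fin n) :
    ∫⁻ x, ∫⁻ t, h (Function.update x k t) ∂gauss ∂stdPi n = ∫⁻ x, h x ∂stdPi n := by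
  rw [← lintegral_marg (s := {k}) hh]
  refine lintegral_congr fun x => ?_
  rw [marg, lmarginal_singleton]

lemma marg_tailSet {h : (Fin n → ℝ) → ℝ≥0∞} (hh : Measurable h) (k : Fin n) (x : Fin n → ℝ) :
    ∫⁻ t, marg (tailSet n (k + 1)) h (Function.update x k t) ∂gauss = marg (tailSet n k) h x := by
  rw [tailSet_eq_insert, marg, marg, lmarginal_insert _ hh (notMem_tailSet_succ k)]

lemma marg_tailSet_zero (h : (Fin n → ℝ) → ℝ≥0∞) (x : Fin n → ℝ) :
    marg (tailSet n 0) h x = ∫⁻ y, h y ∂stdPi n := by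
  rw [tailSet_zero, marg, lmarginal_univ]

lemma marg_tailSet_self (h : (Fin n → ℝ) → ℝ≥0∞) : marg (tailSet n n) h = h := by
  rw [tailSet_self, marg, lmarginal_empty]

@[to_additive]
lemma eq_mul_prod_of_forall_succ {M : Type*} [CommMonoid M] {n : ℕ} {a : ℕ → M} {d : Fin n → M}
    (h : ∀ k : Fin n, a (k + 1) = a k * d k) : a n = a 0 * ∏ k, d k := by
  induction n with
  | zero => simp
  | succ n ih =>
    rw [Fin.prod_univ_castSucc, ← mul_assoc, ← ih fun k => h k.castSucc]
    exact h (Fin.last n)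

end

/-- Averaging a smooth family of densities over a parameter yields a density with finite Fisher
information, and the Fisher information does not increase. -/
lemma FisherDensity.of_average {Y : Type*} [MeasurableSpace Y] {ρ : Measure Y} [SFinite ρ]
    {H H' : ℝ → Y → ℝ} (hHm : Measurable fun z : ℝ × Y => H z.1 z.2)
    (hHm' : Measurable fun z : ℝ × Y => H' z.1 z.2) (h0 : ∀ t y, 0 ≤ H t y)
    (hd : ∀ y t, HasDerivAt (fun t => H t y) (H' t y) t) (hc : ∀ y, Continuous fun t => H' t y)
    (hz : ∀ t y, H t y = 0 → H' t y = 0)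
    {a : ℝ} (ha : 0 < a)
    (hmass : ∫⁻ t, ∫⁻ y, ENNReal.ofReal (H t y) ∂ρ ∂gauss = ENNReal.ofReal a)
    (hfisher : ∫⁻ t, ∫⁻ y, ENNReal.ofReal (H' t y ^ 2 / H t y) ∂ρ ∂gauss ≠ ∞) :
    FisherDensity (fun t => (∫ y, H t y ∂ρ) / a) (fun t => (∫ y, H' t y ∂ρ) / a) ∧
    (∀ t, ENNReal.ofReal (∫ y, H t y ∂ρ) = ∫⁻ y, ENNReal.ofReal (H t y) ∂ρ) ∧
    ENNReal.ofReal a * ∫⁻ t, ENNReal.ofReal (((∫ y, H' t y ∂ρ) / a) ^ 2 / ((∫ y, H t y ∂ρ) / a))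
      ∂gauss ≤ ∫⁻ t, ∫⁻ y, ENNReal.ofReal (H' t y ^ 2 / H t y) ∂ρ ∂gauss := by
  have hHy : ∀ t, Measurable (H t) := fun t => hHm.comp (by fun_prop : Measurable fun y => (t, y))
  have hHy' : ∀ t, Measurable (H' t) := fun t => hHm'.comp (by fun_prop : Measurable fun y => (t, y))
  have hpt : ∀ (c : ℝ) t y, 2 * c * H' t y ≤ c ^ 2 * H t y + H' t y ^ 2 / H t y := fun c t y => by
    rcases (h0 t y).eq_or_lt with h | h
    · rw [hz t y h.symm, ← h]; simp
    have : 0 ≤ (c * H t y - H' t y) ^ 2 / H t y := by positivity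
    have e : (c * H t y - H' t y) ^ 2 / H t y
        = c ^ 2 * H t y - 2 * c * H' t y + H' t y ^ 2 / H t y := by field_simp; ring
    linarith
  have hq0 : ∀ t y, 0 ≤ H' t y ^ 2 / H t y := fun t y => div_nonneg (sq_nonneg _) (h0 t y)
  have habs : ∀ t y, ‖H' t y‖ₑ
      ≤ ENNReal.ofReal (H t y) + ENNReal.ofReal (H' t y ^ 2 / H t y) := fun t y => by
    rw [← ENNReal.ofReal_add (h0 t y) (hq0 t y), Real.enorm_eq_ofReal_abs]
    refine ENNReal.ofReal_le_ofReal (abs_le.2 ⟨?_, ?_⟩)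
    · have := hpt (-1) t y; have := h0 t y; have := hq0 t y; linarith
    · have := hpt 1 t y; have := h0 t y; have := hq0 t y; linarith
  have hfin : ∫⁻ t, ∫⁻ y, ‖H' t y‖ₑ ∂ρ ∂gauss ≠ ∞ := by
    have : ∫⁻ t, ∫⁻ y, ‖H' t y‖ₑ ∂ρ ∂gauss
        ≤ ENNReal.ofReal a + ∫⁻ t, ∫⁻ y, ENNReal.ofReal (H' t y ^ 2 / H t y) ∂ρ ∂gauss := by
      rw [← hmass, ← lintegral_add_left]
      · refine lintegral_mono fun t => ?_
        rw [← lintegral_add_left (hHy t).ennreal_ofReal]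
        exact lintegral_mono (habs t)
      · exact hHm.ennreal_ofReal.lintegral_prod_right'
    exact ne_top_of_le_ne_top (ENNReal.add_ne_top.2 ⟨ENNReal.ofReal_ne_top, hfisher⟩) this
  have hNm : Measurable fun t => ∫⁻ y, ‖H' t y‖ₑ ∂ρ := hHm'.enorm.lintegral_prod_right'
  have hint : ∀ b c : ℝ, Integrable (fun z : ℝ × Y => H' z.1 z.2)
      ((volume.restrict (Ioc b c)).prod ρ) := by
    intro b c
    refine ⟨hHm'.aestronglyMeasurable, ?_⟩
    rw [HasFiniteIntegral, lintegral_prod _ hHm'.enorm.aemeasurable]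
    rw [lintegral_gauss hNm.aemeasurable] at hfin
    rcases lt_or_ge c b with hbc | hbc
    · simp [Ioc_eq_empty (not_lt.2 hbc.le)]
    obtain ⟨x0, -, hx0⟩ := isCompact_Icc.exists_isMinOn (nonempty_Icc.2 hbc)
      continuous_gpdf.continuousOn
    have h1 : (∫⁻ t in Ioc b c, ∫⁻ y, ‖H' t y‖ₑ ∂ρ) * ENNReal.ofReal (gpdf x0)
        ≤ ∫⁻ t, (∫⁻ y, ‖H' t y‖ₑ ∂ρ) * ENNReal.ofReal (gpdf t) := by
      rw [← lintegral_mul_const _ hNm]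
      refine le_trans (setLIntegral_mono' measurableSet_Ioc fun t ht => ?_)
        (setLIntegral_le_lintegral (Ioc b c) _)
      gcongr
      exact hx0 (Ioc_subset_Icc_self ht)
    by_contra htop
    rw [not_lt, top_le_iff] at htop
    rw [htop, ENNReal.top_mul (by simpa using gpdf_pos x0), top_le_iff] at h1
    exact hfin h1
  have hFTC : ∀ b c y, H c y - H b y = ∫ t in b..c, H' t y := fun b c y =>
    (intervalIntegral.integral_eq_sub_of_hasDerivAt (fun t _ => hd y t)
      ((hc y).intervalIntegrable _ _)).symm
  have hdiff : ∀ b c, b ≤ c → Integrable (fun y => H c y - H b y) ρ ∧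
      ∫ y, (H c y - H b y) ∂ρ = ∫ t in b..c, ∫ y, H' t y ∂ρ := fun b c hbc => by
    have e : (fun y => H c y - H b y) = fun y => ∫ t in Ioc b c, H' t y := by
      ext y; rw [hFTC, intervalIntegral.integral_of_le hbc]
    rw [e]
    refine ⟨(hint b c).integral_prod_right, ?_⟩
    rw [intervalIntegral.integral_of_le hbc]
    exact (integral_integral_swap (f := fun t y => H' t y) (hint b c)).symm
  obtain ⟨t0, ht0⟩ : ∃ t, ∫⁻ y, ENNReal.ofReal (H t y) ∂ρ < ∞ := by
    refine (ae_lt_top (μ := gauss) hHm.ennreal_ofReal.lintegral_prod_right' ?_).exists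
    rw [hmass]; exact ENNReal.ofReal_ne_top
  have hi0 : Integrable (H t0) ρ :=
    ⟨(hHy t0).aestronglyMeasurable, by
      rwa [hasFiniteIntegral_iff_ofReal (ae_of_all _ (h0 t0))]⟩
  have hi : ∀ t, Integrable (H t) ρ := fun t => by
    rcases le_total t0 t with h | h
    · exact ((hdiff t0 t h).1.add hi0).congr (ae_of_all _ fun y => by simp)
    · exact (hi0.sub (hdiff t t0 h).1).congr (ae_of_all _ fun y => by simp)
  have hof : ∀ t, ENNReal.ofReal (∫ y, H t y ∂ρ) = ∫⁻ y, ENNReal.ofReal (H t y) ∂ρ := fun t =>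
    ofReal_integral_eq_lintegral_ofReal (hi t) (ae_of_all _ (h0 t))
  have hφ0 : ∀ t, 0 ≤ ∫ y, H t y ∂ρ := fun t => integral_nonneg (h0 t)
  have hcs : ∀ t, ENNReal.ofReal a * ENNReal.ofReal (((∫ y, H' t y ∂ρ) / a) ^ 2
      / ((∫ y, H t y ∂ρ) / a)) ≤ ∫⁻ y, ENNReal.ofReal (H' t y ^ 2 / H t y) ∂ρ := by
    intro t
    by_cases hQ : ∫⁻ y, ENNReal.ofReal (H' t y ^ 2 / H t y) ∂ρ = ∞
    · rw [hQ]; exact le_top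
    have iQ : Integrable (fun y => H' t y ^ 2 / H t y) ρ := by
      refine ⟨(((hHy' t).pow_const 2).div (hHy t)).aestronglyMeasurable, ?_⟩
      rw [hasFiniteIntegral_iff_ofReal (ae_of_all _ (hq0 t))]
      exact lt_top_iff_ne_top.2 hQ
    have i' : Integrable (H' t) ρ := by
      refine ((hi t).add iQ).mono' (hHy' t).aestronglyMeasurable (ae_of_all _ fun y => ?_)
      have h1 := habs t y
      rw [← ENNReal.ofReal_add (h0 t y) (hq0 t y), ← ofReal_norm,
        ENNReal.ofReal_le_ofReal_iff (add_nonneg (h0 t y) (hq0 t y))] at h1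
      exact h1
    rw [← ofReal_integral_eq_lintegral_ofReal iQ (ae_of_all _ (hq0 t)),
      ← ENNReal.ofReal_mul ha.le]
    refine ENNReal.ofReal_le_ofReal ?_
    have e : a * (((∫ y, H' t y ∂ρ) / a) ^ 2 / ((∫ y, H t y ∂ρ) / a))
        = (∫ y, H' t y ∂ρ) ^ 2 / ∫ y, H t y ∂ρ := by
      rcases eq_or_ne (∫ y, H t y ∂ρ) 0 with h | h
      · simp [h]
      · field_simp
    rw [e]
    rcases (hφ0 t).eq_or_lt with h | h
    · rw [← h, div_zero]; exact integral_nonneg (hq0 t)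
    set c := (∫ y, H' t y ∂ρ) / ∫ y, H t y ∂ρ with hcdef
    have h2 : ∫ y, 2 * c * H' t y ∂ρ ≤ ∫ y, (c ^ 2 * H t y + H' t y ^ 2 / H t y) ∂ρ :=
      integral_mono (i'.const_mul _) (((hi t).const_mul _).add iQ) (hpt c t)
    rw [integral_const_mul, integral_add ((hi t).const_mul _) iQ, integral_const_mul] at h2
    have h3 : ∫ y, H' t y ∂ρ = c * ∫ y, H t y ∂ρ := by rw [hcdef]; field_simp
    have h4 : (∫ y, H' t y ∂ρ) ^ 2 / ∫ y, H t y ∂ρ = c ^ 2 * ∫ y, H t y ∂ρ := by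
      rw [h3]; field_simp
    rw [h4]
    rw [h3] at h2
    linarith
  have hfle : ENNReal.ofReal a * ∫⁻ t, ENNReal.ofReal (((∫ y, H' t y ∂ρ) / a) ^ 2
      / ((∫ y, H t y ∂ρ) / a)) ∂gauss
      ≤ ∫⁻ t, ∫⁻ y, ENNReal.ofReal (H' t y ^ 2 / H t y) ∂ρ ∂gauss := by
    rw [← lintegral_const_mul' _ _ ENNReal.ofReal_ne_top]
    exact lintegral_mono hcs
  refine ⟨⟨fun t => div_nonneg (hφ0 t) ha.le, ?_, fun b c => ?_, fun b c => ?_, fun t ht => ?_, ?_,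
    ?_⟩, hof, hfle⟩
  · exact (hHm'.stronglyMeasurable.integral_prod_right').measurable.div_const a
  · refine IntervalIntegrable.div_const ?_ a
    refine ⟨?_, ?_⟩
    · exact (hint b c).integral_prod_left
    · exact (hint c b).integral_prod_left
  · have key : ∀ b c, b ≤ c → (∫ y, H c y ∂ρ) - ∫ y, H b y ∂ρ = ∫ t in b..c, ∫ y, H' t y ∂ρ :=
      fun b c hbc => by rw [← integral_sub (hi c) (hi b), (hdiff b c hbc).2]
    rw [intervalIntegral.integral_div, ← sub_div]
    congr 1
    rcases le_total b c with h | h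
    · exact key b c h
    · rw [intervalIntegral.integral_symm, ← key c b h]; ring
  · have h1 : ∫ y, H t y ∂ρ = 0 := by simpa [ha.ne'] using ht
    rw [integral_eq_zero_iff_of_nonneg (h0 t) (hi t)] at h1
    have h2 : ∫ y, H' t y ∂ρ = 0 := by
      rw [integral_eq_zero_of_ae]
      filter_upwards [h1] with y hy using hz t y hy
    rw [h2, zero_div]
  · have : ∀ t, ENNReal.ofReal ((∫ y, H t y ∂ρ) / a)
        = (∫⁻ y, ENNReal.ofReal (H t y) ∂ρ) * (ENNReal.ofReal a)⁻¹ := fun t => by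
      rw [ENNReal.ofReal_div_of_pos ha, hof, ENNReal.div_eq_inv_mul, mul_comm]
    simp_rw [this]
    rw [lintegral_mul_const _ hHm.ennreal_ofReal.lintegral_prod_right', hmass,
      ENNReal.mul_inv_cancel (by simpa using ha) ENNReal.ofReal_ne_top]
  · intro htop
    rw [htop, ENNReal.mul_top (by simpa using ha), top_le_iff] at hfle
    exact hfisher hfle

/-- Triangular maps which transport each conditional law to the standard Gaussian measure transport
the whole measure to the standard Gaussian measure. -/
lemma map_triangular {n : ℕ} {ρ : ℕ → (Fin n → ℝ) → ℝ≥0∞} (hρm : ∀ j, Measurable (ρ j))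
    (hρ : ∀ x, ρ 0 x = 1) {S : Fin n → (Fin n → ℝ) → ℝ} (hSm : ∀ k, Measurable (S k))
    (hS : ∀ k : Fin n, FreeOf (tailSet n (k + 1)) (S k))
    (hpush : ∀ k : Fin n, ∀ᵐ x ∂stdPi n, ∀ B : Set ℝ, MeasurableSet B →
      ∫⁻ t, B.indicator 1 (S k (Function.update x k t)) * ρ (k + 1) (Function.update x k t) ∂gauss
        = ρ k x * gauss B) :
    ((stdPi n).withDensity (ρ n)).map (fun x k => S k x) = stdPi n := by
  have hSm' : Measurable fun x k => S k x := measurable_pi_lambda _ hSm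
  refine (Measure.pi_eq fun B hB => ?_).symm
  set a : ℕ → ℝ≥0∞ := fun j => ∫⁻ x, (∏ i ∈ Finset.univ.filter (fun i : Fin n => (i : ℕ) < j),
    (B i).indicator 1 (S i x)) * ρ j x ∂stdPi n with ha
  have hPm : ∀ j, Measurable fun x => ∏ i ∈ Finset.univ.filter (fun i : Fin n => (i : ℕ) < j),
      (B i).indicator (1 : ℝ → ℝ≥0∞) (S i x) := fun j =>
    Finset.measurable_prod _ fun i _ => (measurable_one.indicator (hB i)).comp (hSm i)
  have hstep : ∀ k : Fin n, a (k + 1) = a k * gauss (B k) := by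
    intro k
    have e1 : Finset.univ.filter (fun i : Fin n => (i : ℕ) < k + 1)
        = insert k (Finset.univ.filter fun i : Fin n => (i : ℕ) < k) := by
      ext i; simp [Fin.ext_iff]; omega
    have hPfree : ∀ x t, ∏ i ∈ Finset.univ.filter (fun i : Fin n => (i : ℕ) < k),
        (B i).indicator (1 : ℝ → ℝ≥0∞) (S i (Function.update x k t))
        = ∏ i ∈ Finset.univ.filter (fun i : Fin n => (i : ℕ) < k),
        (B i).indicator (1 : ℝ → ℝ≥0∞) (S i x) := fun x t =>
      Finset.prod_congr rfl fun i hi => by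
        rw [(hS i).update]
        simpa [mem_tailSet] using hi
    have hm1 : Measurable fun x => (B k).indicator (1 : ℝ → ℝ≥0∞) (S k x) * ρ (k + 1) x :=
      ((measurable_one.indicator (hB k)).comp (hSm k)).mul (hρm _)
    simp only [ha]
    rw [← lintegral_lintegral_update (h := fun x =>
      (∏ i ∈ Finset.univ.filter (fun i : Fin n => (i : ℕ) < k + 1),
        (B i).indicator 1 (S i x)) * ρ (k + 1) x) ((hPm (k + 1)).mul (hρm (k + 1))) k,
      ← lintegral_mul_const (gauss (B k)) (f := fun x =>
        (∏ i ∈ Finset.univ.filter (fun i : Fin n => (i : ℕ) < k),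
          (B i).indicator 1 (S i x)) * ρ k x) ((hPm k).mul (hρm k))]
    refine lintegral_congr_ae ?_
    filter_upwards [hpush k] with x hx
    simp_rw [e1, Finset.prod_insert (show k ∉ Finset.univ.filter fun i : Fin n => (i : ℕ) < k by simp),
      hPfree, mul_assoc]
    have : ∀ t, (B k).indicator (1 : ℝ → ℝ≥0∞) (S k (Function.update x k t)) *
        ((∏ i ∈ Finset.univ.filter (fun i : Fin n => (i : ℕ) < k),
          (B i).indicator (1 : ℝ → ℝ≥0∞) (S i x)) * ρ (k + 1) (Function.update x k t))
        = (∏ i ∈ Finset.univ.filter (fun i : Fin n => (i : ℕ) < k),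
          (B i).indicator (1 : ℝ → ℝ≥0∞) (S i x)) * ((B k).indicator 1 (S k (Function.update x k t))
          * ρ (k + 1) (Function.update x k t)) := fun t => by ring
    simp_rw [this]
    rw [lintegral_const_mul, hx (B k) (hB k)]
    exact hm1.comp (measurable_update x)
  have h0 : a 0 = 1 := by simp [ha, hρ]
  have hn := eq_mul_prod_of_forall_succ hstep
  rw [h0, one_mul] at hn
  rw [← hn, Measure.map_apply hSm' (MeasurableSet.univ_pi hB), withDensity_apply _
    (hSm' (MeasurableSet.univ_pi hB)), ← lintegral_indicator (hSm' (MeasurableSet.univ_pi hB))]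
  refine lintegral_congr fun x => ?_
  have hu : Finset.univ.filter (fun i : Fin n => (i : ℕ) < n) = Finset.univ := by simp
  rw [hu]
  by_cases hx : x ∈ (fun x k => S k x) ⁻¹' (univ.pi B)
  · rw [indicator_of_mem hx, Finset.prod_eq_one fun i _ => ?_, one_mul]
    exact indicator_of_mem (hx i trivial) _
  · rw [indicator_of_notMem hx]
    have : ∃ i, S i x ∉ B i := by simpa [Set.mem_pi] using hx
    obtain ⟨i, hi⟩ := this
    rw [Finset.prod_eq_zero (Finset.mem_univ i) (indicator_of_notMem hi _), zero_mul]

section Tensor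

variable {n : ℕ}

/-- The density of the first `j` coordinates. -/
def dens (F : (Fin n → ℝ) → ℝ) (j : ℕ) : (Fin n → ℝ) → ℝ≥0∞ :=
  marg (tailSet n j) fun x => ENNReal.ofReal (F x)

/-- The conditional density of the `k`-th coordinate given the previous ones. -/
def condDens (F : (Fin n → ℝ) → ℝ) (k : Fin n) (x : Fin n → ℝ) (t : ℝ) : ℝ :=
  (dens F (k + 1) (Function.update x k t) / dens F k x).toReal

/-- The conditional mean of the `k`-th coordinate given the previous ones. -/
def condMean (F : (Fin n → ℝ) → ℝ) (k : Fin n) (x : Fin n → ℝ) : ℝ :=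
  ∫ t, t * condDens F k x t ∂gauss

/-- The conditional relative entropy of the `k`-th coordinate given the previous ones. -/
def condEnt (F : (Fin n → ℝ) → ℝ) (k : Fin n) (x : Fin n → ℝ) : ℝ≥0∞ :=
  ∫⁻ t, ENNReal.ofReal (klFun (condDens F k x t)) ∂gauss

/-- The triangular transport map. -/
def triMap (F : (Fin n → ℝ) → ℝ) (k : Fin n) (x : Fin n → ℝ) : ℝ :=
  gaussTransport (condDens F k x) (x k)

/-- The `k`-th partial derivative. -/
def pderiv (F : (Fin n → ℝ) → ℝ) (k : Fin n) (x : Fin n → ℝ) : ℝ := fderiv ℝ F x (Pi.single k 1)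

/-- The integrand of the `k`-th summand of the Fisher information. -/
def fisherDens (F : (Fin n → ℝ) → ℝ) (k : Fin n) (x : Fin n → ℝ) : ℝ≥0∞ :=
  ENNReal.ofReal (pderiv F k x ^ 2 / F x)

variable {F : (Fin n → ℝ) → ℝ}

lemma freeOf_dens (F : (Fin n → ℝ) → ℝ) (j : ℕ) : FreeOf (tailSet n j) (dens F j) :=
  fun _ _ hxy => freeOf_marg _ (fun x => ENNReal.ofReal (F x)) hxy

lemma freeOf_condDens (F : (Fin n → ℝ) → ℝ) (k : Fin n) :
    FreeOf (tailSet n k) (condDens F k) := fun x y hxy => by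
  ext t
  unfold condDens
  rw [freeOf_dens F k hxy, freeOf_dens F (k + 1) (x := Function.update x k t)
    (y := Function.update y k t) fun i hi => ?_]
  rcases eq_or_ne i k with rfl | hik
  · simp
  · rw [Function.update_of_ne hik, Function.update_of_ne hik]
    refine hxy i ?_
    rw [mem_tailSet] at hi ⊢
    have : (i : ℕ) ≠ k := fun h => hik (Fin.ext h)
    omega

lemma freeOf_condMean (F : (Fin n → ℝ) → ℝ) (k : Fin n) :
    FreeOf (tailSet n k) (condMean F k) := fun x y hxy => by
  unfold condMean; rw [freeOf_condDens F k hxy]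

lemma FreeOf.mono {α : Type*} {s t : Finset (Fin n)} {c : (Fin n → ℝ) → α} (hc : FreeOf t c)
    (hst : s ⊆ t) : FreeOf s c :=
  fun _ _ hxy => hc fun i hi => hxy i fun h => hi (hst h)

lemma tailSet_succ_subset (k : Fin n) : tailSet n (k + 1) ⊆ tailSet n k := by
  rw [tailSet_eq_insert]; exact Finset.subset_insert _ _

lemma triMap_update (F : (Fin n → ℝ) → ℝ) (k : Fin n) (x : Fin n → ℝ) (t : ℝ) :
    triMap F k (Function.update x k t) = gaussTransport (condDens F k x) t := by
  unfold triMap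
  rw [(freeOf_condDens F k).update (mem_tailSet_self k), Function.update_self]

lemma freeOf_triMap (F : (Fin n → ℝ) → ℝ) (k : Fin n) :
    FreeOf (tailSet n (k + 1)) (triMap F k) := fun x y hxy => by
  unfold triMap
  rw [(freeOf_condDens F k).mono (tailSet_succ_subset k) hxy, hxy k (notMem_tailSet_succ k)]

lemma dens_zero (hmass : ∫⁻ x, ENNReal.ofReal (F x) ∂stdPi n = 1) (x : Fin n → ℝ) :
    dens F 0 x = 1 := by rw [dens, marg_tailSet_zero, hmass]

lemma dens_self (F : (Fin n → ℝ) → ℝ) : dens F n = fun x => ENNReal.ofReal (F x) := by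
  rw [dens, marg_tailSet_self]

lemma measurable_dens (hF : Measurable F) (j : ℕ) : Measurable (dens F j) :=
  measurable_marg hF.ennreal_ofReal

lemma lintegral_dens_update (hF : Measurable F) (k : Fin n) (x : Fin n → ℝ) :
    ∫⁻ t, dens F (k + 1) (Function.update x k t) ∂gauss = dens F k x :=
  marg_tailSet hF.ennreal_ofReal k x

lemma measurable_condDens (hF : Measurable F) (k : Fin n) :
    Measurable fun z : (Fin n → ℝ) × ℝ => condDens F k z.1 z.2 := by
  refine Measurable.ennreal_toReal (Measurable.div ?_ ?_)
  · exact (measurable_dens hF _).comp measurable_update'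
  · exact (measurable_dens hF _).comp measurable_fst

lemma measurable_condDens_right (hF : Measurable F) (k : Fin n) (x : Fin n → ℝ) :
    Measurable (condDens F k x) := by
  unfold condDens
  exact (((measurable_dens hF _).comp (measurable_update x)).div_const _).ennreal_toReal

lemma measurable_condMean (hF : Measurable F) (k : Fin n) : Measurable (condMean F k) := by
  have := measurable_condDens hF k
  have h : Measurable fun z : (Fin n → ℝ) × ℝ => z.2 * condDens F k z.1 z.2 := by fun_prop
  exact h.stronglyMeasurable.integral_prod_right'.measurable

lemma measurable_condEnt (hF : Measurable F) (k : Fin n) : Measurable (condEnt F k) :=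
  (measurable_klFun.comp (measurable_condDens hF k)).ennreal_ofReal.lintegral_prod_right'

lemma measurable_gaussTransport_condDens (hF : Measurable F) (k : Fin n) :
    Measurable fun z : (Fin n → ℝ) × ℝ => gaussTransport (condDens F k z.1) z.2 := by
  refine measurable_probit.comp (Measurable.ennreal_toReal ?_)
  have h1 : MeasurableSet {w : ((Fin n → ℝ) × ℝ) × ℝ | w.2 ≤ w.1.2} :=
    measurableSet_le (by fun_prop) (by fun_prop)
  have h2 : Measurable fun w : ((Fin n → ℝ) × ℝ) × ℝ => ENNReal.ofReal (condDens F k w.1.1 w.2) :=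
    ((measurable_condDens hF k).comp (by fun_prop :
      Measurable fun w : ((Fin n → ℝ) × ℝ) × ℝ => (w.1.1, w.2))).ennreal_ofReal
  have h3 := (h2.indicator h1).lintegral_prod_right' (ν := gauss)
  have e : (fun z : (Fin n → ℝ) × ℝ =>
      ∫⁻ t in Iic z.2, ENNReal.ofReal (condDens F k z.1 t) ∂gauss)
      = fun z => ∫⁻ t, {w : ((Fin n → ℝ) × ℝ) × ℝ | w.2 ≤ w.1.2}.indicator
        (fun w => ENNReal.ofReal (condDens F k w.1.1 w.2)) (z, t) ∂gauss := by
    ext z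
    rw [← lintegral_indicator measurableSet_Iic]
    rfl
  rw [e]
  exact h3

lemma measurable_triMap (hF : Measurable F) (k : Fin n) : Measurable (triMap F k) := by
  unfold triMap
  have h : Measurable fun x : Fin n → ℝ => (x, x k) :=
    measurable_id.prodMk (measurable_pi_apply k)
  exact (measurable_gaussTransport_condDens hF k).comp h

/-- Disintegration along the `k`-th coordinate. -/
lemma lintegral_lintegral_dens_update (hF : Measurable F) (k : Fin n)
    {G : (Fin n → ℝ) → ℝ → ℝ≥0∞} (hG : FreeOf (tailSet n k) G)
    (hGm : Measurable fun z : (Fin n → ℝ) × ℝ => G z.1 z.2) :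
    ∫⁻ x, ∫⁻ t, G x t * dens F (k + 1) (Function.update x k t) ∂gauss ∂stdPi n
      = ∫⁻ x, G x (x k) * ENNReal.ofReal (F x) ∂stdPi n := by
  have hm : Measurable fun x : Fin n → ℝ => G x (x k) :=
    hGm.comp (by fun_prop : Measurable fun x : Fin n → ℝ => (x, x k))
  have hfree : FreeOf (tailSet n (k + 1)) fun x => G x (x k) := fun x y hxy => by
    simp only
    rw [hG.mono (tailSet_succ_subset k) hxy, hxy k (notMem_tailSet_succ k)]
  rw [← lintegral_mul_marg hfree hm hF.ennreal_ofReal]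
  change _ = ∫⁻ x, G x (x k) * dens F (k + 1) x ∂stdPi n
  rw [← lintegral_lintegral_update (h := fun x => G x (x k) * dens F (k + 1) x)
    (hm.mul (measurable_dens hF _)) k]
  refine lintegral_congr fun x => lintegral_congr fun t => ?_
  rw [hG.update (mem_tailSet_self k), Function.update_self]

lemma ae_dens_ne_top (hF : Measurable F) (hmass : ∫⁻ x, ENNReal.ofReal (F x) ∂stdPi n = 1) (j : ℕ) :
    ∀ᵐ x ∂stdPi n, dens F j x ≠ ∞ := by
  refine (ae_lt_top (measurable_dens hF j) ?_).mono fun x hx => hx.ne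
  rw [dens, lintegral_marg hF.ennreal_ofReal, hmass]; simp

lemma lintegral_mul_dens_update (hF : Measurable F) (k : Fin n) {x : Fin n → ℝ}
    (hx : dens F k x ≠ ∞) (v : ℝ → ℝ≥0∞) :
    ∫⁻ t, v t * dens F (k + 1) (Function.update x k t) ∂gauss
      = dens F k x * ∫⁻ t, v t * ENNReal.ofReal (condDens F k x t) ∂gauss := by
  have hm : Measurable fun t => dens F (k + 1) (Function.update x k t) :=
    (measurable_dens hF _).comp (measurable_update x)
  have hi := lintegral_dens_update hF k x
  rw [← lintegral_const_mul' _ _ hx]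
  refine lintegral_congr_ae ?_
  by_cases h0 : dens F k x = 0
  · rw [h0, lintegral_eq_zero_iff hm] at hi
    filter_upwards [hi] with t ht
    rw [h0, ht]; simp
  · filter_upwards [ae_lt_top hm (by rwa [hi])] with t ht
    rw [condDens, ENNReal.ofReal_toReal (ENNReal.div_lt_top ht.ne h0).ne, mul_left_comm,
      ENNReal.mul_div_cancel h0 hx]

lemma ae_lintegral_indicator_triMap (hF : Measurable F)
    (hmass : ∫⁻ x, ENNReal.ofReal (F x) ∂stdPi n = 1) (k : Fin n) :
    ∀ᵐ x ∂stdPi n, ∀ B : Set ℝ, MeasurableSet B →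
      ∫⁻ t, B.indicator 1 (triMap F k (Function.update x k t))
        * dens F (k + 1) (Function.update x k t) ∂gauss = dens F k x * gauss B := by
  filter_upwards [ae_dens_ne_top hF hmass k] with x hx B hB
  have hcm := measurable_condDens_right hF k x
  simp only [triMap_update]
  rw [lintegral_mul_dens_update hF k hx fun t => B.indicator 1 (gaussTransport (condDens F k x) t)]
  by_cases h0 : dens F k x = 0
  · simp [h0]
  congr 1
  have h1 : ∫⁻ t, ENNReal.ofReal (condDens F k x t) ∂gauss = 1 := by
    have h := lintegral_mul_dens_update hF k hx fun _ => 1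
    simp only [one_mul] at h
    rw [lintegral_dens_update hF] at h
    exact (ENNReal.mul_right_inj h0 hx).1 (by rw [mul_one]; exact h.symm)
  have h2 := lintegral_gaussTransport hcm h1 (h := B.indicator 1) (measurable_one.indicator hB)
  rwa [lintegral_indicator_one hB] at h2

/-- The triangular map transports the measure with density `F` to the Gaussian measure. -/
lemma map_triMap (hF : Measurable F) (hmass : ∫⁻ x, ENNReal.ofReal (F x) ∂stdPi n = 1) :
    ((stdPi n).withDensity fun x => ENNReal.ofReal (F x)).map (fun x k => triMap F k x)
      = stdPi n := by
  have h := map_triangular (ρ := dens F) (S := triMap F) (measurable_dens hF) (dens_zero hmass)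
    (measurable_triMap hF) (freeOf_triMap F) (ae_lintegral_indicator_triMap hF hmass)
  rwa [dens_self F] at h

lemma continuous_pderiv (hF : ContDiff ℝ 1 F) (k : Fin n) : Continuous (pderiv F k) :=
  (hF.continuous_fderiv one_ne_zero).clm_apply continuous_const

lemma hasDerivAt_update_comp (hF : ContDiff ℝ 1 F) (k : Fin n) (x : Fin n → ℝ) (t : ℝ) :
    HasDerivAt (fun t => F (Function.update x k t)) (pderiv F k (Function.update x k t)) t :=
  ((hF.differentiable one_ne_zero) _).hasFDerivAt.comp_hasDerivAt t (hasDerivAt_update x k t)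

lemma pderiv_eq_zero (hF0 : ∀ x, 0 ≤ F x) (k : Fin n) {x : Fin n → ℝ} (hx : F x = 0) :
    pderiv F k x = 0 := by
  have : IsLocalMin F x := Eventually.of_forall fun y => by rw [hx]; exact hF0 y
  rw [pderiv, this.fderiv_eq_zero]; simp

/-- Almost all conditional densities have finite Fisher information. -/
lemma exists_fisherDensity_condDens (hF : ContDiff ℝ 1 F) (hF0 : ∀ x, 0 ≤ F x) (k : Fin n)
    {x : Fin n → ℝ} (h0 : dens F k x ≠ 0) (hx : dens F k x ≠ ∞)
    (hQ : marg (tailSet n k) (fisherDens F k) x ≠ ∞) :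
    ∃ g, FisherDensity (condDens F k x) g ∧
      dens F k x * ∫⁻ t, ENNReal.ofReal (g t ^ 2 / condDens F k x t) ∂gauss
        ≤ marg (tailSet n k) (fisherDens F k) x := by
  have hFm : Measurable F := hF.continuous.measurable
  have hQm : Measurable (fisherDens F k) :=
    (((continuous_pderiv hF k).measurable.pow_const 2).div hFm).ennreal_ofReal
  set s := tailSet n (k + 1) with hs
  have hk : k ∉ s := notMem_tailSet_succ k
  have hup : ∀ t (y : s → ℝ), Function.updateFinset (Function.update x k t) s y
      = Function.update (Function.updateFinset x s y) k t := fun t y => by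
    ext i
    by_cases hi : i ∈ s
    · have : i ≠ k := fun h => hk (h ▸ hi)
      simp [Function.updateFinset, hi, this]
    · by_cases h : i = k
      · subst h; simp [Function.updateFinset, hi]
      · simp [Function.updateFinset, hi, h]
  have hum : Measurable fun z : ℝ × (s → ℝ) =>
      Function.updateFinset (Function.update x k z.1) s z.2 :=
    (measurable_updateFinset' (s := s)).comp
      (((measurable_update x).comp measurable_fst).prodMk measurable_snd)
  have key := FisherDensity.of_average (ρ := Measure.pi fun _ : s => gauss)
    (H := fun t y => F (Function.updateFinset (Function.update x k t) s y))
    (H' := fun t y => pderiv F k (Function.updateFinset (Function.update x k t) s y))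
    (a := (dens F k x).toReal) (hFm.comp hum) ((continuous_pderiv hF k).measurable.comp hum)
    (fun t y => hF0 _) (fun y t => by simp_rw [hup]; exact hasDerivAt_update_comp hF k _ t)
    (fun y => by
      simp_rw [hup]
      exact (continuous_pderiv hF k).comp (continuous_const.update k continuous_id))
    (fun t y h => pderiv_eq_zero hF0 k h) (ENNReal.toReal_pos h0 hx)
    (by rw [ENNReal.ofReal_toReal hx]; exact lintegral_dens_update hFm k x)
    (by
      have := marg_tailSet hQm k x
      rw [← this] at hQ; exact hQ)
  obtain ⟨hfd, hof, hle⟩ := key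
  have e : condDens F k x = fun t => (∫ y, F (Function.updateFinset (Function.update x k t) s y)
      ∂(Measure.pi fun _ : s => gauss)) / (dens F k x).toReal := by
    ext t
    rw [condDens, ENNReal.toReal_div]
    congr 1
    have : dens F (k + 1) (Function.update x k t)
      = ∫⁻ y, ENNReal.ofReal (F (Function.updateFinset (Function.update x k t) s y))
        ∂(Measure.pi fun _ : s => gauss) := rfl
    rw [this, ← hof, ENNReal.toReal_ofReal (integral_nonneg fun y => hF0 _)]
  rw [e]
  refine ⟨_, hfd, ?_⟩
  rw [ENNReal.ofReal_toReal hx] at hle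
  refine hle.trans (le_of_eq ?_)
  exact marg_tailSet hQm k x

end Tensor

lemma klFun_mul {a : ℝ} (ha : 0 < a) (s : ℝ) :
    klFun (a * s) = a * klFun s + (s * (a * Real.log a) + (1 - a)) := by
  rcases eq_or_ne s 0 with rfl | hs
  · simp [klFun]
  · rw [klFun, klFun, Real.log_mul ha.ne' hs]; ring

namespace FisherDensity

variable {f g : ℝ → ℝ}

lemma lintegral_klFun_mul (h : FisherDensity f g) {a : ℝ} (ha : 0 < a) :
    ∫⁻ x, ENNReal.ofReal (klFun (a * f x)) ∂gauss
      = ENNReal.ofReal (klFun a)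
        + ENNReal.ofReal a * ∫⁻ x, ENNReal.ofReal (klFun (f x)) ∂gauss := by
  have hD := h.deficit.1
  have hk0 : ∀ x, 0 ≤ klFun (f x) := fun x => klFun_nonneg (h.nonneg x)
  have hk1 : ∀ x, 0 ≤ klFun (a * f x) := fun x => klFun_nonneg (mul_nonneg ha.le (h.nonneg x))
  have hi1 : Integrable (fun x => f x * (a * Real.log a)) gauss := h.integrable.mul_const _
  have hi2 : Integrable (fun x => f x * (a * Real.log a) + (1 - a)) gauss :=
    hi1.add (integrable_const _)
  have hi : Integrable (fun x => klFun (a * f x)) gauss := by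
    simp_rw [klFun_mul ha]
    exact (hD.const_mul a).add hi2
  rw [← ofReal_integral_eq_lintegral_ofReal hi (ae_of_all _ hk1),
    ← ofReal_integral_eq_lintegral_ofReal hD (ae_of_all _ hk0), ← ENNReal.ofReal_mul ha.le,
    ← ENNReal.ofReal_add (klFun_nonneg ha.le) (mul_nonneg ha.le (integral_nonneg hk0))]
  congr 1
  simp_rw [klFun_mul ha]
  rw [integral_add (hD.const_mul a) hi2, integral_add hi1 (integrable_const _),
    integral_const_mul, integral_mul_const, h.integral_eq_one]
  simp [klFun]
  ring

end FisherDensity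

section Tensor

variable {n : ℕ} {F : (Fin n → ℝ) → ℝ}

lemma measurable_fisherDens (hF : ContDiff ℝ 1 F) (k : Fin n) : Measurable (fisherDens F k) :=
  (((continuous_pderiv hF k).measurable.pow_const 2).div hF.continuous.measurable).ennreal_ofReal

/-- For almost all `x`, either `x` has conditional mass zero or the conditional density is regular. -/
lemma ae_exists_fisherDensity_condDens (hF : ContDiff ℝ 1 F) (hF0 : ∀ x, 0 ≤ F x)
    (hmass : ∫⁻ x, ENNReal.ofReal (F x) ∂stdPi n = 1) (k : Fin n)
    (hQ : ∫⁻ x, fisherDens F k x ∂stdPi n ≠ ∞) :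
    ∀ᵐ x ∂stdPi n, dens F k x ≠ ∞ ∧ (dens F k x ≠ 0 → ∃ g, FisherDensity (condDens F k x) g ∧
      dens F k x * ∫⁻ t, ENNReal.ofReal (g t ^ 2 / condDens F k x t) ∂gauss
        ≤ marg (tailSet n k) (fisherDens F k) x) := by
  have hQm := measurable_fisherDens hF k
  have h2 : ∀ᵐ x ∂stdPi n, marg (tailSet n k) (fisherDens F k) x < ∞ :=
    ae_lt_top (measurable_marg hQm) (by rwa [lintegral_marg hQm])
  filter_upwards [ae_dens_ne_top hF.continuous.measurable hmass k, h2] with x hx hx2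
  exact ⟨hx, fun h0 => exists_fisherDensity_condDens hF hF0 k h0 hx hx2.ne⟩

lemma lintegral_dens_mul_lintegral (hF : Measurable F)
    (hmass : ∫⁻ x, ENNReal.ofReal (F x) ∂stdPi n = 1) (k : Fin n)
    {G : (Fin n → ℝ) → ℝ → ℝ≥0∞} (hG : FreeOf (tailSet n k) G)
    (hGm : Measurable fun z : (Fin n → ℝ) × ℝ => G z.1 z.2) :
    ∫⁻ x, dens F k x * ∫⁻ t, G x t * ENNReal.ofReal (condDens F k x t) ∂gauss ∂stdPi n
      = ∫⁻ x, G x (x k) * ENNReal.ofReal (F x) ∂stdPi n := by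
  rw [← lintegral_lintegral_dens_update hF k hG hGm]
  refine lintegral_congr_ae ?_
  filter_upwards [ae_dens_ne_top hF hmass k] with x hx
  exact (lintegral_mul_dens_update hF k hx (G x)).symm

lemma lintegral_dens_mul (hF : Measurable F) (k : Fin n) {c : (Fin n → ℝ) → ℝ≥0∞}
    (hc : FreeOf (tailSet n k) c) (hcm : Measurable c) :
    ∫⁻ x, dens F k x * c x ∂stdPi n = ∫⁻ x, c x * ENNReal.ofReal (F x) ∂stdPi n := by
  rw [← lintegral_mul_marg hc hcm hF.ennreal_ofReal]
  exact lintegral_congr fun x => mul_comm _ _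

/-- The mean conditional relative entropy of the `k`-th coordinate given the previous ones. -/
def meanEnt (F : (Fin n → ℝ) → ℝ) (k : Fin n) : ℝ≥0∞ := ∫⁻ x, dens F k x * condEnt F k x ∂stdPi n

/-- The second moment of the `k`-th conditional mean. -/
def meanSq (F : (Fin n → ℝ) → ℝ) (k : Fin n) : ℝ≥0∞ :=
  ∫⁻ x, ENNReal.ofReal (condMean F k x ^ 2) * ENNReal.ofReal (F x) ∂stdPi n

/-- The cost of moving the `k`-th recentered coordinate by the triangular transport map. -/
def meanCost (F : (Fin n → ℝ) → ℝ) (k : Fin n) : ℝ≥0∞ :=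
  ∫⁻ x, ENNReal.ofReal (Delta |x k - condMean F k x - triMap F k x|) * ENNReal.ofReal (F x) ∂stdPi n

lemma lintegral_dens_mul_sq (hF : Measurable F) (k : Fin n) :
    ∫⁻ x, dens F k x * ENNReal.ofReal (condMean F k x ^ 2) ∂stdPi n = meanSq F k :=
  lintegral_dens_mul hF k (fun x y hxy => by rw [freeOf_condMean F k hxy])
    ((measurable_condMean hF k).pow_const 2).ennreal_ofReal

lemma lintegral_dens_mul_cost (hF : Measurable F)
    (hmass : ∫⁻ x, ENNReal.ofReal (F x) ∂stdPi n = 1) (k : Fin n) :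
    ∫⁻ x, dens F k x * ∫⁻ t, ENNReal.ofReal (Delta |t - condMean F k x
      - gaussTransport (condDens F k x) t| * condDens F k x t) ∂gauss ∂stdPi n = meanCost F k := by
  have h := lintegral_dens_mul_lintegral hF hmass k
    (G := fun x t => ENNReal.ofReal (Delta |t - condMean F k x - gaussTransport (condDens F k x) t|))
    (fun x y hxy => by
      simp only; rw [freeOf_condMean F k hxy, freeOf_condDens F k hxy])
    (by
      have h1 := measurable_gaussTransport_condDens hF k
      have h2 : Measurable fun z : (Fin n → ℝ) × ℝ => condMean F k z.1 :=
        (measurable_condMean hF k).comp measurable_fst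
      exact (measurable_Delta.comp ((measurable_snd.sub h2).sub h1).abs).ennreal_ofReal)
  rw [meanCost]
  refine Eq.trans ?_ h
  refine lintegral_congr fun x => ?_
  congr 1
  refine lintegral_congr fun t => ?_
  rw [ENNReal.ofReal_mul (Delta_abs_nonneg _)]

lemma lintegral_dens_mul_transport (hF : Measurable F)
    (hmass : ∫⁻ x, ENNReal.ofReal (F x) ∂stdPi n = 1) (k : Fin n) :
    ∫⁻ x, dens F k x * ∫⁻ t, ENNReal.ofReal (condDens F k x t
      * (t - gaussTransport (condDens F k x) t) ^ 2) ∂gauss ∂stdPi n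
      = ∫⁻ x, ENNReal.ofReal ((x k - triMap F k x) ^ 2) * ENNReal.ofReal (F x) ∂stdPi n := by
  have h := lintegral_dens_mul_lintegral hF hmass k
    (G := fun x t => ENNReal.ofReal ((t - gaussTransport (condDens F k x) t) ^ 2))
    (fun x y hxy => by
      simp only; rw [freeOf_condDens F k hxy])
    (by
      have h1 := measurable_gaussTransport_condDens hF k
      exact ((measurable_snd.sub h1).pow_const 2).ennreal_ofReal)
  refine Eq.trans ?_ h
  refine lintegral_congr fun x => ?_
  congr 1
  refine lintegral_congr fun t => ?_
  rw [mul_comm, ENNReal.ofReal_mul (sq_nonneg _)]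

variable (hF : ContDiff ℝ 1 F) (hF0 : ∀ x, 0 ≤ F x)
  (hmass : ∫⁻ x, ENNReal.ofReal (F x) ∂stdPi n = 1) (k : Fin n)
  (hQ : ∫⁻ x, fisherDens F k x ∂stdPi n ≠ ∞)

include hF hF0 hmass hQ

/-- The conditional deficit estimate, integrated. -/
lemma meanCost_add_le {s : ℝ} (hs : 0 < s) :
    meanCost F k + ENNReal.ofReal (8 * Real.pi * s) * meanEnt F k
      + ENNReal.ofReal (4 * Real.pi / s) * meanSq F k
    ≤ ENNReal.ofReal (4 * Real.pi * s) * ∫⁻ x, fisherDens F k x ∂stdPi n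
      + ENNReal.ofReal (8 * Real.pi / s) * meanEnt F k := by
  have hFm := hF.continuous.measurable
  have hQm := measurable_fisherDens hF k
  have hdm := measurable_dens hFm k
  have hem : Measurable fun x => dens F k x * condEnt F k x := hdm.mul (measurable_condEnt hFm k)
  have hsm : Measurable fun x => dens F k x * ENNReal.ofReal (condMean F k x ^ 2) :=
    hdm.mul ((measurable_condMean hFm k).pow_const 2).ennreal_ofReal
  rw [← lintegral_dens_mul_cost hFm hmass k, ← lintegral_dens_mul_sq hFm k, meanEnt,
    ← lintegral_marg (s := tailSet n k) hQm, ← lintegral_const_mul _ hem,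
    ← lintegral_const_mul _ hsm, ← lintegral_const_mul _ hem,
    ← lintegral_const_mul _ (measurable_marg hQm), ← lintegral_add_right _ (hem.const_mul _),
    ← lintegral_add_right _ (hsm.const_mul _), ← lintegral_add_right _ (hem.const_mul _)]
  refine lintegral_mono_ae ?_
  filter_upwards [ae_exists_fisherDensity_condDens hF hF0 hmass k hQ] with x hx
  by_cases h0 : dens F k x = 0
  · simp [h0]
  obtain ⟨g, hg, hle⟩ := hx.2 h0
  have h := mul_le_mul_right (hg.deficit_add hs) (dens F k x)
  calc _ = dens F k x * _ := by
        rw [mul_left_comm _ (dens F k x), mul_left_comm _ (dens F k x), ← mul_add, ← mul_add]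
        rfl
    _ ≤ _ := h
    _ ≤ _ := by
        rw [mul_add, mul_left_comm, mul_left_comm (dens F k x)]
        exact add_le_add_left (mul_le_mul_right hle _) _

lemma lintegral_transport_le :
    ∫⁻ x, ENNReal.ofReal ((x k - triMap F k x) ^ 2) * ENNReal.ofReal (F x) ∂stdPi n
      ≤ 2 * meanEnt F k := by
  have hFm := hF.continuous.measurable
  have hem : Measurable fun x => dens F k x * condEnt F k x :=
    (measurable_dens hFm k).mul (measurable_condEnt hFm k)
  rw [← lintegral_dens_mul_transport hFm hmass k, meanEnt, ← lintegral_const_mul _ hem]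
  refine lintegral_mono_ae ?_
  filter_upwards [ae_exists_fisherDensity_condDens hF hF0 hmass k hQ] with x hx
  by_cases h0 : dens F k x = 0
  · simp [h0]
  obtain ⟨g, hg, -⟩ := hx.2 h0
  rw [mul_left_comm, condEnt]
  refine mul_le_mul_right (hg.deficit.2.2.1.trans (le_of_eq ?_)) _
  rw [ENNReal.ofReal_mul zero_le_two, ofReal_integral_eq_lintegral_ofReal hg.deficit.1
    (ae_of_all _ fun t => klFun_nonneg (hg.nonneg t))]
  simp

lemma meanSq_le : meanSq F k ≤ 2 * meanEnt F k := by
  have hFm := hF.continuous.measurable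
  have hem : Measurable fun x => dens F k x * condEnt F k x :=
    (measurable_dens hFm k).mul (measurable_condEnt hFm k)
  rw [← lintegral_dens_mul_sq hFm k, meanEnt, ← lintegral_const_mul _ hem]
  refine lintegral_mono_ae ?_
  filter_upwards [ae_exists_fisherDensity_condDens hF hF0 hmass k hQ] with x hx
  by_cases h0 : dens F k x = 0
  · simp [h0]
  obtain ⟨g, hg, -⟩ := hx.2 h0
  rw [mul_left_comm, condEnt]
  refine mul_le_mul_right ((ENNReal.ofReal_le_ofReal hg.deficit.2.2.2.1).trans (le_of_eq ?_)) _
  rw [ENNReal.ofReal_mul zero_le_two, ofReal_integral_eq_lintegral_ofReal hg.deficit.1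
    (ae_of_all _ fun t => klFun_nonneg (hg.nonneg t))]
  simp

/-- The logarithmic Sobolev inequality for the conditional laws, integrated. -/
lemma two_mul_meanEnt_le : 2 * meanEnt F k ≤ ∫⁻ x, fisherDens F k x ∂stdPi n := by
  have hFm := hF.continuous.measurable
  have hem : Measurable fun x => dens F k x * condEnt F k x :=
    (measurable_dens hFm k).mul (measurable_condEnt hFm k)
  rw [← lintegral_marg (s := tailSet n k) (measurable_fisherDens hF k), meanEnt,
    ← lintegral_const_mul _ hem]
  refine lintegral_mono_ae ?_
  filter_upwards [ae_exists_fisherDensity_condDens hF hF0 hmass k hQ] with x hx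
  by_cases h0 : dens F k x = 0
  · simp [h0]
  obtain ⟨g, hg, hle⟩ := hx.2 h0
  refine le_trans ?_ hle
  rw [mul_left_comm, condEnt]
  refine mul_le_mul_right ?_ _
  rw [← ofReal_integral_eq_lintegral_ofReal hg.deficit.1
    (ae_of_all _ fun t => klFun_nonneg (hg.nonneg t)),
    ← ofReal_integral_eq_lintegral_ofReal hg.integrable_fisher
    (ae_of_all _ fun t => div_nonneg (sq_nonneg _) (hg.nonneg t)),
    show (2 : ℝ≥0∞) = ENNReal.ofReal 2 by simp, ← ENNReal.ofReal_mul zero_le_two]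
  refine ENNReal.ofReal_le_ofReal ?_
  linarith [hg.deficit.2.1]

lemma meanEnt_ne_top : meanEnt F k ≠ ∞ := fun h => by
  have := two_mul_meanEnt_le hF hF0 hmass k hQ
  rw [h, ENNReal.mul_top two_ne_zero, top_le_iff] at this
  exact hQ this

/-- One step of the chain rule for the relative entropy. -/
lemma lintegral_klFun_dens_succ :
    ∫⁻ x, ENNReal.ofReal (klFun (dens F (k + 1) x).toReal) ∂stdPi n
      = ∫⁻ x, ENNReal.ofReal (klFun (dens F k x).toReal) ∂stdPi n + meanEnt F k := by
  have hFm := hF.continuous.measurable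
  have hem : Measurable fun x => dens F k x * condEnt F k x :=
    (measurable_dens hFm k).mul (measurable_condEnt hFm k)
  have hm : ∀ j, Measurable fun x => ENNReal.ofReal (klFun (dens F j x).toReal) := fun j =>
    (measurable_klFun.comp (measurable_dens hFm j).ennreal_toReal).ennreal_ofReal
  rw [← lintegral_lintegral_update (hm _) k, meanEnt, ← lintegral_add_right _ hem]
  refine lintegral_congr_ae ?_
  filter_upwards [ae_exists_fisherDensity_condDens hF hF0 hmass k hQ] with x hx
  have hi := lintegral_dens_update hFm k x
  have hdm : Measurable fun t => dens F (k + 1) (Function.update x k t) :=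
    (measurable_dens hFm _).comp (measurable_update x)
  by_cases h0 : dens F k x = 0
  · rw [h0, lintegral_eq_zero_iff hdm] at hi
    rw [lintegral_congr_ae (g := fun _ => 1)]
    · simp [h0, klFun]
    · filter_upwards [hi] with t ht
      rw [ht]; simp [klFun]
  · obtain ⟨g, hg, -⟩ := hx.2 h0
    have ha := ENNReal.toReal_pos h0 hx.1
    have h := hg.lintegral_klFun_mul ha
    rw [ENNReal.ofReal_toReal hx.1] at h
    rw [condEnt, ← h]
    refine lintegral_congr fun t => ?_
    rw [condDens, ENNReal.toReal_div, mul_div_cancel₀ _ ha.ne']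

end Tensor

section Tensor

variable {n : ℕ} {F : (Fin n → ℝ) → ℝ} (hF : ContDiff ℝ 1 F) (hF0 : ∀ x, 0 ≤ F x)
  (hmass : ∫⁻ x, ENNReal.ofReal (F x) ∂stdPi n = 1)
  (hQ : ∀ k, ∫⁻ x, fisherDens F k x ∂stdPi n ≠ ∞)

include hF hF0 hmass hQ

/-- The chain rule for the relative entropy. -/
lemma lintegral_klFun_eq_sum_meanEnt :
    ∫⁻ x, ENNReal.ofReal (klFun (F x)) ∂stdPi n = ∑ k, meanEnt F k := by
  have h := eq_add_sum_of_forall_succ (n := n)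
    (a := fun j => ∫⁻ x, ENNReal.ofReal (klFun (dens F j x).toReal) ∂stdPi n) (d := meanEnt F)
    fun k => lintegral_klFun_dens_succ hF hF0 hmass k (hQ k)
  simp only [dens_zero hmass, dens_self F, ENNReal.toReal_ofReal (hF0 _)] at h
  rw [h]; simp [klFun]

/-- The deficit estimate in additive form, in dimension `n`. -/
lemma sum_meanCost_add_le {s : ℝ} (hs : 0 < s) :
    ∑ k, meanCost F k + ENNReal.ofReal (8 * Real.pi * s) * ∑ k, meanEnt F k
      + ENNReal.ofReal (4 * Real.pi / s) * ∑ k, meanSq F k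
    ≤ ENNReal.ofReal (4 * Real.pi * s) * ∑ k, ∫⁻ x, fisherDens F k x ∂stdPi n
      + ENNReal.ofReal (8 * Real.pi / s) * ∑ k, meanEnt F k := by
  simp_rw [Finset.mul_sum, ← Finset.sum_add_distrib]
  exact Finset.sum_le_sum fun k _ => meanCost_add_le hF hF0 hmass k (hQ k) hs

end Tensor

/-- The Cameron-Martin formula on the line. -/
lemma lintegral_indicator_sub_mul_exp (m : ℝ) {B : Set ℝ} (hB : MeasurableSet B) :
    ∫⁻ t, B.indicator (1 : ℝ → ℝ≥0∞) (t - m) * ENNReal.ofReal (Real.exp (t * m - m ^ 2 / 2)) ∂gauss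
      = gauss B := by
  have hi : Measurable (B.indicator (1 : ℝ → ℝ≥0∞)) := measurable_one.indicator hB
  have hi' : Measurable fun t => B.indicator (1 : ℝ → ℝ≥0∞) (t - m)
      * ENNReal.ofReal (Real.exp (t * m - m ^ 2 / 2)) :=
    (hi.comp (measurable_id.sub_const m)).mul (by fun_prop)
  rw [lintegral_gauss hi'.aemeasurable, ← lintegral_indicator_one hB, lintegral_gauss hi.aemeasurable,
    ← lintegral_sub_right_eq_self (fun t => B.indicator (1 : ℝ → ℝ≥0∞) t * ENNReal.ofReal (gpdf t)) m]
  refine lintegral_congr fun t => ?_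
  rw [mul_assoc, ← ENNReal.ofReal_mul (Real.exp_pos _).le]
  congr 2
  rw [gpdf_eq, gpdf_eq, mul_left_comm, ← Real.exp_add]
  congr 2
  ring

section Shear

variable {n : ℕ} {m : Fin n → (Fin n → ℝ) → ℝ}

/-- The exponent of the Cameron-Martin density of the first `j` coordinates. -/
def shearExp (m : Fin n → (Fin n → ℝ) → ℝ) (j : ℕ) (x : Fin n → ℝ) : ℝ :=
  ∑ i ∈ Finset.univ.filter (fun i : Fin n => (i : ℕ) < j), (x i * m i x - m i x ^ 2 / 2)

lemma measurable_shearExp (hm : ∀ k, Measurable (m k)) (j : ℕ) : Measurable (shearExp m j) :=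
  Finset.measurable_sum _ fun i _ =>
    ((measurable_pi_apply i).mul (hm i)).sub (((hm i).pow_const 2).div_const 2)

lemma shearExp_update (hf : ∀ k : Fin n, FreeOf (tailSet n k) (m k)) (k : Fin n) (x : Fin n → ℝ)
    (t : ℝ) : shearExp m (k + 1) (Function.update x k t)
      = shearExp m k x + (t * m k x - m k x ^ 2 / 2) := by
  have e1 : Finset.univ.filter (fun i : Fin n => (i : ℕ) < k + 1)
      = insert k (Finset.univ.filter fun i : Fin n => (i : ℕ) < k) := by
    ext i; simp [Fin.ext_iff]; omega
  rw [shearExp, e1, Finset.sum_insert (by simp), Function.update_self,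
    (hf k).update (mem_tailSet_self k), add_comm]
  congr 1
  refine Finset.sum_congr rfl fun i hi => ?_
  have hik : (i : ℕ) < k := by simpa using hi
  rw [(hf i).update (mem_tailSet.2 hik.le), Function.update_of_ne (fun h => by simp [h] at hik)]

lemma map_shear (hm : ∀ k, Measurable (m k)) (hf : ∀ k : Fin n, FreeOf (tailSet n k) (m k)) :
    ((stdPi n).withDensity fun x => ENNReal.ofReal (Real.exp (shearExp m n x))).map
      (fun x k => x k - m k x) = stdPi n := by
  refine map_triangular (ρ := fun j x => ENNReal.ofReal (Real.exp (shearExp m j x)))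
    (S := fun k x => x k - m k x) (fun j => (measurable_shearExp hm j).exp.ennreal_ofReal)
    (fun x => by simp [shearExp]) (fun k => (measurable_pi_apply k).sub (hm k))
    (fun k x y hxy => ?_) (fun k => ae_of_all _ fun x B hB => ?_)
  · simp only
    rw [hxy k (notMem_tailSet_succ k), (hf k).mono (tailSet_succ_subset k) hxy]
  · have e : ∀ t, B.indicator (1 : ℝ → ℝ≥0∞) (Function.update x k t k - m k (Function.update x k t))
        * ENNReal.ofReal (Real.exp (shearExp m (k + 1) (Function.update x k t)))
        = ENNReal.ofReal (Real.exp (shearExp m k x)) * (B.indicator 1 (t - m k x)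
          * ENNReal.ofReal (Real.exp (t * m k x - m k x ^ 2 / 2))) := fun t => by
      rw [shearExp_update hf, Real.exp_add, ENNReal.ofReal_mul (Real.exp_pos _).le,
        Function.update_self, (hf k).update (mem_tailSet_self k)]
      ring
    simp only [e]
    rw [lintegral_const_mul' _ _ ENNReal.ofReal_ne_top, lintegral_indicator_sub_mul_exp _ hB]

lemma injective_shear (hf : ∀ k : Fin n, FreeOf (tailSet n k) (m k)) :
    Function.Injective fun (x : Fin n → ℝ) k => x k - m k x := by
  intro x y hxy
  have key : ∀ j : ℕ, ∀ k : Fin n, (k : ℕ) = j → x k = y k := by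
    intro j
    induction j using Nat.strong_induction_on with
    | _ j ih =>
      intro k hk
      have h : x k - m k x = y k - m k y := congrFun hxy k
      rw [hf k fun i hi => ih i (by rw [mem_tailSet] at hi; omega) i rfl] at h
      linarith
  exact funext fun k => key k k rfl

end Shear

lemma klDiv_map_of_injective {α β : Type*} [MeasurableSpace α] [StandardBorelSpace α] [Nonempty α]
    [MeasurableSpace β] [StandardBorelSpace β] {μ ν : Measure α} [IsFiniteMeasure μ]
    [IsFiniteMeasure ν] {S : α → β} (hS : Measurable S) (hi : Function.Injective S) :
    klDiv (μ.map S) (ν.map S) = klDiv μ ν := by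
  refine le_antisymm (klDiv_map_le _ _ hS) ?_
  obtain ⟨R, hR, hRS⟩ := (hS.measurableEmbedding hi).exists_measurable_extend measurable_id
    fun _ => inferInstance
  have h := klDiv_map_le (μ.map S) (ν.map S) hR
  rwa [Measure.map_map hR hS, Measure.map_map hR hS, hRS, Measure.map_id, Measure.map_id] at h

section Law

variable {n : ℕ} {F : (Fin n → ℝ) → ℝ}

/-- The measure with density `F` with respect to the standard Gaussian measure. -/
abbrev lawPi (F : (Fin n → ℝ) → ℝ) : Measure (Fin n → ℝ) :=
  (stdPi n).withDensity fun x => ENNReal.ofReal (F x)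

lemma lintegral_lawPi (hF : Measurable F) {h : (Fin n → ℝ) → ℝ≥0∞} (hh : Measurable h) :
    ∫⁻ x, h x ∂lawPi F = ∫⁻ x, h x * ENNReal.ofReal (F x) ∂stdPi n := by
  rw [lawPi, lintegral_withDensity_eq_lintegral_mul _ hF.ennreal_ofReal hh]
  simp [mul_comm]

lemma isProbabilityMeasure_lawPi (hmass : ∫⁻ x, ENNReal.ofReal (F x) ∂stdPi n = 1) :
    IsProbabilityMeasure (lawPi F) := ⟨by simpa using hmass⟩

lemma klDiv_lawPi (hF : Measurable F) (hF0 : ∀ x, 0 ≤ F x)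
    (hmass : ∫⁻ x, ENNReal.ofReal (F x) ∂stdPi n = 1) :
    klDiv (lawPi F) (stdPi n) = ∫⁻ x, ENNReal.ofReal (klFun (F x)) ∂stdPi n := by
  have := isProbabilityMeasure_lawPi hmass
  rw [klDiv_eq_lintegral_klFun_of_ac (withDensity_absolutelyContinuous _ _)]
  refine lintegral_congr_ae ?_
  filter_upwards [Measure.rnDeriv_withDensity (stdPi n) hF.ennreal_ofReal] with x hx
  rw [hx, ENNReal.toReal_ofReal (hF0 x)]

/-- Disintegration along the `k`-th coordinate, for real integrands. -/
lemma integral_lawPi_eq (hF : Measurable F)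
    (hmass : ∫⁻ x, ENNReal.ofReal (F x) ∂stdPi n = 1) (k : Fin n)
    {G : (Fin n → ℝ) → ℝ → ℝ} (hG : FreeOf (tailSet n k) G)
    (hGm : Measurable fun z : (Fin n → ℝ) × ℝ => G z.1 z.2)
    (hi : Integrable (fun x => G x (x k)) (lawPi F)) :
    ∫ x, G x (x k) ∂lawPi F = ∫ x, ∫ t, G x t * condDens F k x t ∂gauss ∂lawPi F := by
  have hcd := measurable_condDens hF k
  have hc0 : ∀ x t, 0 ≤ condDens F k x t := fun x t => ENNReal.toReal_nonneg
  have aux : ∀ H : (Fin n → ℝ) → ℝ → ℝ, FreeOf (tailSet n k) H →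
      (Measurable fun z : (Fin n → ℝ) × ℝ => H z.1 z.2) →
      (Measurable fun x => ∫⁻ t, ENNReal.ofReal (H x t * condDens F k x t) ∂gauss) ∧
      ∫⁻ x, ∫⁻ t, ENNReal.ofReal (H x t * condDens F k x t) ∂gauss ∂lawPi F
        = ∫⁻ x, ENNReal.ofReal (H x (x k)) ∂lawPi F := by
    intro H hH hHm
    have hm : Measurable fun x => ∫⁻ t, ENNReal.ofReal (H x t * condDens F k x t) ∂gauss :=
      (hHm.mul hcd).ennreal_ofReal.lintegral_prod_right'
    have hHk : Measurable fun x : Fin n → ℝ => H x (x k) :=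
      hHm.comp (measurable_id.prodMk (measurable_pi_apply k))
    refine ⟨hm, ?_⟩
    rw [lintegral_lawPi hF hm, lintegral_lawPi hF hHk.ennreal_ofReal,
      ← lintegral_dens_mul_lintegral hF hmass k (G := fun x t => ENNReal.ofReal (H x t))
      (fun x y hxy => by simp only; rw [hH hxy]) hHm.ennreal_ofReal, ← lintegral_dens_mul hF k
      (fun x y hxy => by rw [hH hxy, freeOf_condDens F k hxy]) hm]
    refine lintegral_congr fun x => ?_
    congr 1
    exact lintegral_congr fun t => ENNReal.ofReal_mul' (hc0 x t)
  obtain ⟨hPm, hP⟩ := aux G hG hGm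
  obtain ⟨hNm, hN⟩ := aux (fun x t => -G x t) (fun x y hxy => by simp only; rw [hG hxy]) hGm.neg
  have hPf : ∫⁻ x, ENNReal.ofReal (G x (x k)) ∂lawPi F ≠ ∞ := by
    refine ne_top_of_le_ne_top hi.2.ne (lintegral_mono fun x => ?_)
    exact Real.ofReal_le_enorm _
  have hNf : ∫⁻ x, ENNReal.ofReal (-G x (x k)) ∂lawPi F ≠ ∞ := by
    refine ne_top_of_le_ne_top hi.2.ne (lintegral_mono fun x => ?_)
    rw [← enorm_neg]
    exact Real.ofReal_le_enorm _
  have hPae := ae_lt_top hPm (by rw [hP]; exact hPf)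
  have hNae := ae_lt_top hNm (by rw [hN]; exact hNf)
  rw [integral_eq_lintegral_pos_part_sub_lintegral_neg_part hi, ← hP, ← hN,
    ← integral_toReal hPm.aemeasurable hPae, ← integral_toReal hNm.aemeasurable hNae,
    ← integral_sub (integrable_toReal_of_lintegral_ne_top hPm.aemeasurable (by rw [hP]; exact hPf))
      (integrable_toReal_of_lintegral_ne_top hNm.aemeasurable (by rw [hN]; exact hNf))]
  refine integral_congr_ae ?_
  filter_upwards [hPae, hNae] with x hx1 hx2
  have hm : Measurable fun t => G x t * condDens F k x t :=
    (hGm.mul hcd).comp measurable_prodMk_left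
  rw [integral_eq_lintegral_pos_part_sub_lintegral_neg_part]
  · simp only [neg_mul]
  · refine ⟨hm.aestronglyMeasurable, ?_⟩
    have e : ∀ a : ℝ, ‖a‖ₑ = ENNReal.ofReal a + ENNReal.ofReal (-a) := fun a => by
      rw [Real.enorm_eq_ofReal_abs]
      rcases le_total 0 a with h | h
      · rw [abs_of_nonneg h, ENNReal.ofReal_of_nonpos (neg_nonpos.2 h), add_zero]
      · rw [abs_of_nonpos h, ENNReal.ofReal_of_nonpos h, zero_add]
    simp only [HasFiniteIntegral, e]
    rw [lintegral_add_left hm.ennreal_ofReal]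
    simp only [neg_mul] at hx2
    exact ENNReal.add_lt_top.2 ⟨hx1, hx2⟩

lemma integral_mul_lawPi (hF : Measurable F)
    (hmass : ∫⁻ x, ENNReal.ofReal (F x) ∂stdPi n = 1) (k : Fin n)
    {c : (Fin n → ℝ) → ℝ} (hc : FreeOf (tailSet n k) c) (hcm : Measurable c)
    (hi : Integrable (fun x => c x * x k) (lawPi F)) :
    ∫ x, c x * x k ∂lawPi F = ∫ x, c x * condMean F k x ∂lawPi F := by
  rw [integral_lawPi_eq hF hmass k (G := fun x t => c x * t)
    (fun x y hxy => by simp only; rw [hc hxy]) (by fun_prop) hi]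
  refine integral_congr_ae (ae_of_all _ fun x => ?_)
  simp only [mul_assoc]
  rw [integral_const_mul, condMean]

end Law

section Recenter

variable {n : ℕ} {F : (Fin n → ℝ) → ℝ} (hF : ContDiff ℝ 1 F) (hF0 : ∀ x, 0 ≤ F x)
  (hmass : ∫⁻ x, ENNReal.ofReal (F x) ∂stdPi n = 1)
  (hQ : ∀ k, ∫⁻ x, fisherDens F k x ∂stdPi n ≠ ∞)

include hF hF0 hmass hQ

lemma memLp_condMean (k : Fin n) : MemLp (condMean F k) 2 (lawPi F) := by
  have hFm := hF.continuous.measurable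
  have hm := measurable_condMean hFm k
  rw [memLp_two_iff_integrable_sq hm.aestronglyMeasurable]
  refine ⟨(hm.pow_const 2).aestronglyMeasurable, ?_⟩
  rw [hasFiniteIntegral_iff_ofReal (ae_of_all _ fun x => sq_nonneg _),
    lintegral_lawPi hFm (hm.pow_const 2).ennreal_ofReal]
  exact (meanSq_le hF hF0 hmass k (hQ k)).trans_lt
    (ENNReal.mul_lt_top (by simp) (meanEnt_ne_top hF hF0 hmass k (hQ k)).lt_top)

lemma memLp_eval (k : Fin n) : MemLp (fun x : Fin n → ℝ => x k) 2 (lawPi F) := by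
  have hFm := hF.continuous.measurable
  have hT := measurable_triMap hFm k
  have h1 : MemLp (fun x : Fin n → ℝ => x k - triMap F k x) 2 (lawPi F) := by
    have hm : Measurable fun x : Fin n → ℝ => x k - triMap F k x := (measurable_pi_apply k).sub hT
    rw [memLp_two_iff_integrable_sq hm.aestronglyMeasurable]
    refine ⟨(hm.pow_const 2).aestronglyMeasurable, ?_⟩
    rw [hasFiniteIntegral_iff_ofReal (ae_of_all _ fun x => sq_nonneg _),
      lintegral_lawPi hFm (hm.pow_const 2).ennreal_ofReal]
    exact (lintegral_transport_le hF hF0 hmass k (hQ k)).trans_lt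
      (ENNReal.mul_lt_top (by simp) (meanEnt_ne_top hF hF0 hmass k (hQ k)).lt_top)
  have h2 : MemLp (triMap F k) 2 (lawPi F) := by
    have hg : MemLp (fun x : Fin n → ℝ => x k) 2 (stdPi n) :=
      (memLp_id_gaussianReal 2).comp_measurePreserving (measurePreserving_eval _ k)
    rw [← map_triMap hFm hmass] at hg
    exact (memLp_map_measure_iff hg.1 (measurable_pi_lambda _ (measurable_triMap hFm)).aemeasurable).1 hg
  exact (h1.add h2).ae_eq (ae_of_all _ fun x => by simp)

/-- The entropy of the recentered measure. -/
lemma klDiv_map_shear_condMean :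
    klDiv (lawPi F) (stdPi n) = ∑ k, meanEnt F k ∧
    klDiv ((lawPi F).map fun x k => x k - condMean F k x) (stdPi n) ≠ ∞ ∧
    (klDiv ((lawPi F).map fun x k => x k - condMean F k x) (stdPi n)).toReal
      = (∑ k, meanEnt F k).toReal - (∑ k, meanSq F k).toReal / 2 := by
  have hFm := hF.continuous.measurable
  have hμ := isProbabilityMeasure_lawPi hmass
  have hm := measurable_condMean hFm
  have hf := freeOf_condMean F
  have hL := memLp_condMean hF hF0 hmass hQ
  have hE := memLp_eval hF hF0 hmass hQ
  have hkl : klDiv (lawPi F) (stdPi n) = ∑ k, meanEnt F k := by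
    rw [klDiv_lawPi hFm hF0 hmass, lintegral_klFun_eq_sum_meanEnt hF hF0 hmass hQ]
  refine ⟨hkl, ?_⟩
  have hD : klDiv (lawPi F) (stdPi n) ≠ ∞ := by
    rw [hkl]; exact ENNReal.sum_ne_top.2 fun k _ => meanEnt_ne_top hF hF0 hmass k (hQ k)
  obtain ⟨hac, hllr⟩ := klDiv_ne_top_iff.1 hD
  set w := shearExp (condMean F) n with hw
  have hwm : Measurable w := measurable_shearExp hm n
  have hSm : Measurable fun (x : Fin n → ℝ) k => x k - condMean F k x :=
    measurable_pi_lambda _ fun k => (measurable_pi_apply k).sub (hm k)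
  have hmap := map_shear hm hf
  have hexp1 : ∫⁻ x, ENNReal.ofReal (Real.exp (w x)) ∂stdPi n = 1 := by
    have h := congrArg (fun ρ => ρ univ) hmap
    simpa [Measure.map_apply hSm] using h
  have hexp0 : ∀ᵐ x ∂stdPi n, 0 ≤ Real.exp (w x) := ae_of_all _ fun x => (Real.exp_pos _).le
  have hexpi : Integrable (fun x => Real.exp (w x)) (stdPi n) :=
    ⟨hwm.exp.aestronglyMeasurable, by
      rw [hasFiniteIntegral_iff_ofReal hexp0, hexp1]; exact ENNReal.one_lt_top⟩
  have hexpint : ∫ x, Real.exp (w x) ∂stdPi n = 1 := by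
    rw [integral_eq_lintegral_of_nonneg_ae hexp0 hexpi.1, hexp1, ENNReal.toReal_one]
  have htilt : (stdPi n).tilted w
      = (stdPi n).withDensity fun x => ENNReal.ofReal (Real.exp (w x)) := by
    rw [Measure.tilted, hexpint]; simp
  have hwi : ∀ k, Integrable (fun x => x k * condMean F k x) (lawPi F) := fun k =>
    (hE k).integrable_mul (hL k)
  have hwi2 : ∀ k, Integrable (fun x => condMean F k x ^ 2 / 2) (lawPi F) := fun k =>
    (hL k).integrable_sq.div_const 2
  have hwf : w = fun x => ∑ k, (x k * condMean F k x - condMean F k x ^ 2 / 2) := by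
    ext x; simp [hw, shearExp]
  have hwI : Integrable w (lawPi F) := by
    rw [hwf]
    exact integrable_finsetSum _ fun k _ => (hwi k).sub (hwi2 k)
  have hwint : ∫ x, w x ∂lawPi F = (∑ k, meanSq F k).toReal / 2 := by
    simp only [hwf]
    rw [integral_finsetSum _ fun k _ => by exact (hwi k).sub (hwi2 k), ENNReal.toReal_sum, Finset.sum_div]
    · refine Finset.sum_congr rfl fun k _ => ?_
      have h1 := integral_mul_lawPi hFm hmass k (hf k) (hm k)
        ((hwi k).congr (ae_of_all _ fun x => mul_comm _ _))
      have h2 : meanSq F k = ENNReal.ofReal (∫ x, condMean F k x ^ 2 ∂lawPi F) := by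
        rw [ofReal_integral_eq_lintegral_ofReal (hL k).integrable_sq
          (ae_of_all _ fun x => sq_nonneg _), lintegral_lawPi hFm ((hm k).pow_const 2).ennreal_ofReal]
        rfl
      rw [integral_sub (hwi k) (hwi2 k), h2, ENNReal.toReal_ofReal
        (integral_nonneg fun x => sq_nonneg _), integral_div]
      simp_rw [mul_comm (_ : ℝ) (condMean F k _), h1, ← sq]
      ring
    · exact fun k _ => ne_top_of_le_ne_top
        (ENNReal.mul_ne_top (by simp) (meanEnt_ne_top hF hF0 hmass k (hQ k)))
        (meanSq_le hF hF0 hmass k (hQ k))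
  have hprob : IsProbabilityMeasure ((stdPi n).tilted w) := isProbabilityMeasure_tilted hexpi
  have hac' : lawPi F ≪ (stdPi n).tilted w := hac.trans (absolutelyContinuous_tilted hexpi)
  have e : klDiv ((lawPi F).map fun x k => x k - condMean F k x) (stdPi n)
      = klDiv (lawPi F) ((stdPi n).tilted w) := by
    rw [← klDiv_map_of_injective (μ := lawPi F) (ν := (stdPi n).tilted w) hSm (injective_shear hf),
      htilt, hmap]
  rw [e]
  refine ⟨klDiv_ne_top hac' (integrable_llr_tilted_right hac hwI hllr hexpi), ?_⟩
  rw [toReal_klDiv_of_measure_eq hac' (by simp), integral_llr_tilted_right hac hwI hexpi hllr,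
    ← toReal_klDiv_of_measure_eq hac (by simp), hkl, hwint, hexpint, Real.log_one, add_zero]

end Recenter

section Density

variable {n : ℕ}

lemma gaussDensity_pos (x : EuclideanSpace ℝ (Fin n)) : 0 < gaussDensity n x := by
  unfold gaussDensity; positivity

lemma contDiff_gaussDensity : ContDiff ℝ 1 (gaussDensity n) := by
  unfold gaussDensity
  exact contDiff_const.mul ((((contDiff_norm_sq ℝ).neg).div_const 2).exp)

/-- The density with respect to the standard Gaussian measure, in coordinates. -/
def gaussRatio (p : EuclideanSpace ℝ (Fin n) → ℝ) (y : Fin n → ℝ) : ℝ :=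
  p (WithLp.toLp 2 y) / gaussDensity n (WithLp.toLp 2 y)

lemma lintegral_toLp_stdPi {h : EuclideanSpace ℝ (Fin n) → ℝ≥0∞} (hh : Measurable h) :
    ∫⁻ y, h (WithLp.toLp 2 y) ∂stdPi n = ∫⁻ x, h x * ENNReal.ofReal (gaussDensity n x) := by
  rw [← lintegral_map hh (WithLp.measurable_toLp 2 _), map_pi_eq_stdGaussian,
    stdGaussian_eq_withDensity, lintegral_withDensity_eq_lintegral_mul _
    contDiff_gaussDensity.continuous.measurable.ennreal_ofReal hh]
  simp [mul_comm]

variable {p : EuclideanSpace ℝ (Fin n) → ℝ}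

lemma contDiff_gaussRatio (hp : ContDiff ℝ 1 p) : ContDiff ℝ 1 (gaussRatio p) :=
  (hp.div contDiff_gaussDensity fun x => (gaussDensity_pos x).ne').comp
    (PiLp.continuousLinearEquiv 2 ℝ fun _ : Fin n => ℝ).symm.contDiff

lemma gaussRatio_nonneg (hp0 : ∀ x, 0 ≤ p x) (y : Fin n → ℝ) : 0 ≤ gaussRatio p y :=
  div_nonneg (hp0 _) (gaussDensity_pos _).le

/-- The law in coordinates has density `gaussRatio p` with respect to the Gaussian measure. -/
lemma map_ofLp_withDensity (hp : ContDiff ℝ 1 p) :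
    (volume.withDensity fun x => ENNReal.ofReal (p x)).map WithLp.ofLp = lawPi (gaussRatio p) := by
  have hpm := hp.continuous.measurable
  have hqm := (contDiff_gaussDensity (n := n)).continuous.measurable
  refine Measure.ext_of_lintegral _ fun h hh => ?_
  have ho : Measurable (WithLp.ofLp : EuclideanSpace ℝ (Fin n) → Fin n → ℝ) :=
    WithLp.measurable_ofLp 2 _
  have hm : Measurable fun x : EuclideanSpace ℝ (Fin n) => h (WithLp.ofLp x) := hh.comp ho
  rw [lintegral_map hh ho, lintegral_withDensity_eq_lintegral_mul _ hpm.ennreal_ofReal hm,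
    lintegral_lawPi (contDiff_gaussRatio hp).continuous.measurable hh]
  have e := lintegral_toLp_stdPi (h := fun x => h (WithLp.ofLp x) *
    ENNReal.ofReal (p x / gaussDensity n x)) (hm.mul (hpm.div hqm).ennreal_ofReal)
  refine Eq.trans ?_ e.symm
  refine lintegral_congr fun x => ?_
  rw [mul_assoc, ← ENNReal.ofReal_mul' (gaussDensity_pos x).le,
    div_mul_cancel₀ _ (gaussDensity_pos x).ne', Pi.mul_apply, mul_comm]

lemma pderiv_gaussRatio (hp : ContDiff ℝ 1 p) (k : Fin n) (y : Fin n → ℝ) :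
    pderiv (gaussRatio p) k y
      = (∇ p (WithLp.toLp 2 y) k * gaussDensity n (WithLp.toLp 2 y)
        - p (WithLp.toLp 2 y) * ∇ (gaussDensity n) (WithLp.toLp 2 y) k)
        / gaussDensity n (WithLp.toLp 2 y) ^ 2 := by
  have hg : ∀ (f : EuclideanSpace ℝ (Fin n) → ℝ) x,
      ∇ f x k = fderiv ℝ f x (EuclideanSpace.single k 1) := fun f x => by
    rw [← inner_gradient_left, EuclideanSpace.inner_single_right]
    simp
  set x : EuclideanSpace ℝ (Fin n) := WithLp.toLp 2 y with hx
  have hline : HasDerivAt (fun t : ℝ => x + t • EuclideanSpace.single k (1 : ℝ))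
      (EuclideanSpace.single k (1 : ℝ)) 0 := by
    simpa using ((hasDerivAt_id (0 : ℝ)).smul_const (EuclideanSpace.single k (1 : ℝ))).const_add x
  have hline' : HasDerivAt (fun t : ℝ => y + t • Pi.single k (1 : ℝ)) (Pi.single k (1 : ℝ)) 0 := by
    simpa using ((hasDerivAt_id (0 : ℝ)).smul_const (Pi.single k (1 : ℝ) : Fin n → ℝ)).const_add y
  have hdir : ∀ f : EuclideanSpace ℝ (Fin n) → ℝ, ContDiff ℝ 1 f →
      HasDerivAt (fun t : ℝ => f (x + t • EuclideanSpace.single k (1 : ℝ))) (∇ f x k) 0 :=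
    fun f hf => by
      rw [hg]
      exact HasFDerivAt.comp_hasDerivAt_of_eq 0 ((hf.differentiable one_ne_zero) x).hasFDerivAt hline
        (by simp)
  have h1 := (hdir p hp).fun_div (hdir _ contDiff_gaussDensity) (gaussDensity_pos _).ne'
  have h2 : HasDerivAt (fun t : ℝ => gaussRatio p (y + t • Pi.single k (1 : ℝ)))
      (pderiv (gaussRatio p) k y) 0 :=
    HasFDerivAt.comp_hasDerivAt_of_eq 0
      (((contDiff_gaussRatio hp).differentiable one_ne_zero) y).hasFDerivAt hline' (by simp)
  have h3 := h2.unique h1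
  simpa using h3

/-- The Fisher information in coordinates. -/
lemma fisherInfo_eq_sum (hp : ContDiff ℝ 1 p) (hp0 : ∀ x, 0 ≤ p x) :
    fisherInfo p (gaussDensity n) = ∑ k, ∫⁻ y, fisherDens (gaussRatio p) k y ∂stdPi n := by
  have hF := contDiff_gaussRatio hp
  rw [← lintegral_finsetSum _ fun k _ => measurable_fisherDens hF k, fisherInfo]
  have hm : Measurable fun x : EuclideanSpace ℝ (Fin n) =>
      ∑ k, fisherDens (gaussRatio p) k (WithLp.ofLp x) :=
    Finset.measurable_sum _ fun k _ =>
      (measurable_fisherDens hF k).comp (WithLp.measurable_ofLp 2 _)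
  have e := lintegral_toLp_stdPi hm
  refine Eq.trans ?_ e.symm
  refine lintegral_congr fun x => ?_
  have hq := gaussDensity_pos x
  simp only [fisherDens]
  rw [← ENNReal.ofReal_sum_of_nonneg fun k _ => div_nonneg (sq_nonneg _)
    (gaussRatio_nonneg hp0 _), ← ENNReal.ofReal_mul' hq.le]
  congr 1
  rw [EuclideanSpace.real_norm_sq_eq, Finset.sum_mul, Finset.sum_mul]
  refine Finset.sum_congr rfl fun k _ => ?_
  rw [pderiv_gaussRatio hp, gaussRatio, WithLp.toLp_ofLp]
  simp only [PiLp.sub_apply, PiLp.smul_apply, smul_eq_mul]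
  rcases (hp0 x).eq_or_lt with h | h
  · rw [← h]; simp
  · field_simp

end Density

section CondExp

variable {Ω : Type*} [MeasurableSpace Ω] {P : Measure Ω} [IsProbabilityMeasure P] {n : ℕ}
  {X : Ω → EuclideanSpace ℝ (Fin n)} {F : (Fin n → ℝ) → ℝ}

lemma FreeOf.apply_ite {α : Type*} {k : Fin n} {c : (Fin n → ℝ) → α} (hc : FreeOf (tailSet n k) c)
    (y : Fin n → ℝ) : c (fun i => if i < k then y i else 0) = c y :=
  hc fun i hi => if_pos (by rw [mem_tailSet] at hi; exact not_le.1 hi)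

/-- The conditional mean is a version of the conditional expectation. -/
lemma condExp_pastSigma_ae_eq (hX : Measurable X) (hF : Measurable F)
    (hmass : ∫⁻ x, ENNReal.ofReal (F x) ∂stdPi n = 1)
    (hlaw : P.map (fun ω => (X ω).ofLp) = lawPi F) (k : Fin n)
    (hi : Integrable (fun x : Fin n → ℝ => x k) (lawPi F)) (hmi : Integrable (condMean F k) (lawPi F)) :
    P[fun ω => X ω k | pastSigma X k] =ᵐ[P] fun ω => condMean F k (X ω).ofLp := by
  have hY : Measurable fun ω => (X ω).ofLp := (WithLp.measurable_ofLp 2 _).comp hX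
  have hYk : ∀ j, Measurable fun ω => X ω j := fun j => (measurable_pi_apply j).comp hY
  have hle : pastSigma X k ≤ ‹MeasurableSpace Ω› := iSup₂_le fun j _ => (hYk j).comap_le
  set pr : (Fin n → ℝ) → Fin n → ℝ := fun y i => if i < k then y i else 0 with hpr
  have hprm : Measurable pr := measurable_pi_lambda _ fun i => by
    by_cases h : i < k
    · simpa [hpr, h] using measurable_pi_apply i
    · simp [hpr, h]
  have hprY : Measurable[pastSigma X k] fun ω => pr (X ω).ofLp := by
    refine @measurable_pi_lambda _ _ _ (pastSigma X k) _ _ fun i => ?_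
    by_cases h : i < k
    · simp only [hpr, h, if_true]
      exact (comap_measurable _).mono (le_iSup₂_of_le i h le_rfl) le_rfl
    · simp only [hpr, h, if_false]
      exact measurable_const
  have hcomap : pastSigma X k ≤ MeasurableSpace.comap (fun ω => pr (X ω).ofLp) inferInstance := by
    refine iSup₂_le fun j hj => ?_
    rintro _ ⟨B, hB, rfl⟩
    refine ⟨(fun y => y j) ⁻¹' B, measurable_pi_apply j hB, ?_⟩
    ext ω; simp [hpr, hj]
  have hcm := measurable_condMean hF k
  have hXi : Integrable (fun ω => X ω k) P := by
    rw [← hlaw] at hi; exact hi.comp_measurable hY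
  have hMi : Integrable (fun ω => condMean F k (X ω).ofLp) P := by
    rw [← hlaw] at hmi; exact hmi.comp_measurable hY
  refine (ae_eq_condExp_of_forall_setIntegral_eq hle hXi (fun s _ _ => hMi.integrableOn)
    (fun s hs _ => ?_) ?_).symm
  · obtain ⟨A, hA, rfl⟩ := hcomap s hs
    have hs' : MeasurableSet ((fun ω => pr (X ω).ofLp) ⁻¹' A) := hle _ hs
    set c : (Fin n → ℝ) → ℝ := fun y => A.indicator 1 (pr y) with hc
    have hcmeas : Measurable c := (measurable_one.indicator hA).comp hprm
    have hcfree : FreeOf (tailSet n k) c := fun x y hxy => by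
      have : pr x = pr y := by
        ext i
        by_cases h : i < k
        · simp only [hpr, h, if_true]
          exact hxy i (by rw [mem_tailSet]; exact not_le.2 h)
        · simp only [hpr, h, if_false]
      simp only [hc, this]
    have hset : ∀ g : (Fin n → ℝ) → ℝ, Measurable g →
        ∫ ω in (fun ω => pr (X ω).ofLp) ⁻¹' A, g (X ω).ofLp ∂P = ∫ x, c x * g x ∂lawPi F := by
      intro g hg
      have hcg : Measurable fun x => c x * g x := hcmeas.mul hg
      rw [← integral_indicator hs', ← hlaw, integral_map hY.aemeasurable hcg.aestronglyMeasurable]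
      refine integral_congr_ae (ae_of_all _ fun ω => ?_)
      by_cases h : pr (X ω).ofLp ∈ A
      · simp [hc, h]
      · simp [hc, h]
    rw [hset _ hcm, hset _ (measurable_pi_apply k)]
    refine (integral_mul_lawPi hF hmass k hcfree hcmeas ?_).symm
    refine hi.bdd_mul (c := 1) hcmeas.aestronglyMeasurable (ae_of_all _ fun x => ?_)
    simp only [hc, indicator]; split_ifs <;> simp
  · refine Measurable.aestronglyMeasurable ?_
    have h := hcm.comp hprY
    convert h using 1
    ext ω
    exact ((freeOf_condMean F k).apply_ite _).symm

end CondExp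

lemma klDiv_map_toLp {n : ℕ} {μ : Measure (Fin n → ℝ)} [IsFiniteMeasure μ] :
    klDiv (μ.map (WithLp.toLp 2)) (stdGaussian (EuclideanSpace ℝ (Fin n))) = klDiv μ (stdPi n) := by
  rw [← map_pi_eq_stdGaussian]
  exact klDiv_map_of_injective (WithLp.measurable_toLp 2 _) (WithLp.toLp_injective 2)

/-- The triangular transport map yields a coupling of the recentered law and the Gaussian measure. -/
lemma transportCost_map_le {n : ℕ} {F : (Fin n → ℝ) → ℝ} (hF : Measurable F)
    (hmass : ∫⁻ x, ENNReal.ofReal (F x) ∂stdPi n = 1) :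
    transportCost (((lawPi F).map fun x k => x k - condMean F k x).map (WithLp.toLp 2))
      (stdGaussian (EuclideanSpace ℝ (Fin n))) ≤ ∑ k, meanCost F k := by
  have hL : Measurable (WithLp.toLp 2 : (Fin n → ℝ) → EuclideanSpace ℝ (Fin n)) :=
    WithLp.measurable_toLp 2 _
  have hSk := fun k => (measurable_pi_apply (X := fun _ : Fin n => ℝ) k).sub (measurable_condMean hF k)
  have hS : Measurable fun (x : Fin n → ℝ) k => x k - condMean F k x := measurable_pi_lambda _ hSk
  have hT : Measurable fun (x : Fin n → ℝ) k => triMap F k x :=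
    measurable_pi_lambda _ (measurable_triMap hF)
  have hJ : Measurable fun x : Fin n → ℝ => ((WithLp.toLp 2 fun k => x k - condMean F k x :
      EuclideanSpace ℝ (Fin n)), (WithLp.toLp 2 fun k => triMap F k x : EuclideanSpace ℝ (Fin n))) :=
    (hL.comp hS).prodMk (hL.comp hT)
  have hcost : Measurable fun w : EuclideanSpace ℝ (Fin n) × EuclideanSpace ℝ (Fin n) =>
      ENNReal.ofReal (Delta ‖w.1 - w.2‖) :=
    (measurable_Delta.comp (measurable_fst.sub measurable_snd).norm).ennreal_ofReal
  have hk : ∀ k, Measurable fun x : Fin n → ℝ =>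
      ENNReal.ofReal (Delta |x k - condMean F k x - triMap F k x|) := fun k =>
    (measurable_Delta.comp ((hSk k).sub (measurable_triMap hF k)).abs).ennreal_ofReal
  refine (iInf₂_le ((lawPi F).map fun x => ((WithLp.toLp 2 fun k => x k - condMean F k x),
    (WithLp.toLp 2 fun k => triMap F k x))) ⟨?_, ?_⟩).trans ?_
  · rw [lintegral_map hcost hJ]
    have e : ∀ k, meanCost F k
        = ∫⁻ x, ENNReal.ofReal (Delta |x k - condMean F k x - triMap F k x|) ∂lawPi F :=
      fun k => (lintegral_lawPi hF (hk k)).symm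
    simp_rw [e]
    rw [← lintegral_finsetSum _ fun k _ => hk k]
    refine lintegral_mono fun x => ?_
    rw [← ENNReal.ofReal_sum_of_nonneg fun k _ => Delta_abs_nonneg _]
    exact ENNReal.ofReal_le_ofReal (Delta_norm_le _)
  · rw [Measure.map_map measurable_fst hJ, Measure.map_map hL hS]; rfl
  · have h := congrArg (Measure.map (WithLp.toLp 2)) (map_triMap hF hmass)
    rw [Measure.map_map hL hT, map_pi_eq_stdGaussian] at h
    rw [Measure.map_map measurable_snd hJ, ← h]
    rfl

/-- Optimization over the free parameter. -/
lemma sq_le_of_forall_pos_le {T δ D : ℝ} (hT : 0 ≤ T) (hδ : 0 ≤ δ) (hD : 0 ≤ D)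
    (h : ∀ s : ℝ, 0 < s → T ≤ 8 * Real.pi * (s * δ + D / s)) :
    1 / (256 * Real.pi ^ 2) * (T ^ 2 / D) ≤ δ := by
  rcases hD.eq_or_lt with rfl | hD
  · simpa using hδ
  rcases hT.eq_or_lt with rfl | hT
  · simpa using hδ
  have hπ := Real.pi_pos
  have h1 := h (16 * Real.pi * D / T) (by positivity)
  have e : 8 * Real.pi * (16 * Real.pi * D / T * δ + D / (16 * Real.pi * D / T))
      = 128 * Real.pi ^ 2 * D * δ / T + T / 2 := by field_simp; ring
  rw [e] at h1
  have h2 : T / 2 ≤ 128 * Real.pi ^ 2 * D * δ / T := by linarith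
  rw [le_div_iff₀ hT] at h2
  rw [div_mul_div_comm, div_le_iff₀ (by positivity)]
  linarith

end

theorem theorem1p3 {Ω : Type*} [MeasurableSpace Ω] (P : Measure Ω) [IsProbabilityMeasure P]
    (n : ℕ) (X : Ω → EuclideanSpace ℝ (Fin n)) (hX : Measurable X)
    (p : EuclideanSpace ℝ (Fin n) → ℝ) (hp_nonneg : ∀ x, 0 ≤ p x) (hp_smooth : ContDiff ℝ (⊤ : ℕ∞) p)
    (hp_density : P.map X = volume.withDensity (fun x => ENNReal.ofReal (p x)))
    (hI : fisherInfo p (gaussDensity n) ≠ ∞) :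
    Integrable X P ∧
    klDiv (P.map X) (stdGaussian (EuclideanSpace ℝ (Fin n))) ≠ ∞ ∧
    klDiv (P.map (recenter P X)) (stdGaussian (EuclideanSpace ℝ (Fin n))) ≠ ∞ ∧
    transportCost (P.map (recenter P X)) (stdGaussian (EuclideanSpace ℝ (Fin n))) ≠ ∞ ∧
    1 / 2 * (fisherInfo p (gaussDensity n)).toReal
        - (klDiv (P.map X) (stdGaussian (EuclideanSpace ℝ (Fin n)))).toReal
      ≥ 1 / (256 * Real.pi ^ 2) *
        ((transportCost (P.map (recenter P X))
            (stdGaussian (EuclideanSpace ℝ (Fin n)))).toReal ^ 2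
          / (klDiv (P.map (recenter P X))
              (stdGaussian (EuclideanSpace ℝ (Fin n)))).toReal) := by
  have hp : ContDiff ℝ 1 p := hp_smooth.of_le (by exact_mod_cast le_top)
  have hL : Measurable (WithLp.toLp 2 : (Fin n → ℝ) → EuclideanSpace ℝ (Fin n)) :=
    WithLp.measurable_toLp 2 _
  have ho : Measurable (WithLp.ofLp : EuclideanSpace ℝ (Fin n) → Fin n → ℝ) :=
    WithLp.measurable_ofLp 2 _
  have hY : Measurable fun ω => (X ω).ofLp := ho.comp hX
  have hF0 := gaussRatio_nonneg hp_nonneg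
  have hF := contDiff_gaussRatio hp
  have hsum := fisherInfo_eq_sum hp hp_nonneg
  have hlaw : P.map (fun ω => (X ω).ofLp) = lawPi (gaussRatio p) := by
    rw [← map_ofLp_withDensity hp, ← hp_density, Measure.map_map ho hX]
    rfl
  set F := gaussRatio p
  have hFm : Measurable F := hF.continuous.measurable
  have hmass : ∫⁻ x, ENNReal.ofReal (F x) ∂stdPi n = 1 := by
    have h : (lawPi F) Set.univ = 1 := by
      rw [← hlaw, Measure.map_apply hY MeasurableSet.univ]; simp
    simpa using h
  have hμ := isProbabilityMeasure_lawPi hmass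
  rw [hsum] at hI ⊢
  have hQ : ∀ k, ∫⁻ x, fisherDens F k x ∂stdPi n ≠ ∞ := fun k =>
    ENNReal.sum_ne_top.1 hI k (Finset.mem_univ k)
  have hE := memLp_eval hF hF0 hmass hQ
  have hM := memLp_condMean hF hF0 hmass hQ
  obtain ⟨hD, hDbar, hDbarEq⟩ := klDiv_map_shear_condMean hF hF0 hmass hQ
  have hSm : Measurable fun (x : Fin n → ℝ) k => x k - condMean F k x :=
    measurable_pi_lambda _ fun k => (measurable_pi_apply k).sub (measurable_condMean hFm k)
  have hXlaw : P.map X = (lawPi F).map (WithLp.toLp 2) := by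
    rw [← hlaw, Measure.map_map hL hY]; rfl
  have hRlaw : P.map (recenter P X)
      = ((lawPi F).map fun x k => x k - condMean F k x).map (WithLp.toLp 2) := by
    rw [← hlaw, Measure.map_map hL hSm, Measure.map_map (hL.comp hSm) hY]
    refine Measure.map_congr ?_
    have h := ae_all_iff.2 fun k => condExp_pastSigma_ae_eq hX hFm hmass hlaw k
      ((hE k).integrable one_le_two) ((hM k).integrable one_le_two)
    filter_upwards [h] with ω hω
    simp only [recenter, Function.comp_apply, hω]
  have hT := transportCost_map_le hFm hmass
  have hprobS : IsProbabilityMeasure ((lawPi F).map fun x k => x k - condMean F k x) :=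
    Measure.isProbabilityMeasure_map hSm.aemeasurable
  rw [hRlaw, hXlaw, klDiv_map_toLp, klDiv_map_toLp, hD]
  set T := transportCost (((lawPi F).map fun x k => x k - condMean F k x).map (WithLp.toLp 2))
    (stdGaussian (EuclideanSpace ℝ (Fin n)))
  have hDt : ∑ k, meanEnt F k ≠ ∞ :=
    ENNReal.sum_ne_top.2 fun k _ => meanEnt_ne_top hF hF0 hmass k (hQ k)
  have hMle : ∑ k, meanSq F k ≤ 2 * ∑ k, meanEnt F k := by
    rw [Finset.mul_sum]
    exact Finset.sum_le_sum fun k _ => meanSq_le hF hF0 hmass k (hQ k)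
  have hDI : 2 * ∑ k, meanEnt F k ≤ ∑ k, ∫⁻ x, fisherDens F k x ∂stdPi n := by
    rw [Finset.mul_sum]
    exact Finset.sum_le_sum fun k _ => two_mul_meanEnt_le hF hF0 hmass k (hQ k)
  have hMt : ∑ k, meanSq F k ≠ ∞ := ne_top_of_le_ne_top (ENNReal.mul_ne_top (by simp) hDt) hMle
  have hbound := fun (s : ℝ) (hs : 0 < s) =>
    (add_le_add_left (add_le_add_left hT (ENNReal.ofReal (8 * Real.pi * s) * ∑ k, meanEnt F k))
      (ENNReal.ofReal (4 * Real.pi / s) * ∑ k, meanSq F k)).trans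
      (sum_meanCost_add_le hF hF0 hmass hQ hs)
  have hTt : T ≠ ∞ := by
    have h := hbound 1 one_pos
    refine ne_top_of_le_ne_top ?_ ((le_add_right le_self_add).trans h)
    exact ENNReal.add_ne_top.2 ⟨ENNReal.mul_ne_top ENNReal.ofReal_ne_top hI,
      ENNReal.mul_ne_top ENNReal.ofReal_ne_top hDt⟩
  refine ⟨Integrable.of_eval_piLp fun k => ?_, hDt, hDbar, hTt, ?_⟩
  · have h := (hE k).integrable one_le_two
    rw [← hlaw] at h
    exact h.comp_measurable hY
  rw [hDbarEq]
  set I := ∑ k, ∫⁻ x, fisherDens F k x ∂stdPi n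
  set D := ∑ k, meanEnt F k
  set M := ∑ k, meanSq F k
  have h1 : M.toReal ≤ 2 * D.toReal := by
    have := ENNReal.toReal_mono (ENNReal.mul_ne_top (by simp) hDt) hMle
    simpa [ENNReal.toReal_mul] using this
  have h2 : 2 * D.toReal ≤ I.toReal := by
    have := ENNReal.toReal_mono hI hDI
    simpa [ENNReal.toReal_mul] using this
  refine sq_le_of_forall_pos_le ENNReal.toReal_nonneg (by linarith) (by linarith) fun s hs => ?_
  have hπ := Real.pi_pos
  have h := hbound s hs
  rw [← ENNReal.ofReal_toReal hTt, ← ENNReal.ofReal_toReal hDt, ← ENNReal.ofReal_toReal hMt,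
    ← ENNReal.ofReal_toReal hI, ← ENNReal.ofReal_mul (by positivity),
    ← ENNReal.ofReal_mul (by positivity), ← ENNReal.ofReal_mul (by positivity),
    ← ENNReal.ofReal_mul (by positivity), ← ENNReal.ofReal_add (by positivity) (by positivity),
    ← ENNReal.ofReal_add (by positivity) (by positivity),
    ← ENNReal.ofReal_add (by positivity) (by positivity),
    ENNReal.ofReal_le_ofReal_iff (by positivity)] at h
  have e : 8 * Real.pi * (s * (1 / 2 * I.toReal - D.toReal) + (D.toReal - M.toReal / 2) / s)
      = 4 * Real.pi * s * I.toReal + 8 * Real.pi / s * D.toReal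
        - 8 * Real.pi * s * D.toReal - 4 * Real.pi / s * M.toReal := by
    field_simp; ring
  rw [e]
  linarith
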